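/- **Setting.** Let $\mathbf k$ be a field of characteristic zero or, more generally, a $\mathbb Z_2$-graded commutative ring whose even part $\mathbf k_0$ is a field of characteristic zero. Let $V=V_0\oplus V_1$ be a $\mathbb Z_2$-graded $\mathbf k$-module (with $vt=(-1)^{|t||v|}tv$), equipped with an inner product: an even right $\mathbf k$-module homomorphism $\langle\cdot,\cdot\rangle:V\otimes V\to\mathbf k$ which is graded symmetric, $\langle v,w\rangle=(-1)^{|v||w|}\langle w,v\rangle$, and non-degenerate in the sense that $v\mapsto\langle v,\cdot\rangle$ is an isomorphism $V\to\mathrm{Hom}(V,\mathbf k)$. For $v_1,\dots,v_n$ homogeneous and a permutation $\sigma$, let $\epsilon(\sigma)$ be the Koszul sign of $v_1\cdots v_n\mapsto v_{\sigma(1)}\cdots v_{\sigma(n)}$ and $(-1)^\sigma$ the sign of $\sigma$; let $\mathrm{Sh}(p,q)$ be the set of unshuffles (permutations of $p+q$ letters increasing on the first $p$ and on the last $q$ positions). Let $C(V)=\mathrm{Hom}(\bigwedge V,V)=\prod_{k\ge1}\mathrm{Hom}(\bigwedge^kV,V)$, where $\bigwedge^k V$ is the graded exterior power (so elements are graded antisymmetric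 $\mathbf k$-multilinear maps); $\varphi=(\varphi_k)_{k\ge 1}$, and a homogeneous $\varphi_k$ has bidegree $(|\varphi_k|,k-1)$. All indices $k,l$ below are $\geq 1$. For homogeneous $\varphi_k,\psi_l$ and $n=k+l-1$ put $$(\varphi_k\circ\psi_l)(v_1,\dots,v_n)=\sum_{\sigma\in \mathrm{Sh}(l,k-1)}(-1)^\sigma\epsilon(\sigma)\,\varphi_k(\psi_l(v_{\sigma(1)},\dots,v_{\sigma(l)}),v_{\sigma(l+1)},\dots,v_{\sigma(n)}),$$ $$[\varphi_k,\psi_l]=\varphi_k\circ\psi_l-(-1)^{|\varphi_k||\psi_l|+(k-1)(l-1)}\psi_l\circ\varphi_k,\qquad \{\varphi_k,\psi_l\}=(-1)^{(k-1)|\psi_l|}[\varphi_k,\psi_l],$$ and extend the modified bracket biadditively to $C(V)$ by $\{\varphi,\psi\}_n=\sum_{k+l=n+1}\{\varphi_k,\psi_l\}$. A homogeneous $\varphi_k$ is *cyclic* if $\langle\varphi_k(v_1,\dots,v_k),v_{k+1}\rangle=(-1)^{k+|v_1||\varphi_k|}\langle v_1,\varphi_k(v_2,\dots,v_{k+1})\rangle$;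 $\varphi\in C(V)$ is cyclic if all homogeneous components of all $\varphi_k$ are. Let $CC(V)\subseteq C(V)$ be the module of cyclic elements, and $\tilde\varphi_k(v_1,\dots,v_{k+1})=\langle\varphi_k(v_1,\dots,v_k),v_{k+1}\rangle$; $\varphi\mapsto\tilde\varphi=(\tilde\varphi_k)_{k\ge1}$ is a bijection of $CC(V)$ onto $\prod_{k\ge1}\mathrm{Hom}(\bigwedge^{k+1}V,\mathbf k)$, and the two modules, with their bidegrees $(|\varphi_k|,k-1)$, are identified by it. Each element of this product decomposes uniquely into its bihomogeneous components. **Theorem.** i) If $\varphi,\psi\in C(V)$ are cyclic, then $\{\varphi,\psi\}$ is cyclic, and if every $\psi_l$ is homogeneous then, for homogeneous $v_i$ and all $n\ge1$, $$\widetilde{\{\varphi,\psi\}}(v_1,\dots,v_{n+1})=\sum_{\substack{k+l=n+1\\ \sigma\in \mathrm{Sh}(l,k)}}(-1)^\sigma\epsilon(\sigma)(-1)^{(k-1)|\psi_l|}\,\tilde\varphi_k(\psi_l(v_{\sigma(1)},\dots,v_{\sigma(l)}),v_{\sigma(l+1)},\dots,v_{\sigma(n+1)}).$$ Thus $\{\tilde\varphi,\tilde\psi\}=\widetilde{\{\varphi,\psi\}}$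 defines on $CC(V)$ the structure of a $\mathbb Z_2\times\mathbb Z$-graded Lie algebra over $\mathbf k$ with respect to the form $\langle(m,n),(m',n')\rangle=(m+n)(m'+n')$ on $\mathbb Z_2\times\mathbb Z$; equally, it is a $\mathbb Z_2$-graded Lie algebra with respect to the total parity, which is $q+d$ in bidegree $(q,d)$. ii) Let $l\in C(V)$ be an $L_\infty$ structure on $V$, i.e. $l_k$ has parity $k \bmod 2$ and for all $n\geq 1$ and homogeneous $v_i$ $$\sum_{\substack{k+j=n+1\\ \sigma\in \mathrm{Sh}(j,n-j)}}(-1)^\sigma\epsilon(\sigma)(-1)^{(k-1)j}\,l_k(l_j(v_{\sigma(1)},\dots,v_{\sigma(j)}),v_{\sigma(j+1)},\dots,v_{\sigma(n)})=0 .$$ Then (whether or not $l$ is cyclic) there is a $\mathbf k$-linear differential $D$ on $CC(V)$, i.e. $D^2=0$ and $D$ is odd for the total parity, given by $$D(\tilde\varphi)(v_1,\dots,v_{n+1})=\sum_{\substack{k+j=n+1\\ \sigma\in \mathrm{Sh}(j,k)}}(-1)^\sigma\epsilon(\sigma)(-1)^{(k-1)j}\,\tilde\varphi_k(l_j(v_{\sigma(1)},\dots,v_{\sigma(j)}),v_{\sigma(j+1)},\dots,v_{\sigma(n+1)}).$$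 iii) If moreover the inner product is invariant, i.e. $l$ is cyclic, then $D(\tilde\varphi)=\{\tilde\varphi,\tilde l\}$, and $CC(V)$ with $\{\cdot,\cdot\}$ and $D$ is a differential graded Lie algebra, graded by the total parity $|\cdot|$, with derivation rule $D\{x,y\}=\{x,Dy\}+(-1)^{|y|}\{Dx,y\}$. -/

import Mathlib

open scoped BigOperators

namespace LInfty

/-! ### Signs -/

/-- The sign `(-1)^z` for `z` in `ℤ/2`. -/
def ksign (z : ZMod 2) : ℤ := if z = 0 then 1 else -1

/-- The Koszul sign `ε(σ; v₁, …, v_N)` of the rearrangement `v_{σ(1)}, …, v_{σ(N)}` of homogeneous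
elements `v_i` of parity `p i`: the product over all inversions of `σ` of `(-1)^{|v_{σ i}||v_{σ j}|}`. -/
def koszul {N : ℕ} (σ : Equiv.Perm (Fin N)) (p : Fin N → ZMod 2) : ℤ :=
  ∏ i, ∏ j, if i < j ∧ σ j < σ i then ksign (p (σ i) * p (σ j)) else 1

/-- The unshuffles of type `(l, N - l)`: permutations of `N` letters that are increasing on the first
`l` positions and increasing on the remaining positions. -/
def unshuffles (l N : ℕ) : Finset (Equiv.Perm (Fin N)) :=
  Finset.univ.filter fun σ => ∀ i j : Fin N, i < j → (j.val < l ∨ l ≤ i.val) → σ i < σ j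

/-- The `i`-th entry of `v` (used only with `i < N`). -/
def argAt {X : Type*} [Zero X] {N : ℕ} (v : Fin N → X) (i : ℕ) : X :=
  if h : i < N then v ⟨i, h⟩ else 0

/-! ### Ground ring, supermodules, inner products -/

section Super

variable {K V : Type*} [Ring K] [AddCommGroup V] [Module K V] [Module Kᵐᵒᵖ V]

/-- Graded commutativity of a `ℤ/2`-graded ring. -/
def IsSupercommutative (𝒦 : ZMod 2 → AddSubgroup K) : Prop :=
  ∀ (i j : ZMod 2) (a b : K), a ∈ 𝒦 i → b ∈ 𝒦 j → a * b = ksign (i * j) • (b * a)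

/-- `V = V₀ ⊕ V₁` is a `ℤ/2`-graded module; the left and the right action of the ground ring are
related by `v t = (-1)^{|t||v|} t v`. -/
structure IsSupermodule (𝒦 : ZMod 2 → AddSubgroup K) (𝒱 : ZMod 2 → AddSubgroup V) : Prop where
  smul_mem : ∀ (s p : ZMod 2) (t : K) (v : V), t ∈ 𝒦 s → v ∈ 𝒱 p → t • v ∈ 𝒱 (s + p)
  op_smul : ∀ (s p : ZMod 2) (t : K) (v : V), t ∈ 𝒦 s → v ∈ 𝒱 p →
    MulOpposite.op t • v = ksign (s * p) • (t • v)

/-- An even inner product: a right module homomorphism `V ⊗ V → K` (tensor product over `K`) that is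
even, graded symmetric and non-degenerate, i.e. `v ↦ ⟨v, ·⟩` is a bijection from `V` onto the
module of right module homomorphisms `V → K`. -/
structure IsInnerProduct (𝒦 : ZMod 2 → AddSubgroup K) (𝒱 : ZMod 2 → AddSubgroup V)
    (ip : V →+ V →+ K) : Prop where
  balanced : ∀ (v w : V) (t : K), ip (MulOpposite.op t • v) w = ip v (t • w)
  map_op_smul : ∀ (v w : V) (t : K), ip v (MulOpposite.op t • w) = ip v w * t
  even : ∀ (p q : ZMod 2) (v w : V), v ∈ 𝒱 p → w ∈ 𝒱 q → ip v w ∈ 𝒦 (p + q)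
  symm : ∀ (p q : ZMod 2) (v w : V), v ∈ 𝒱 p → w ∈ 𝒱 q → ip v w = ksign (p * q) • ip w v
  nondegenerate : ∀ g : V →ₗ[Kᵐᵒᵖ] K, ∃! v : V, ∀ w, ip v w = g w

/-! ### Cochains -/

/-- `f` is an element of `Hom(⋀^{m+1} V, X)`: it is additive in every variable, balanced over `K`
(so that it is a map on the tensor power over `K`), a right `K`-module homomorphism, and
graded antisymmetric. -/
structure IsCochain (K : Type*) {V X : Type*} [Ring K] [AddCommGroup V] [Module K V]
    [Module Kᵐᵒᵖ V] [AddCommGroup X] [Module Kᵐᵒᵖ X] (𝒱 : ZMod 2 → AddSubgroup V) {m : ℕ}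
    (f : (Fin (m + 1) → V) → X) : Prop where
  add : ∀ (v : Fin (m + 1) → V) (i : Fin (m + 1)) (x y : V),
    f (Function.update v i (x + y)) = f (Function.update v i x) + f (Function.update v i y)
  balanced : ∀ (v : Fin (m + 1) → V) (i : Fin m) (t : K),
    f (Function.update v i.castSucc (MulOpposite.op t • v i.castSucc)) =
      f (Function.update v i.succ (t • v i.succ))
  map_op_smul : ∀ (v : Fin (m + 1) → V) (t : K),
    f (Function.update v (Fin.last m) (MulOpposite.op t • v (Fin.last m))) =
      MulOpposite.op t • f v
  antisymm : ∀ (v : Fin (m + 1) → V) (p : Fin (m + 1) → ZMod 2), (∀ i, v i ∈ 𝒱 (p i)) →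
    ∀ σ : Equiv.Perm (Fin (m + 1)),
      f v = ((Equiv.Perm.sign σ : ℤ) * koszul σ p) • f fun i => v (σ i)

/-- A sequence `φ` of maps; `φ d` has `d + 1` arguments, so that it has exterior degree `d`. In the
notation `φ = (φ_k)_{k ≥ 1}` with `φ_k : ⋀^k V → V` one has `φ d = φ_{d+1}`. -/
abbrev CochainFamily (V : Type*) := ∀ d : ℕ, (Fin (d + 1) → V) → V

/-- A sequence of scalar valued maps; the one of exterior degree `d` has `d + 2` arguments. -/
abbrev FormFamily (V K : Type*) := ∀ d : ℕ, (Fin (d + 2) → V) → K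

/-- `φ` lies in `C(V) = Hom(⋀ V, V) = ∏_{k ≥ 1} Hom(⋀^k V, V)`. -/
def InC (K : Type*) {V : Type*} [Ring K] [AddCommGroup V] [Module K V] [Module Kᵐᵒᵖ V]
    (𝒱 : ZMod 2 → AddSubgroup V) (φ : CochainFamily V) : Prop :=
  ∀ d, IsCochain K 𝒱 (φ d)

/-- `f` is homogeneous of parity `q`. -/
def HasParity {X : Type*} [AddCommGroup X] (𝒱 : ZMod 2 → AddSubgroup V)
    (𝒳 : ZMod 2 → AddSubgroup X) (q : ZMod 2) {N : ℕ} (f : (Fin N → V) → X) : Prop :=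
  ∀ (v : Fin N → V) (p : Fin N → ZMod 2), (∀ i, v i ∈ 𝒱 (p i)) → f v ∈ 𝒳 (q + ∑ i, p i)

/-- The component of parity `p` of `x`. -/
def proj (𝒱 : ZMod 2 → AddSubgroup V) [DirectSum.Decomposition 𝒱] (p : ZMod 2) (x : V) : V :=
  (DirectSum.decompose 𝒱 x p : V)

/-- The component of parity `q` of a multi-additive map `f`. -/
def parityPart (𝒱 : ZMod 2 → AddSubgroup V) [DirectSum.Decomposition 𝒱] (q : ZMod 2) {N : ℕ}
    (f : (Fin N → V) → V) : (Fin N → V) → V :=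
  fun v => ∑ p : Fin N → ZMod 2, proj 𝒱 (q + ∑ i, p i) (f fun i => proj 𝒱 (p i) (v i))

/-- The map associated with `φ` by the inner product,
`φ̃(v_1, …, v_{n+1}) = ⟨φ(v_1, …, v_n), v_{n+1}⟩`. -/
def tilde (ip : V →+ V →+ K) (φ : CochainFamily V) : FormFamily V K :=
  fun d v => ip (φ d fun i => v i.castSucc) (v (Fin.last (d + 1)))

/-- `f : V^n → V`, `n = d + 1`, is cyclic: each homogeneous component `f^q` satisfies
`⟨f^q(v_1, …, v_n), v_{n+1}⟩ = (-1)^{n + |v_1| q} ⟨v_1, f^q(v_2, …, v_{n+1})⟩`. -/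
def IsCyclic (𝒱 : ZMod 2 → AddSubgroup V) [DirectSum.Decomposition 𝒱] (ip : V →+ V →+ K) {d : ℕ}
    (f : (Fin (d + 1) → V) → V) : Prop :=
  ∀ (q : ZMod 2) (v : Fin (d + 2) → V) (p : Fin (d + 2) → ZMod 2), (∀ i, v i ∈ 𝒱 (p i)) →
    ip (parityPart 𝒱 q f fun i => v i.castSucc) (v (Fin.last (d + 1))) =
      ksign ((d : ZMod 2) + 1 + p 0 * q) • ip (v 0) (parityPart 𝒱 q f fun i => v i.succ)

/-- `CC(V)`: the set of all cyclic elements of `C(V)`. -/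
def CC (𝒱 : ZMod 2 → AddSubgroup V) [DirectSum.Decomposition 𝒱] (ip : V →+ V →+ K) :
    Set (CochainFamily V) :=
  {φ | InC K 𝒱 φ ∧ ∀ d, IsCyclic 𝒱 ip (φ d)}

/-! ### Insertion along unshuffles and the brackets -/

/-- `∑_{σ ∈ Sh(b+1, m)} (-1)^σ ε(σ) f(g(v_{σ(1)}, …, v_{σ(b+1)}), v_{σ(b+2)}, …, v_{σ(N)})` for
homogeneous `v_i` of parity `p i` and `N = b + 1 + m`. -/
def insertAt {X : Type*} [AddCommGroup X] {m b N : ℕ} (f : (Fin (m + 1) → V) → X)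
    (g : (Fin (b + 1) → V) → V) (p : Fin N → ZMod 2) (v : Fin N → V) : X :=
  ∑ σ ∈ unshuffles (b + 1) N, ((Equiv.Perm.sign σ : ℤ) * koszul σ p) •
    f (Fin.cons (g fun i => argAt (fun s => v (σ s)) i)
      fun j : Fin m => argAt (fun s => v (σ s)) (b + 1 + j))

/-- The multi-additive extension of `insertAt` to arbitrary arguments. -/
def insertion (𝒱 : ZMod 2 → AddSubgroup V) [DirectSum.Decomposition 𝒱] {m b N : ℕ}
    (f : (Fin (m + 1) → V) → V) (g : (Fin (b + 1) → V) → V) (v : Fin N → V) : V :=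
  ∑ p : Fin N → ZMod 2, insertAt f g p fun i => proj 𝒱 (p i) (v i)

/-- The bracket of coderivations `[f, g]` for `f` of bidegree `(q, a)` and `g` of bidegree `(r, b)`;
here `N = a + b + 1`. -/
def coderBracket (𝒱 : ZMod 2 → AddSubgroup V) [DirectSum.Decomposition 𝒱] {a b N : ℕ}
    (q r : ZMod 2) (f : (Fin (a + 1) → V) → V) (g : (Fin (b + 1) → V) → V) (v : Fin N → V) : V :=
  insertion 𝒱 f g v - ksign (q * r + (a : ZMod 2) * b) • insertion 𝒱 g f v

/-- The modified bracket `{φ, ψ}` on `C(V)`: the biadditive extension of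
`{φ_k, ψ_l} = (-1)^{deg(φ_k) |ψ_l|} [φ_k, ψ_l]` (with `deg φ_k = k - 1`) to sequences of not
necessarily homogeneous cochains, `{φ, ψ}_n = ∑_{k + l = n + 1} {φ_k, ψ_l}`. -/
def modBracket (𝒱 : ZMod 2 → AddSubgroup V) [DirectSum.Decomposition 𝒱]
    (φ ψ : CochainFamily V) : CochainFamily V :=
  fun d v => ∑ ab ∈ Finset.HasAntidiagonal.antidiagonal d, ∑ q : ZMod 2, ∑ r : ZMod 2,
    ksign ((ab.1 : ZMod 2) * r) •
      coderBracket 𝒱 q r (parityPart 𝒱 q (φ ab.1)) (parityPart 𝒱 r (ψ ab.2)) v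

/-- `l` is an `L_∞` structure: `l_k ∈ Hom(⋀^k V, V)` has parity `k`, and
`∑_{k+l=n+1} ∑_{σ ∈ Sh(l, n-l)} (-1)^σ ε(σ) (-1)^{(k-1) l} l_k(l_l(v_{σ(1)}, …), …, v_{σ(n)}) = 0`. -/
structure IsLInfty (K : Type*) {V : Type*} [Ring K] [AddCommGroup V] [Module K V] [Module Kᵐᵒᵖ V]
    (𝒱 : ZMod 2 → AddSubgroup V) (l : CochainFamily V) : Prop where
  cochain : InC K 𝒱 l
  parity : ∀ d : ℕ, HasParity 𝒱 𝒱 ((d : ZMod 2) + 1) (l d)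
  relation : ∀ (d : ℕ) (v : Fin (d + 1) → V) (p : Fin (d + 1) → ZMod 2), (∀ i, v i ∈ 𝒱 (p i)) →
    ∑ ab ∈ Finset.HasAntidiagonal.antidiagonal d,
      ksign ((ab.1 : ZMod 2) * ((ab.2 : ZMod 2) + 1)) • insertAt (l ab.1) (l ab.2) p v = 0

/-! ### The module of scalar valued cochains and its gradings -/

/-- The module `∏_{n ≥ 1} Hom(⋀^{n+1} V, K)`. -/
def Forms (K : Type*) {V : Type*} [Ring K] [AddCommGroup V] [Module K V] [Module Kᵐᵒᵖ V]
    (𝒱 : ZMod 2 → AddSubgroup V) : Submodule K (FormFamily V K) where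
  carrier := {f | ∀ d, IsCochain K 𝒱 (f d)}
  zero_mem' d := ⟨by simp, by simp, by simp, by simp⟩
  add_mem' {f g} hf hg d := by
    refine ⟨fun v i x y => ?_, fun v i t => ?_, fun v t => ?_, fun v p hp σ => ?_⟩
    · simp only [Pi.add_apply, (hf d).add, (hg d).add]; abel
    · simp only [Pi.add_apply, (hf d).balanced, (hg d).balanced]
    · simp only [Pi.add_apply, (hf d).map_op_smul, (hg d).map_op_smul, smul_add]
    · simp only [Pi.add_apply, smul_add]
      rw [(hf d).antisymm v p hp σ, (hg d).antisymm v p hp σ]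
  smul_mem' c f hf d := by
    refine ⟨fun v i x y => ?_, fun v i t => ?_, fun v t => ?_, fun v p hp σ => ?_⟩
    · simp only [Pi.smul_apply, (hf d).add, smul_add]
    · simp only [Pi.smul_apply, (hf d).balanced]
    · simp only [Pi.smul_apply, (hf d).map_op_smul, smul_eq_mul, MulOpposite.smul_eq_mul_unop,
        mul_assoc]
    · simp only [Pi.smul_apply, smul_eq_mul]
      rw [(hf d).antisymm v p hp σ, mul_smul_comm]

/-- The elements of bidegree `g = (parity, exterior degree)`. -/
def bidegreePart (𝒦 : ZMod 2 → AddSubgroup K) (𝒱 : ZMod 2 → AddSubgroup V) (g : ZMod 2 × ℤ) :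
    AddSubgroup (Forms K 𝒱) where
  carrier := {f | (∀ d : ℕ, (d : ℤ) ≠ g.2 → f.1 d = 0) ∧ ∀ d, HasParity 𝒱 𝒦 g.1 (f.1 d)}
  zero_mem' := ⟨fun _ _ => rfl, fun _ _ _ _ => zero_mem _⟩
  add_mem' {f f'} hf hf' :=
    ⟨fun d hd => by
      have h1 := hf.1 d hd
      have h2 := hf'.1 d hd
      change f.1 d + f'.1 d = 0
      rw [h1, h2, add_zero],
     fun d v p hp => add_mem (hf.2 d v p hp) (hf'.2 d v p hp)⟩
  neg_mem' {f} hf :=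
    ⟨fun d hd => by
      have h1 := hf.1 d hd
      change -(f.1 d) = 0
      rw [h1, neg_zero],
     fun d v p hp => neg_mem (hf.2 d v p hp)⟩

/-- The elements of total parity `s`, where an element of bidegree `(q, d)` has total parity
`q + d`. -/
def totalParityPart (𝒦 : ZMod 2 → AddSubgroup K) (𝒱 : ZMod 2 → AddSubgroup V) (s : ZMod 2) :
    AddSubgroup (Forms K 𝒱) where
  carrier := {f | ∀ d : ℕ, HasParity 𝒱 𝒦 (s + d) (f.1 d)}
  zero_mem' := fun _ _ _ _ => zero_mem _
  add_mem' hf hf' := fun d v p hp => add_mem (hf d v p hp) (hf' d v p hp)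
  neg_mem' hf := fun d v p hp => neg_mem (hf d v p hp)

/-- The form `⟨(m, n), (m', n')⟩ = (m + n)(m' + n')` on the grading group `ℤ/2 × ℤ`. -/
def totalForm (g h : ZMod 2 × ℤ) : ZMod 2 := (g.1 + (g.2 : ZMod 2)) * (h.1 + (h.2 : ZMod 2))

/-! ### Graded Lie algebras -/

/-- `B` is a graded Lie bracket on the `K`-module `L` with homogeneous parts `𝓛 g`, with respect to
the form `χ` on the grading group. Together with antisymmetry, linearity over `K` on the left
gives (graded) `K`-bilinearity. -/
structure IsGradedLieBracket (K : Type*) {L G : Type*} [Ring K] [AddCommGroup L] [Module K L]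
    [AddCommGroup G] (𝓛 : G → AddSubgroup L) (χ : G → G → ZMod 2) (B : L →+ L →+ L) : Prop where
  mem : ∀ (g h : G) (x y : L), x ∈ 𝓛 g → y ∈ 𝓛 h → B x y ∈ 𝓛 (g + h)
  smul_left : ∀ (t : K) (x y : L), B (t • x) y = t • B x y
  antisymm : ∀ (g h : G) (x y : L), x ∈ 𝓛 g → y ∈ 𝓛 h → B x y = -(ksign (χ g h) • B y x)
  jacobi : ∀ (g h : G) (x y z : L), x ∈ 𝓛 g → y ∈ 𝓛 h →
    B x (B y z) = B (B x y) z + ksign (χ g h) • B y (B x z)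

/-- `D` is an odd map of square zero. -/
structure IsDifferential {K L : Type*} [Ring K] [AddCommGroup L] [Module K L]
    (𝓛 : ZMod 2 → AddSubgroup L) (D : L →ₗ[K] L) : Prop where
  odd : ∀ (s : ZMod 2) (x : L), x ∈ 𝓛 s → D x ∈ 𝓛 (s + 1)
  sq_zero : ∀ x : L, D (D x) = 0

/-- `(L, B, D)` is a (`ℤ/2`-graded) differential graded Lie algebra; the derivation rule is
`D{x, y} = {x, D y} + (-1)^{|y|} {D x, y}`. -/
structure IsDGLie {K L : Type*} [Ring K] [AddCommGroup L] [Module K L]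
    (𝓛 : ZMod 2 → AddSubgroup L) (B : L →+ L →+ L) (D : L →ₗ[K] L) : Prop where
  lie : IsGradedLieBracket K 𝓛 (fun s t => s * t) B
  differential : IsDifferential 𝓛 D
  derivation : ∀ (s : ZMod 2) (x y : L), y ∈ 𝓛 s →
    D (B x y) = B x (D y) + ksign s • B (D x) y

end Super

end LInfty

namespace LInfty

/-! ### Signs with exponents in ℤ/2 -/

section Signs

/-! Everything rests on a décalage. Label each argument by its parity plus one and multiply each map
by the sign `decalage`. Graded antisymmetric maps then become graded symmetric ones, (-1)^σ ε(σ)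
becomes the Koszul sign of the labels, and the factor (-1)^((k-1)|ψ_l|) of the modified bracket is
absorbed. A whole sequence of maps becomes one function on lists of labelled letters, in which a
component of bidegree (q, d) has degree q + d. Inserting all ψ_l into all φ_k becomes a single sum
`listComp` over the splittings of a list into two complementary sublists.

Splitting is coassociative (`unshuffleSum_assoc`). Hence (f∘g)∘h is f∘(g∘h) plus a term in which g
and h fill two different arguments of f (`listComp_listComp`), and for symmetric f this term is
graded symmetric in g and h (`listPair_swap`). It therefore cancels in a commutator: insertion is a
right action of the graded commutator bracket on symmetric functions f, scalar valued or not
(`listComp_bracket`).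

For an antisymmetric φ, cyclicity says that φ̃ is graded symmetric in all its arguments, the last
one included; by non-degeneracy every symmetric form arises in this way (`bijOn_tilde`). Now
evaluate φ̃∘ψ on a list ending in w (`listComp_append_singleton`). The splittings that keep w
outside ψ give ⟨(φ∘ψ)(…), w⟩; in the others, symmetry of φ̃, of the inner product and of ψ̃ moves w
to the outside and gives ⟨(ψ∘φ)(…), w⟩. So φ̃∘ψ corresponds to the bracket of φ and ψ. The bracket
is cyclic because φ̃∘ψ is visibly a symmetric form, it is antisymmetric because a commutator is, and
Jacobi is the action identity.

The differential D is insertion of l, which does not involve the inner product. In D²f = f∘(l∘l) +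
(symmetric term in l, l), the first summand vanishes by the L_∞ relations. The second equals its own
negative because l has degree one, so it vanishes because 2 is invertible in the even part. If l is
cyclic, then D = {·, l̃} and the derivation rule is again the action identity.

What remains is a dictionary between maps of tuples and functions of lists, and between unshuffle
permutations and splittings of lists. Most sign checks reduce to polynomial identities over ℤ/2,
verified by evaluation. -/

theorem ksign_zero : ksign 0 = 1 := by decide

theorem ksign_add (a b : ZMod 2) : ksign (a + b) = ksign a * ksign b := by
  revert a b; decide

theorem ksign_smul_ksign_smul {X : Type*} [AddCommGroup X] (a b : ZMod 2) (x : X) :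
    ksign a • ksign b • x = ksign (a + b) • x := by
  rw [smul_smul, ksign_add]

theorem ksign_smul_self {X : Type*} [AddCommGroup X] (a : ZMod 2) (x : X) :
    ksign a • ksign a • x = x := by
  rw [ksign_smul_ksign_smul, CharTwo.add_self_eq_zero, ksign_zero, one_smul]

theorem neg_eq_ksign_smul {X : Type*} [AddCommGroup X] (x : X) : -x = ksign 1 • x := by
  have : ksign 1 = -1 := by decide
  rw [this, neg_one_smul]

theorem ksign_smul_congr {X : Type*} [AddCommGroup X] {a b : ZMod 2} (h : a = b) (x : X) :
    ksign a • x = ksign b • x := by rw [h]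

theorem eq_ksign_smul_iff {X : Type*} [AddCommGroup X] (a : ZMod 2) (x y : X) :
    x = ksign a • y ↔ ksign a • x = y :=
  ⟨fun h => by rw [h, ksign_smul_self], fun h => by rw [← h, ksign_smul_self]⟩

end Signs

/-! ### Sums over splittings of a list, and their coassociativity -/

section UnshuffleSum

variable {α β X Y : Type*} [AddCommGroup X] [AddCommGroup Y]

/-- The sum of `F T R` over all decompositions of a list into complementary sublists `T` and `R`,
where each pair `t ∈ T`, `r ∈ R` with `r` before `t` contributes the factor `w t r`. -/
def unshuffleSum (w : α → α → ℤ) : List α → (List α → List α → X) → X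
  | [], F => F [] []
  | a :: l, F => unshuffleSum w l (fun T R => F (a :: T) R) +
      unshuffleSum w l (fun T R => (T.map (w · a)).prod • F T (a :: R))

/-- That T and R together rearrange `l` is what transports homogeneity of the letters, total length
and total label from `l` to the pieces. -/
theorem unshuffleSum_congr (w : α → α → ℤ) (l : List α) {F G : List α → List α → X}
    (h : ∀ T R, (T ++ R).Perm l → F T R = G T R) : unshuffleSum w l F = unshuffleSum w l G := by
  induction l generalizing F G with
  | nil => exact h [] [] (List.Perm.refl _)
  | cons a l ih =>
    simp only [unshuffleSum]
    congr 1
    · exact ih fun T R hp => h _ _ (hp.cons a)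
    · exact ih fun T R hp => by rw [h _ _ (List.perm_middle.trans (hp.cons a))]

theorem map_unshuffleSum (w : α → α → ℤ) (φ : X →+ Y) (l : List α) (F : List α → List α → X) :
    φ (unshuffleSum w l F) = unshuffleSum w l fun T R => φ (F T R) := by
  induction l generalizing F with
  | nil => rfl
  | cons a l ih => simp only [unshuffleSum, map_add, ih, map_zsmul]

theorem unshuffleSum_add (w : α → α → ℤ) (l : List α) (F G : List α → List α → X) :
    (unshuffleSum w l fun T R => F T R + G T R) = unshuffleSum w l F + unshuffleSum w l G := by
  induction l generalizing F G with
  | nil => rfl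
  | cons a l ih => simp only [unshuffleSum, smul_add, ih]; abel

theorem unshuffleSum_zero (w : α → α → ℤ) (l : List α) :
    (unshuffleSum w l fun _ _ => (0 : X)) = 0 := by
  induction l with
  | nil => rfl
  | cons a l ih => simp only [unshuffleSum, smul_zero, ih, add_zero]

theorem unshuffleSum_smul (w : α → α → ℤ) (n : ℤ) (l : List α) (F : List α → List α → X) :
    (unshuffleSum w l fun T R => n • F T R) = n • unshuffleSum w l F :=
  (map_unshuffleSum w (zsmulAddGroupHom n) l F).symm

theorem unshuffleSum_sum {ι : Type*} (w : α → α → ℤ) (s : Finset ι) (l : List α)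
    (F : ι → List α → List α → X) :
    (unshuffleSum w l fun T R => ∑ i ∈ s, F i T R) = ∑ i ∈ s, unshuffleSum w l (F i) := by
  classical
  induction s using Finset.induction_on with
  | empty => simp [unshuffleSum_zero]
  | insert i s hi ih => simp only [Finset.sum_insert hi, unshuffleSum_add, ih]

theorem unshuffleSum_map (w : β → β → ℤ) (h : α → β) (l : List α) (F : List β → List β → X) :
    unshuffleSum w (l.map h) F =
      unshuffleSum (fun a b => w (h a) (h b)) l fun T R => F (T.map h) (R.map h) := by
  induction l generalizing F with
  | nil => rfl
  | cons a l ih => simp only [List.map_cons, unshuffleSum, ih, List.map_map, Function.comp_def]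

/-- Coassociativity: both sides run over splittings into three sublists A, B, R, and each collects
one factor for every inversion between two different pieces. The induction asks to which of the
three pieces the first letter belongs. -/
theorem unshuffleSum_assoc (w : α → α → ℤ) (l : List α) (F : List α → List α → List α → X) :
    (unshuffleSum w l fun T R => unshuffleSum w T fun A B => F A B R) =
      unshuffleSum w l fun A S => unshuffleSum w S fun B R => F A B R := by
  induction l generalizing F with
  | nil => rfl
  | cons a l ih =>
    simp only [unshuffleSum, unshuffleSum_add, ih, smul_add]
    rw [add_assoc]
    congr 2
    · simp only [unshuffleSum_smul]
    · refine (unshuffleSum_congr w l fun T R _ => ?_).trans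
        ((ih fun A B R => (A.map (w · a)).prod • (B.map (w · a)).prod • F A B (a :: R)).trans ?_)
      · rw [← unshuffleSum_smul]
        refine unshuffleSum_congr w T fun A B hp => ?_
        -- T is a rearrangement of A and B, so its weight against `a` is the product of theirs.
        rw [smul_smul, ← List.prod_append, ← List.map_append, (hp.map _).prod_eq]
      · simp only [unshuffleSum_smul]

/-- The last letter overtakes all of R when it is sent to the first list, and overtakes nothing
otherwise. -/
theorem unshuffleSum_append_singleton (w : α → α → ℤ) (l : List α) (c : α)
    (F : List α → List α → X) :
    unshuffleSum w (l ++ [c]) F =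
      (unshuffleSum w l fun T R => (R.map (w c ·)).prod • F (T ++ [c]) R) +
        unshuffleSum w l fun T R => F T (R ++ [c]) := by
  induction l generalizing F with
  | nil => simp [unshuffleSum]
  | cons a l ih =>
    simp only [List.cons_append, unshuffleSum, ih, List.map_append, List.prod_append, List.map_cons,
      List.prod_cons, List.map_nil, List.prod_nil, mul_one, smul_smul]
    rw [add_add_add_comm]
    congr 2
    refine congrArg _ (funext₂ fun T R => ?_)
    congr 1
    ring

end UnshuffleSum

/-! ### Koszul signs and graded symmetry for labelled letters -/

section Letters

variable {V X : Type*} [AddCommGroup X]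

/-- The sum of the labels of a list of labelled elements. -/
def label (l : List (V × ZMod 2)) : ZMod 2 := (l.map Prod.snd).sum

@[simp] theorem label_nil : label ([] : List (V × ZMod 2)) = 0 := rfl

@[simp] theorem label_cons (a : V × ZMod 2) (l : List (V × ZMod 2)) :
    label (a :: l) = a.2 + label l := by simp [label]

@[simp] theorem label_append (l l' : List (V × ZMod 2)) :
    label (l ++ l') = label l + label l' := by simp [label]

theorem label_perm {l l' : List (V × ZMod 2)} (h : l.Perm l') : label l = label l' :=
  (h.map _).sum_eq

/-- The sum over unshuffles of a list of labelled elements with Koszul signs. -/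
abbrev koszulSum (l : List (V × ZMod 2)) (F : List (V × ZMod 2) → List (V × ZMod 2) → X) : X :=
  unshuffleSum (fun a b => ksign (a.2 * b.2)) l F

theorem prod_ksign_left (l : List (V × ZMod 2)) (a : V × ZMod 2) :
    (l.map fun t => ksign (t.2 * a.2)).prod = ksign (label l * a.2) := by
  induction l with
  | nil => simp [ksign_zero]
  | cons b l ih => simp [ih, add_mul, ksign_add]

theorem prod_ksign_right (l : List (V × ZMod 2)) (a : V × ZMod 2) :
    (l.map fun t => ksign (a.2 * t.2)).prod = ksign (a.2 * label l) := by
  rw [mul_comm, ← prod_ksign_left]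
  simp only [mul_comm]

theorem koszulSum_nil (F : List (V × ZMod 2) → List (V × ZMod 2) → X) :
    koszulSum [] F = F [] [] := rfl

theorem koszulSum_cons (a : V × ZMod 2) (l : List (V × ZMod 2))
    (F : List (V × ZMod 2) → List (V × ZMod 2) → X) :
    koszulSum (a :: l) F = (koszulSum l fun T R => F (a :: T) R) +
      koszulSum l fun T R => ksign (label T * a.2) • F T (a :: R) := by
  simp only [koszulSum, unshuffleSum, prod_ksign_left]

theorem koszulSum_append_singleton (l : List (V × ZMod 2)) (c : V × ZMod 2)
    (F : List (V × ZMod 2) → List (V × ZMod 2) → X) :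
    koszulSum (l ++ [c]) F =
      (koszulSum l fun T R => ksign (c.2 * label R) • F (T ++ [c]) R) +
        koszulSum l fun T R => F T (R ++ [c]) := by
  simp only [koszulSum, unshuffleSum_append_singleton, prod_ksign_right]

/-- A pair of letters from T and R is inverted for exactly one of the two orders of the pieces, so
the two Koszul signs differ by the sign of all pairs. -/
theorem koszulSum_comm (l : List (V × ZMod 2)) (F : List (V × ZMod 2) → List (V × ZMod 2) → X) :
    koszulSum l F = koszulSum l fun T R => ksign (label T * label R) • F R T := by
  induction l generalizing F with
  | nil => simp [koszulSum_nil, ksign_zero]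
  | cons a l ih =>
    rw [koszulSum_cons, koszulSum_cons, ih, add_comm, ih]
    simp only [ksign_smul_ksign_smul, label_cons]
    congr 2 <;> funext T R <;> refine ksign_smul_congr ?_ _
    · ring
    · rw [mul_add, ← add_assoc, CharTwo.add_self_eq_zero, zero_add]

/-- Graded symmetry of a function of lists, with respect to exchanging neighbours, for lists
whose entries satisfy `good`. -/
def SwapSymm (good : V × ZMod 2 → Prop) (F : List (V × ZMod 2) → X) : Prop :=
  ∀ (l₁ l₂ : List (V × ZMod 2)) (a b : V × ZMod 2), (∀ c ∈ l₁ ++ a :: b :: l₂, good c) →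
    F (l₁ ++ a :: b :: l₂) = ksign (a.2 * b.2) • F (l₁ ++ b :: a :: l₂)

theorem SwapSymm.cons_eq_append {good : V × ZMod 2 → Prop} {F : List (V × ZMod 2) → X}
    (hF : SwapSymm good F) (l₁ l₂ l₃ : List (V × ZMod 2)) (a : V × ZMod 2)
    (hg : ∀ c ∈ l₁ ++ a :: l₂ ++ l₃, good c) :
    F (l₁ ++ a :: l₂ ++ l₃) = ksign (a.2 * label l₂) • F (l₁ ++ l₂ ++ a :: l₃) := by
  induction l₂ generalizing l₁ with
  | nil => simp [ksign_zero]
  | cons b l₂ ih =>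
    have h1 := hF l₁ (l₂ ++ l₃) a b (by simpa using hg)
    have h2 := ih (l₁ ++ [b]) (fun c hc => hg c (by
      simp only [List.mem_append, List.mem_cons, List.not_mem_nil, or_false] at hc ⊢; tauto))
    simp only [List.append_assoc, List.cons_append, List.nil_append] at h1 h2 ⊢
    rw [h1, h2, ksign_smul_ksign_smul, label_cons, mul_add]

/-- If the neighbours `a`, `b` fall into the same sublist, the symmetry of `F` applies. If they are
separated, exchanging them matches the summands of the two sides, and the extra sign is that of the
one inversion between them. -/
theorem koszulSum_swap (good : V × ZMod 2 → Prop) (l₁ l₂ : List (V × ZMod 2)) (a b : V × ZMod 2)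
    (hg : ∀ c ∈ l₁ ++ a :: b :: l₂, good c) (F : List (V × ZMod 2) → List (V × ZMod 2) → X)
    (hT : ∀ T₁ T₂ R, (∀ c ∈ T₁ ++ a :: b :: T₂ ++ R, good c) →
      F (T₁ ++ a :: b :: T₂) R = ksign (a.2 * b.2) • F (T₁ ++ b :: a :: T₂) R)
    (hR : ∀ T R₁ R₂, (∀ c ∈ T ++ (R₁ ++ a :: b :: R₂), good c) →
      F T (R₁ ++ a :: b :: R₂) = ksign (a.2 * b.2) • F T (R₁ ++ b :: a :: R₂)) :
    koszulSum (l₁ ++ a :: b :: l₂) F =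
      ksign (a.2 * b.2) • koszulSum (l₁ ++ b :: a :: l₂) F := by
  induction l₁ generalizing F with
  | nil =>
    have hl : ∀ {T R : List (V × ZMod 2)}, (T ++ R).Perm l₂ → ∀ c ∈ T ++ R, good c :=
      fun hp c hc => hg c (by simp [hp.mem_iff.1 hc])
    have ha : good a := hg a (by simp)
    have hb : good b := hg b (by simp)
    simp only [List.nil_append, koszulSum_cons, label_cons]
    have e1 : (koszulSum l₂ fun T R => F (a :: b :: T) R) =
        ksign (a.2 * b.2) • koszulSum l₂ fun T R => F (b :: a :: T) R := by
      rw [← unshuffleSum_smul]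
      refine unshuffleSum_congr _ _ fun T R hp => hT [] T R fun c hc => ?_
      have := hl hp c
      simp only [List.nil_append, List.cons_append, List.mem_cons] at hc
      rcases hc with rfl | rfl | hc <;> tauto
    have e2 : (koszulSum l₂ fun T R => ksign (label T * b.2) • ksign (label T * a.2) •
          F T (a :: b :: R)) =
        ksign (a.2 * b.2) • koszulSum l₂ fun T R => ksign (label T * a.2) •
          ksign (label T * b.2) • F T (b :: a :: R) := by
      rw [← unshuffleSum_smul]
      refine unshuffleSum_congr _ _ fun T R hp => ?_
      rw [← List.nil_append (a :: b :: R), hR T [] R fun c hc => ?_]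
      · simp only [ksign_smul_ksign_smul, List.nil_append]
        refine ksign_smul_congr ?_ _
        ring
      · have := hl hp c
        simp only [List.nil_append, List.mem_append, List.mem_cons] at hc this
        rcases hc with hc | rfl | rfl | hc <;> tauto
    rw [e1, e2]
    simp only [smul_add, ← unshuffleSum_smul, ksign_smul_ksign_smul]
    -- In the mixed terms, the sign of `a` and `b` appears when the later of the two letters is in
    -- the first list; multiplying by it again moves it to the other mixed term.
    simp only [add_mul, mul_comm b.2 a.2, ← add_assoc, CharTwo.add_self_eq_zero, zero_add,
      koszulSum]
    abel
  | cons c l₁ ih =>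
    have hc : good c := hg c (by simp)
    simp only [List.cons_append, koszulSum_cons, smul_add]
    have hg' : ∀ c ∈ l₁ ++ a :: b :: l₂, good c := fun x hx =>
      hg x (by rw [List.cons_append]; exact List.mem_cons_of_mem _ hx)
    rw [ih hg', ih hg']
    · intro T₁ T₂ R h
      have e : label (T₁ ++ a :: b :: T₂) = label (T₁ ++ b :: a :: T₂) := by
        simp only [label_append, label_cons]; ring
      rw [hT T₁ T₂ (c :: R), e, smul_comm]
      intro x hx
      have := h x
      simp only [List.mem_append, List.mem_cons] at hx this
      rcases hx with (hx | rfl | rfl | hx) | rfl | hx <;> tauto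
    · intro T R₁ R₂ h
      have := hR T (c :: R₁) R₂ (by
        intro x hx
        have := h x
        simp only [List.mem_append, List.mem_cons, List.cons_append] at hx this
        rcases hx with hx | rfl | hx | rfl | rfl | hx <;> tauto)
      rw [List.cons_append, List.cons_append] at this
      rw [this, smul_comm]
    · intro T₁ T₂ R h
      refine hT (c :: T₁) T₂ R fun x hx => ?_
      rw [List.cons_append, List.cons_append, List.mem_cons] at hx
      rcases hx with rfl | hx
      exacts [hc, h x hx]
    · intro T R₁ R₂ h
      refine hR (c :: T) R₁ R₂ fun x hx => ?_
      rw [List.cons_append, List.mem_cons] at hx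
      rcases hx with rfl | hx
      exacts [hc, h x hx]

end Letters

end LInfty

namespace LInfty

/-! ### Insertion of functions of lists: linearity, pre-Lie identity, pairing with the last letter
-/

section ListComp

variable {K V X : Type*} [Ring K] [AddCommGroup V] [Module K V] [Module Kᵐᵒᵖ V]
  [AddCommGroup X] [Module Kᵐᵒᵖ X]

/-- The label of `a` is the parity of the element shifted by one. -/
def Shifted (𝒱 : ZMod 2 → AddSubgroup V) (a : V × ZMod 2) : Prop := a.1 ∈ 𝒱 (a.2 + 1)

/-- Additivity in the first entry. -/
def HeadAdditive (f : List (V × ZMod 2) → X) : Prop :=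
  ∀ (x y : V) (p : ZMod 2) (l : List (V × ZMod 2)),
    f ((x + y, p) :: l) = f ((x, p) :: l) + f ((y, p) :: l)

/-- Right linearity in the first entry. -/
def HeadLinear (𝒦 : ZMod 2 → AddSubgroup K) (𝒱 : ZMod 2 → AddSubgroup V) (e : ZMod 2)
    (f : List (V × ZMod 2) → X) : Prop :=
  ∀ (s : ZMod 2) (t : K), t ∈ 𝒦 s → ∀ (a : V × ZMod 2) (l : List (V × ZMod 2)), Shifted 𝒱 a →
    (∀ c ∈ l, Shifted 𝒱 c) →
      f ((MulOpposite.op t • a.1, a.2 + s) :: l) =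
        ksign (s * (label l + e)) • MulOpposite.op t • f (a :: l)

/-- A function of lists of degree `γ` with values in a graded group whose grading is shifted
by `u`. -/
def HasDegree (𝒱 : ZMod 2 → AddSubgroup V) (𝒳 : ZMod 2 → AddSubgroup X) (u γ : ZMod 2)
    (f : List (V × ZMod 2) → X) : Prop :=
  ∀ l : List (V × ZMod 2), (∀ c ∈ l, Shifted 𝒱 c) → f l ∈ 𝒳 (γ + label l + u)

/-- Insertion of `g`, of degree `γ`, into `f`. -/
def listComp (γ : ZMod 2) (f : List (V × ZMod 2) → X) (g : List (V × ZMod 2) → V)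
    (l : List (V × ZMod 2)) : X :=
  koszulSum l fun T R => f ((g T, γ + label T) :: R)

/-- Insertion of both `g` and `h` into `f`. -/
def listPair (γ₁ γ₂ : ZMod 2) (f : List (V × ZMod 2) → X) (g h : List (V × ZMod 2) → V)
    (l : List (V × ZMod 2)) : X :=
  koszulSum l fun S R => koszulSum S fun T U => ksign (label U * (γ₂ + label T)) •
    f ((g U, γ₁ + label U) :: (h T, γ₂ + label T) :: R)

/-- A head additive function as a homomorphism in its first entry. -/
def HeadAdditive.hom {f : List (V × ZMod 2) → X} (hf : HeadAdditive f) (p : ZMod 2)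
    (l : List (V × ZMod 2)) : V →+ X :=
  AddMonoidHom.mk' (fun x => f ((x, p) :: l)) fun x y => hf x y p l

theorem HeadAdditive.zsmul {f : List (V × ZMod 2) → X} (hf : HeadAdditive f) (n : ℤ) (x : V)
    (p : ZMod 2) (l : List (V × ZMod 2)) : f ((n • x, p) :: l) = n • f ((x, p) :: l) :=
  map_zsmul (hf.hom p l) n x

theorem HeadAdditive.zero {f : List (V × ZMod 2) → X} (hf : HeadAdditive f)
    (p : ZMod 2) (l : List (V × ZMod 2)) : f ((0, p) :: l) = 0 :=
  map_zero (hf.hom p l)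

theorem HeadAdditive.koszulSum {f : List (V × ZMod 2) → X} (hf : HeadAdditive f) (p : ZMod 2)
    (l l' : List (V × ZMod 2)) (F : List (V × ZMod 2) → List (V × ZMod 2) → V) :
    f ((koszulSum l' F, p) :: l) = LInfty.koszulSum l' fun T R => f ((F T R, p) :: l) :=
  map_unshuffleSum _ (hf.hom p l) l' F

theorem listComp_congr {𝒱 : ZMod 2 → AddSubgroup V} {γ : ZMod 2} {f f' : List (V × ZMod 2) → X}
    {g g' : List (V × ZMod 2) → V} (hdeg : HasDegree 𝒱 𝒱 1 γ g)
    (hf : ∀ l, (∀ c ∈ l, Shifted 𝒱 c) → f l = f' l) (hg : ∀ l, (∀ c ∈ l, Shifted 𝒱 c) → g l = g' l)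
    {l : List (V × ZMod 2)} (hl : ∀ c ∈ l, Shifted 𝒱 c) : listComp γ f g l = listComp γ f' g' l := by
  refine unshuffleSum_congr _ _ fun T R hp => ?_
  have hTR : ∀ c ∈ T ++ R, Shifted 𝒱 c := fun c hc => hl c (hp.mem_iff.1 hc)
  have hT : ∀ c ∈ T, Shifted 𝒱 c := fun c hc => hTR c (by simp [hc])
  rw [hf, hg T hT]
  intro c hc
  rw [List.mem_cons] at hc
  rcases hc with rfl | hc
  · exact hdeg T hT
  · exact hTR c (by simp [hc])

omit [AddCommGroup V] in
theorem listComp_add_left (γ : ZMod 2) (f f' : List (V × ZMod 2) → X) (g : List (V × ZMod 2) → V)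
    (l : List (V × ZMod 2)) :
    listComp γ (fun l => f l + f' l) g l = listComp γ f g l + listComp γ f' g l :=
  unshuffleSum_add _ _ _ _

theorem listComp_add_right (γ : ZMod 2) {f : List (V × ZMod 2) → X} (hf : HeadAdditive f)
    (g g' : List (V × ZMod 2) → V) (l : List (V × ZMod 2)) :
    listComp γ f (fun l => g l + g' l) l = listComp γ f g l + listComp γ f g' l := by
  simp only [listComp, hf _ _ _ _, koszulSum, unshuffleSum_add]

theorem listComp_zsmul_right (γ : ZMod 2) {f : List (V × ZMod 2) → X} (hf : HeadAdditive f)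
    (n : ℤ) (g : List (V × ZMod 2) → V) (l : List (V × ZMod 2)) :
    listComp γ f (fun l => n • g l) l = n • listComp γ f g l := by
  simp only [listComp, hf.zsmul, koszulSum, unshuffleSum_smul]

theorem HasDegree.listComp {𝒱 : ZMod 2 → AddSubgroup V} {𝒳 : ZMod 2 → AddSubgroup X}
    {u γ₁ γ₂ : ZMod 2} {f : List (V × ZMod 2) → X} {g : List (V × ZMod 2) → V}
    (hf : HasDegree 𝒱 𝒳 u γ₁ f) (hg : HasDegree 𝒱 𝒱 1 γ₂ g) :
    HasDegree 𝒱 𝒳 u (γ₁ + γ₂) (listComp γ₂ f g) := by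
  intro l hl
  have key : ∀ (l : List (V × ZMod 2)) (F : List (V × ZMod 2) → List (V × ZMod 2) → X)
      (H : AddSubgroup X), (∀ T R, (T ++ R).Perm l → F T R ∈ H) → koszulSum l F ∈ H := by
    intro l
    induction l with
    | nil => exact fun F H h => h _ _ (List.Perm.refl _)
    | cons a l ih =>
      intro F H h
      rw [koszulSum_cons]
      exact H.add_mem (ih _ _ fun T R hp => h _ _ (hp.cons a))
        (ih _ _ fun T R hp => H.zsmul_mem (h _ _ (List.perm_middle.trans (hp.cons a))) _)
  refine key l _ _ fun T R hp => ?_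
  have hTR : ∀ c ∈ T ++ R, Shifted 𝒱 c := fun c hc => hl c (hp.mem_iff.1 hc)
  have := hf ((g T, γ₂ + label T) :: R) (by
    intro c hc
    rw [List.mem_cons] at hc
    rcases hc with rfl | hc
    · exact hg T fun c hc => hTR c (by simp [hc])
    · exact hTR c (by simp [hc]))
  rw [← label_perm hp, label_append]
  rw [label_cons] at this
  simpa only [add_assoc] using this

theorem SwapSymm.listComp {𝒱 : ZMod 2 → AddSubgroup V} {γ : ZMod 2} {f : List (V × ZMod 2) → X}
    {g : List (V × ZMod 2) → V} (hf : SwapSymm (Shifted 𝒱) f) (hfa : HeadAdditive f)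
    (hg : SwapSymm (Shifted 𝒱) g) (hgd : HasDegree 𝒱 𝒱 1 γ g) :
    SwapSymm (Shifted 𝒱) (listComp γ f g) := by
  intro l₁ l₂ a b hl
  refine koszulSum_swap (Shifted 𝒱) l₁ l₂ a b hl _ ?_ ?_
  · intro T₁ T₂ R h
    have e : label (T₁ ++ a :: b :: T₂) = label (T₁ ++ b :: a :: T₂) := by
      simp only [label_append, label_cons]; ring
    rw [hg T₁ T₂ a b fun c hc => h c (List.mem_append_left _ hc), hfa.zsmul, e]
  · intro T R₁ R₂ h
    refine hf ((g T, γ + label T) :: R₁) R₂ a b fun c hc => ?_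
    rw [List.cons_append, List.mem_cons] at hc
    rcases hc with rfl | hc
    · exact hgd T fun c hc => h c (List.mem_append_left _ hc)
    · exact h c (List.mem_append_right _ hc)

theorem IsSupermodule.op_smul_mem {𝒦 : ZMod 2 → AddSubgroup K} {𝒱 : ZMod 2 → AddSubgroup V}
    (hV : IsSupermodule 𝒦 𝒱) {s p : ZMod 2} {t : K} {v : V} (ht : t ∈ 𝒦 s) (hv : v ∈ 𝒱 p) :
    MulOpposite.op t • v ∈ 𝒱 (p + s) := by
  rw [hV.op_smul s p t v ht hv, add_comm]
  exact (𝒱 _).zsmul_mem (hV.smul_mem s p t v ht hv) _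

theorem Shifted.op_smul {𝒦 : ZMod 2 → AddSubgroup K} {𝒱 : ZMod 2 → AddSubgroup V}
    (hV : IsSupermodule 𝒦 𝒱) {s : ZMod 2} {t : K} {a : V × ZMod 2} (ht : t ∈ 𝒦 s)
    (ha : Shifted 𝒱 a) : Shifted 𝒱 (MulOpposite.op t • a.1, a.2 + s) := by
  have := hV.op_smul_mem ht ha
  rwa [add_right_comm] at this

theorem HeadLinear.listComp {𝒦 : ZMod 2 → AddSubgroup K} {𝒱 : ZMod 2 → AddSubgroup V}
    (hV : IsSupermodule 𝒦 𝒱) {γ e : ZMod 2} {f : List (V × ZMod 2) → X}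
    {g : List (V × ZMod 2) → V} (hf : SwapSymm (Shifted 𝒱) f) (hfa : HeadAdditive f)
    (hfl : HeadLinear 𝒦 𝒱 e f) (hgl : HeadLinear 𝒦 𝒱 0 g) (hgd : HasDegree 𝒱 𝒱 1 γ g) :
    HeadLinear 𝒦 𝒱 e (listComp γ f g) := by
  intro s t ht a l ha hl
  have hta := ha.op_smul hV ht
  have hop : ∀ x : X, MulOpposite.op t • x = DistribSMul.toAddMonoidHom X (MulOpposite.op t) x :=
    fun _ => rfl
  simp only [LInfty.listComp, koszulSum_cons, smul_add]
  rw [hop (LInfty.koszulSum _ _), hop (LInfty.koszulSum _ _)]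
  simp only [LInfty.koszulSum, map_unshuffleSum, ← unshuffleSum_smul]
  congr 1 <;> refine unshuffleSum_congr _ _ fun T R hp => ?_
  all_goals
    have hTR : ∀ c ∈ T ++ R, Shifted 𝒱 c := fun c hc => hl c (hp.mem_iff.1 hc)
    have hT : ∀ c ∈ T, Shifted 𝒱 c := fun c hc => hTR c (by simp [hc])
    have hR : ∀ c ∈ R, Shifted 𝒱 c := fun c hc => hTR c (by simp [hc])
    have hlab := label_perm hp
    rw [label_append] at hlab
    rw [← hop]
  · have haT : Shifted 𝒱 (g (a :: T), γ + label (a :: T)) := hgd _ (by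
      intro c hc
      rw [List.mem_cons] at hc
      rcases hc with rfl | hc
      exacts [ha, hT c hc])
    have h := hfl s t ht _ R haT hR
    rw [hgl s t ht a T ha hT, hfa.zsmul]
    simp only [label_cons] at h ⊢
    rw [show γ + (a.2 + s + label T) = γ + (a.2 + label T) + s by ring, h,
      ksign_smul_ksign_smul, ← hlab]
    refine ksign_smul_congr ?_ _
    ring
  · have hgT : Shifted 𝒱 (g T, γ + label T) := hgd _ hT
    have hgR : ∀ c ∈ (g T, γ + label T) :: R, Shifted 𝒱 c := by
      intro c hc
      rw [List.mem_cons] at hc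
      rcases hc with rfl | hc
      exacts [hgT, hR c hc]
    -- Here the first letter stays behind the inserted value. It is exchanged with that value, the
    -- scalar is pulled out at the head, and the exchange is undone.
    have h1 := hf [] R (g T, γ + label T) (MulOpposite.op t • a.1, a.2 + s) (by
      intro c hc
      have := hgR c
      simp only [List.nil_append, List.mem_cons] at hc this
      rcases hc with hc | rfl | hc
      exacts [this (Or.inl hc), hta, this (Or.inr hc)])
    have h2 := hf [] R a (g T, γ + label T) (by
      intro c hc
      have := hgR c
      simp only [List.nil_append, List.mem_cons] at hc this
      rcases hc with rfl | hc
      exacts [ha, this hc])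
    have h3 := hfl s t ht a _ ha hgR
    simp only [List.nil_append] at h1 h2
    rw [h1, h3, h2, smul_comm (MulOpposite.op t) (ksign _), smul_comm (MulOpposite.op t) (ksign _)]
    simp only [ksign_smul_ksign_smul, label_cons, ← hlab]
    refine ksign_smul_congr ?_ _
    generalize label T = x, label R = y, a.2 = z
    clear * -
    decide +revert

/-- Insertion is a right pre-Lie product up to a graded symmetric term. -/
theorem listComp_listComp (γ₁ γ₂ : ZMod 2) {f : List (V × ZMod 2) → X} (hf : HeadAdditive f)
    (g h : List (V × ZMod 2) → V) (l : List (V × ZMod 2)) :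
    listComp γ₂ (listComp γ₁ f g) h l =
      listComp (γ₁ + γ₂) f (listComp γ₂ g h) l + listPair γ₁ γ₂ f g h l := by
  -- The letter produced by `h` heads the list that is split for `g`. It becomes either an argument
  -- of `g`, giving the nested insertion, or a further argument of `f`, giving `listPair`.
  simp only [listComp, listPair, koszulSum_cons, koszulSum, unshuffleSum_add]
  congr 1
  · rw [← unshuffleSum_assoc _ l fun A B R =>
      f ((g ((h A, γ₂ + label A) :: B), γ₁ + label ((h A, γ₂ + label A) :: B)) :: R)]
    refine unshuffleSum_congr _ _ fun T R _ => ?_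
    refine Eq.trans ?_ (hf.koszulSum _ _ _ _).symm
    refine unshuffleSum_congr _ _ fun A B hp => ?_
    rw [label_cons, ← label_perm hp, label_append]
    simp only [add_assoc]
  · rw [← unshuffleSum_assoc _ l fun A B R => ksign (label B * (γ₂ + label A)) •
      f ((g B, γ₁ + label B) :: (h A, γ₂ + label A) :: R)]

/-- Exchanging the two argument lists gives a Koszul sign, and exchanging the first two entries of
`f` gives the sign of two letters of degrees γ₁ + |T| and γ₂ + |U|. Together with the explicit signs
in `listPair`, only γ₁γ₂ survives. -/
theorem listPair_swap {𝒱 : ZMod 2 → AddSubgroup V} (γ₁ γ₂ : ZMod 2) {f : List (V × ZMod 2) → X}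
    (hf : SwapSymm (Shifted 𝒱) f) {g h : List (V × ZMod 2) → V} (hg : HasDegree 𝒱 𝒱 1 γ₁ g)
    (hh : HasDegree 𝒱 𝒱 1 γ₂ h) {l : List (V × ZMod 2)} (hl : ∀ c ∈ l, Shifted 𝒱 c) :
    listPair γ₁ γ₂ f g h l = ksign (γ₁ * γ₂) • listPair γ₂ γ₁ f h g l := by
  simp only [listPair, koszulSum, ← unshuffleSum_smul]
  refine unshuffleSum_congr _ _ fun S R hp => ?_
  refine (koszulSum_comm _ _).trans (unshuffleSum_congr _ _ fun T U hp' => ?_)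
  have hSR : ∀ c ∈ S ++ R, Shifted 𝒱 c := fun c hc => hl c (hp.mem_iff.1 hc)
  have hTU : ∀ c ∈ T ++ U, Shifted 𝒱 c := fun c hc => hSR c (by
    rw [List.mem_append]; exact Or.inl (hp'.mem_iff.1 hc))
  have h1 := hf [] R (g T, γ₁ + label T) (h U, γ₂ + label U) (by
    intro c hc
    simp only [List.nil_append, List.mem_cons] at hc
    rcases hc with rfl | rfl | hc
    · exact hg T fun c hc => hTU c (by simp [hc])
    · exact hh U fun c hc => hTU c (by simp [hc])
    · exact hSR c (by simp [hc]))
  simp only [List.nil_append] at h1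
  rw [h1]
  simp only [ksign_smul_ksign_smul]
  refine ksign_smul_congr ?_ _
  generalize label T = x, label U = y
  clear * -
  decide +revert

/-- The failure of associativity is graded symmetric in `g` and `h`, so it drops out of the
commutator. This action identity is the source of both the Jacobi identity and the derivation rule.
-/
theorem listComp_bracket {𝒱 : ZMod 2 → AddSubgroup V} (γ₁ γ₂ : ZMod 2)
    {f : List (V × ZMod 2) → X} (hfa : HeadAdditive f) (hf : SwapSymm (Shifted 𝒱) f)
    {g h : List (V × ZMod 2) → V} (hg : HasDegree 𝒱 𝒱 1 γ₁ g)
    (hh : HasDegree 𝒱 𝒱 1 γ₂ h) {l : List (V × ZMod 2)} (hl : ∀ c ∈ l, Shifted 𝒱 c) :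
    listComp (γ₁ + γ₂) f (fun l => listComp γ₂ g h l - ksign (γ₁ * γ₂) • listComp γ₁ h g l) l =
      listComp γ₂ (listComp γ₁ f g) h l - ksign (γ₁ * γ₂) • listComp γ₁ (listComp γ₂ f h) g l := by
  have h1 := listComp_listComp γ₁ γ₂ hfa g h l
  have h2 := listComp_listComp γ₂ γ₁ hfa h g l
  have h3 := listPair_swap γ₁ γ₂ hf hg hh hl
  simp only [sub_eq_add_neg, ← neg_smul]
  rw [listComp_add_right _ hfa, listComp_zsmul_right _ hfa, h1, h2, h3, add_comm γ₂ γ₁]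
  simp only [neg_smul, smul_add]
  abel

/-- The bridge between bracket and insertion: the two terms of the commutator correspond to the two
possible places of the last letter `w`. The hypotheses say that `f` and `g` are the forms of φ and
ψ; their symmetry carries the cyclicity. -/
theorem listComp_append_singleton {𝒦 : ZMod 2 → AddSubgroup K} {𝒱 : ZMod 2 → AddSubgroup V}
    {ip : V →+ V →+ K} (hip : IsInnerProduct 𝒦 𝒱 ip) (γ₁ γ₂ : ZMod 2)
    {f g : List (V × ZMod 2) → K} {φ ψ : List (V × ZMod 2) → V}
    (hf : SwapSymm (Shifted 𝒱) f) (hg : SwapSymm (Shifted 𝒱) g)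
    (hφ : HasDegree 𝒱 𝒱 1 γ₁ φ) (hψ : HasDegree 𝒱 𝒱 1 γ₂ ψ)
    (hfφ : ∀ l w, (∀ c ∈ l, Shifted 𝒱 c) → Shifted 𝒱 w →
      f (l ++ [w]) = ksign (w.2 + 1) • ip (φ l) w.1)
    (hgψ : ∀ l w, (∀ c ∈ l, Shifted 𝒱 c) → Shifted 𝒱 w →
      g (l ++ [w]) = ksign (w.2 + 1) • ip (ψ l) w.1)
    {l : List (V × ZMod 2)} {w : V × ZMod 2} (hl : ∀ c ∈ l, Shifted 𝒱 c) (hw : Shifted 𝒱 w) :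
    listComp γ₂ f ψ (l ++ [w]) = ksign (w.2 + 1) •
      ip (listComp γ₂ φ ψ l - ksign (γ₁ * γ₂) • listComp γ₁ ψ φ l) w.1 := by
  have hmap : ∀ F : List (V × ZMod 2) → List (V × ZMod 2) → V,
      ip (koszulSum l F) w.1 = koszulSum l fun T R => ip (F T R) w.1 := fun F =>
    map_unshuffleSum _ (ip.flip w.1) l F
  simp only [listComp, koszulSum_append_singleton, map_sub, map_zsmul, AddMonoidHom.sub_apply,
    AddMonoidHom.zsmul_apply, hmap]
  rw [add_comm, smul_sub, sub_eq_add_neg]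
  congr 1
  -- `w` is not an argument of ψ, so it is still the last argument of `f`.
  · simp only [koszulSum]
    rw [← unshuffleSum_smul]
    refine unshuffleSum_congr _ _ fun T R hp => ?_
    have hTR : ∀ c ∈ T ++ R, Shifted 𝒱 c := fun c hc => hl c (hp.mem_iff.1 hc)
    rw [← List.cons_append, hfφ _ _ _ hw]
    intro c hc
    rw [List.mem_cons] at hc
    rcases hc with rfl | hc
    · exact hψ T fun c hc => hTR c (by simp [hc])
    · exact hTR c (by simp [hc])
  -- `w` is an argument of ψ. With the roles of the lists exchanged, φ is evaluated on T and ψ on R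
  -- and `w`: f(ψ(R, w), T) becomes ⟨φ(T), ψ(R, w)⟩, then ⟨ψ(R, w), φ(T)⟩, and by symmetry of `g`
  -- finally ⟨ψ(φ(T), R), w⟩, up to signs.
  · rw [koszulSum_comm]
    simp only [koszulSum]
    rw [neg_eq_ksign_smul]
    simp only [← unshuffleSum_smul]
    refine (unshuffleSum_congr _ _ fun T R hp => ?_)
    have hTR : ∀ c ∈ T ++ R, Shifted 𝒱 c := fun c hc => hl c (hp.mem_iff.1 hc)
    have hT : ∀ c ∈ T, Shifted 𝒱 c := fun c hc => hTR c (by simp [hc])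
    have hR : ∀ c ∈ R, Shifted 𝒱 c := fun c hc => hTR c (by simp [hc])
    have hRw : ∀ c ∈ R ++ [w], Shifted 𝒱 c := by
      intro c hc
      simp only [List.mem_append, List.mem_cons, List.not_mem_nil, or_false] at hc
      rcases hc with hc | rfl
      exacts [hR c hc, hw]
    have hx : Shifted 𝒱 (ψ (R ++ [w]), γ₂ + label (R ++ [w])) := hψ _ hRw
    have hy : Shifted 𝒱 (φ T, γ₁ + label T) := hφ _ hT
    have h1 := hf.cons_eq_append [] T [] (ψ (R ++ [w]), γ₂ + label (R ++ [w])) (by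
      intro c hc
      simp only [List.nil_append, List.append_nil, List.mem_cons] at hc
      rcases hc with rfl | hc
      exacts [hx, hT c hc])
    have h2 := hg.cons_eq_append [] (R ++ [w]) [] (φ T, γ₁ + label T) (by
      intro c hc
      simp only [List.nil_append, List.append_nil, List.mem_cons] at hc
      rcases hc with rfl | hc
      exacts [hy, hRw c hc])
    simp only [List.nil_append, List.append_nil] at h1 h2
    rw [h1, hfφ T _ hT hx, hip.symm _ _ _ _ hy hx]
    rw [← List.cons_append, hgψ _ _ (by
      intro c hc
      rw [List.mem_cons] at hc
      rcases hc with rfl | hc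
      exacts [hy, hR c hc]) hw, hgψ _ _ hRw hy, eq_comm, eq_ksign_smul_iff] at h2
    rw [← h2]
    simp only [ksign_smul_ksign_smul, label_append, label_cons, label_nil]
    refine ksign_smul_congr ?_ _
    generalize label T = x, label R = y, w.2 = z
    clear * -
    decide +revert

end ListComp

end LInfty

namespace LInfty

/-! ### The Koszul sign of permutations is a cocycle -/

section Koszul

variable {N : ℕ}

/-- A permutation only relabels unordered pairs. The antisymmetrization of `h`, with a minus sign
below the diagonal, puts this in the form of a known product formula, and the sign of σ that it
produces cancels. -/
theorem prod_Iio_comp_perm (σ : Equiv.Perm (Fin N)) (h : Fin N → Fin N → ℤ)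
    (hs : ∀ i j, h i j = h j i) :
    ∏ j, ∏ i ∈ Finset.Iio j, h (σ i) (σ j) = ∏ j, ∏ i ∈ Finset.Iio j, h i j := by
  have key := σ.prod_Iio_comp_eq_sign_mul_prod (R := ℤ)
    (f := fun i j => if i < j then h i j else if j < i then -h i j else 0) (by
      intro i j
      rcases lt_trichotomy i j with hij | rfl | hij
      · simp [hij, hij.not_gt, hs i j]
      · simp
      · simp [hij, hij.not_gt, hs i j])
  have e1 : ∏ j, ∏ i ∈ Finset.Iio j, (fun i j => if i < j then h i j else
      if j < i then -h i j else 0) (σ i) (σ j) =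
      (σ.sign : ℤ) * ∏ j, ∏ i ∈ Finset.Iio j, h (σ i) (σ j) := by
    rw [Equiv.Perm.sign_eq_prod_prod_Iio]
    simp only [Units.coe_prod, ← Finset.prod_mul_distrib]
    refine Finset.prod_congr rfl fun j _ => Finset.prod_congr rfl fun i hi => ?_
    have hij : σ i ≠ σ j := fun h => (Finset.mem_Iio.1 hi).ne (σ.injective h)
    rcases hij.lt_or_gt with h' | h'
    · simp [h']
    · simp [h', h'.not_gt]
  have e2 : ∏ j, ∏ i ∈ Finset.Iio j, (fun i j => if i < j then h i j else
      if j < i then -h i j else 0) i j = ∏ j, ∏ i ∈ Finset.Iio j, h i j :=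
    Finset.prod_congr rfl fun j _ => Finset.prod_congr rfl fun i hi => by
      simp [Finset.mem_Iio.1 hi]
  rw [e1, e2] at key
  have hu : (σ.sign : ℤ) * σ.sign = 1 := by
    rw [← Units.val_mul, Int.units_mul_self, Units.val_one]
  simpa [← mul_assoc, hu] using congrArg ((σ.sign : ℤ) * ·) key

/-- Stated with an equivalence, the inversion condition is symmetric in the two indices, as
`prod_Iio_comp_perm` requires. -/
theorem koszul_eq_prod (σ : Equiv.Perm (Fin N)) (p : Fin N → ZMod 2) :
    koszul σ p = ∏ j, ∏ i ∈ Finset.Iio j,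
      if (i < j ↔ σ i < σ j) then 1 else ksign (p (σ i) * p (σ j)) := by
  rw [koszul, Finset.prod_comm]
  refine Finset.prod_congr rfl fun j _ => ?_
  have : Finset.Iio j = Finset.univ.filter (· < j) := by ext; simp
  rw [this, Finset.prod_filter]
  refine Finset.prod_congr rfl fun i _ => ?_
  by_cases hij : i < j
  · have hne : σ i ≠ σ j := fun h => hij.ne (σ.injective h)
    rcases hne.lt_or_gt with h | h
    · simp [hij, h, h.not_gt]
    · simp [hij, h, h.not_gt]
  · simp [hij]

theorem ksign_mul_self (a : ZMod 2) : ksign a * ksign a = 1 := by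
  revert a; decide

/-- A pair is inverted by the product exactly when one, but not both, of the two successive
permutations inverts it; a double inversion contributes a square, which is 1. -/
theorem koszul_mul (σ τ : Equiv.Perm (Fin N)) (p : Fin N → ZMod 2) :
    koszul (σ * τ) p = koszul σ p * koszul τ fun i => p (σ i) := by
  rw [koszul_eq_prod, koszul_eq_prod, koszul_eq_prod,
    ← prod_Iio_comp_perm τ fun i j => if (i < j ↔ σ i < σ j) then 1 else ksign (p (σ i) * p (σ j))]
  · rw [← Finset.prod_mul_distrib]
    refine Finset.prod_congr rfl fun j _ => ?_
    rw [← Finset.prod_mul_distrib]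
    refine Finset.prod_congr rfl fun i _ => ?_
    simp only [Equiv.Perm.mul_apply]
    by_cases h1 : i < j <;> by_cases h2 : τ i < τ j <;> by_cases h3 : σ (τ i) < σ (τ j) <;>
      simp [h1, h2, h3, ksign_mul_self]
  · intro i j
    rw [mul_comm (p (σ j))]
    rcases lt_trichotomy i j with h | rfl | h
    · have hne : σ i ≠ σ j := fun h' => h.ne (σ.injective h')
      rcases hne.lt_or_gt with h' | h' <;> simp [h, h.not_gt, h', h'.not_gt]
    · simp
    · have hne : σ i ≠ σ j := fun h' => h.ne' (σ.injective h')
      rcases hne.lt_or_gt with h' | h' <;> simp [h, h.not_gt, h', h'.not_gt]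

theorem koszul_swap_castSucc_succ {m : ℕ} (i : Fin m) (p : Fin (m + 1) → ZMod 2) :
    koszul (Equiv.swap i.castSucc i.succ) p = ksign (p i.castSucc * p i.succ) := by
  rw [koszul, Finset.prod_eq_single i.castSucc, Finset.prod_eq_single i.succ]
  · simp [mul_comm]
  · intro j _ hj
    rw [if_neg]
    rintro ⟨h1, h2⟩
    have hj' : j ≠ i.castSucc := h1.ne'
    rw [Equiv.swap_apply_left, Equiv.swap_apply_of_ne_of_ne hj' hj] at h2
    simp only [Fin.lt_def, Fin.val_castSucc, Fin.val_succ] at h1 h2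
    omega
  · simp
  · intro k _ hk
    refine Finset.prod_eq_one fun j _ => if_neg ?_
    rintro ⟨h1, h2⟩
    simp only [Equiv.swap_apply_def] at h2
    simp only [ne_eq, Fin.ext_iff, Fin.lt_def, Fin.val_castSucc, Fin.val_succ] at h1 h2 hk
    split_ifs at h2 <;> simp_all <;> omega
  · simp

variable {V X : Type*} [AddCommGroup V] [AddCommGroup X]

/-- Antisymmetry under exchange of neighbours implies graded antisymmetry. -/
theorem antisymm_of_swap {𝒱 : ZMod 2 → AddSubgroup V} {m : ℕ} {f : (Fin (m + 1) → V) → X}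
    (hf : ∀ (v : Fin (m + 1) → V) (p : Fin (m + 1) → ZMod 2), (∀ i, v i ∈ 𝒱 (p i)) →
      ∀ i : Fin m, f v = ksign (1 + p i.castSucc * p i.succ) •
        f fun j => v (Equiv.swap i.castSucc i.succ j))
    (v : Fin (m + 1) → V) (p : Fin (m + 1) → ZMod 2) (hv : ∀ i, v i ∈ 𝒱 (p i))
    (σ : Equiv.Perm (Fin (m + 1))) :
    f v = ((Equiv.Perm.sign σ : ℤ) * koszul σ p) • f fun i => v (σ i) := by
  have hσ : σ ∈ Submonoid.closure
      (Set.range fun i : Fin m => Equiv.swap i.castSucc i.succ) := by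
    rw [Equiv.Perm.mclosure_swap_castSucc_succ]; trivial
  induction hσ using Submonoid.closure_induction generalizing v p with
  | mem σ hσ =>
    obtain ⟨i, rfl⟩ := hσ
    simp only [koszul_swap_castSucc_succ]
    rw [hf v p hv i, Equiv.Perm.sign_swap (Fin.castSucc_lt_succ (i := i)).ne, ksign_add]
    rfl
  | one =>
    have h : ∀ i j : Fin (m + 1), ¬(i < j ∧ j < i) := fun i j h => lt_asymm h.1 h.2
    simp [koszul, h]
  | mul σ τ _ _ hσ hτ =>
    rw [hσ v p hv, hτ (fun i => v (σ i)) (fun i => p (σ i)) fun i => hv (σ i), koszul_mul,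
      Equiv.Perm.sign_mul, Units.val_mul, smul_smul]
    simp only [Equiv.Perm.mul_apply]
    congr 1
    ring

end Koszul

/-! ### Neighbouring entries of tuples and of lists -/

section Lists

variable {α : Type*}

theorem ofFn_update_eq {N : ℕ} (w : Fin N → α) (i : Fin N) :
    ∃ l₁ l₂ : List α, l₁.length = i ∧ ∀ x, List.ofFn (Function.update w i x) = l₁ ++ x :: l₂ := by
  refine ⟨(List.ofFn w).take i, (List.ofFn w).drop (i + 1), by simp, fun x => ?_⟩
  have : List.ofFn (Function.update w i x) = (List.ofFn w).set i x := by
    refine List.ext_getElem (by simp) fun n h1 h2 => ?_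
    simp only [List.getElem_ofFn, List.getElem_set, Function.update_apply, Fin.ext_iff]
    simp only [eq_comm]
  rw [this, List.set_eq_take_append_cons_drop, if_pos (by simp)]

theorem ofFn_update_update_eq {m : ℕ} (w : Fin (m + 1) → α) (i : Fin m) :
    ∃ l₁ l₂ : List α, l₁.length = i ∧ ∀ x y,
      List.ofFn (Function.update (Function.update w i.castSucc x) i.succ y) =
        l₁ ++ x :: y :: l₂ := by
  have key : ∀ (l : List α) (k : ℕ) (x y : α), k + 1 < l.length →
      (l.set k x).set (k + 1) y = l.take k ++ x :: y :: l.drop (k + 2) := by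
    intro l
    induction l with
    | nil => intro k x y h; simp at h
    | cons a l ih =>
      intro k x y h
      cases k with
      | zero =>
        cases l with
        | nil => simp at h
        | cons b l => simp
      | succ k => simpa using ih k x y (by simpa using h)
  refine ⟨(List.ofFn w).take i, (List.ofFn w).drop (i + 2), by simp; omega, fun x y => ?_⟩
  rw [← key _ _ _ _ (by simp)]
  refine List.ext_getElem (by simp) fun n h1 h2 => ?_
  simp only [List.getElem_ofFn, List.getElem_set, Function.update_apply, Fin.ext_iff,
    Fin.val_succ, Fin.val_castSucc]
  simp only [eq_comm]

theorem comp_swap_eq_update {m : ℕ} (w : Fin (m + 1) → α) (i : Fin m) :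
    (fun j => w (Equiv.swap i.castSucc i.succ j)) =
      Function.update (Function.update w i.castSucc (w i.succ)) i.succ (w i.castSucc) := by
  funext j
  rcases eq_or_ne j i.succ with rfl | h1
  · simp
  · rcases eq_or_ne j i.castSucc with rfl | h2
    · simp [h1]
    · simp [h1, h2, Equiv.swap_apply_of_ne_of_ne h2 h1]

theorem ofFn_swap_eq {m : ℕ} (w : Fin (m + 1) → α) (i : Fin m) :
    ∃ l₁ l₂ : List α, l₁.length = i ∧ List.ofFn w = l₁ ++ w i.castSucc :: w i.succ :: l₂ ∧
      List.ofFn (fun j => w (Equiv.swap i.castSucc i.succ j)) =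
        l₁ ++ w i.succ :: w i.castSucc :: l₂ := by
  obtain ⟨l₁, l₂, h, e⟩ := ofFn_update_update_eq w i
  refine ⟨l₁, l₂, h, ?_, ?_⟩
  · rw [← e]; simp
  · rw [comp_swap_eq_update, e]

theorem eq_ofFn_swap {α : Type*} (l₁ l₂ : List α) (a b : α) :
    ∃ (m : ℕ) (w : Fin (m + 1) → α) (i : Fin m), l₁ ++ a :: b :: l₂ = List.ofFn w ∧
      l₁ ++ b :: a :: l₂ = List.ofFn (fun j => w (Equiv.swap i.castSucc i.succ j)) ∧
      w i.castSucc = a ∧ w i.succ = b := by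
  obtain ⟨N, w, hw⟩ : ∃ (N : ℕ) (w : Fin N → α), l₁ ++ a :: b :: l₂ = List.ofFn w :=
    ⟨_, _, (List.ofFn_get _).symm⟩
  have hN : N = l₁.length + l₂.length + 1 + 1 := by
    have := congrArg List.length hw
    simp at this
    omega
  subst hN
  obtain ⟨l₁', l₂', h, e1, e2⟩ := ofFn_swap_eq w ⟨l₁.length, by omega⟩
  refine ⟨_, w, ⟨l₁.length, by omega⟩, hw, ?_⟩
  rw [← hw] at e1
  obtain ⟨rfl, e3⟩ := List.append_inj e1 h.symm
  simp only [List.cons.injEq] at e3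
  rw [e2, ← e3.1, ← e3.2.1, e3.2.2]
  exact ⟨rfl, rfl, rfl⟩

end Lists

end LInfty

namespace LInfty

/-! ### Homogeneous components and multi-additive maps -/

section Graded

variable {V X : Type*} [AddCommGroup V] [AddCommGroup X]
variable (𝒱 : ZMod 2 → AddSubgroup V) [DirectSum.Decomposition 𝒱]

theorem sum_proj (x : V) : ∑ p, proj 𝒱 p x = x := by
  classical
  conv_rhs => rw [← DirectSum.sum_support_decompose 𝒱 x]
  refine (Finset.sum_subset (Finset.subset_univ _) fun p _ hp => ?_).symm
  rw [DFinsupp.notMem_support_iff] at hp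
  rw [proj, hp]
  rfl

theorem proj_mem (p : ZMod 2) (x : V) : proj 𝒱 p x ∈ 𝒱 p := SetLike.coe_mem _

theorem proj_of_mem {p : ZMod 2} {x : V} (hx : x ∈ 𝒱 p) : proj 𝒱 p x = x :=
  DirectSum.decompose_of_mem_same 𝒱 hx

theorem proj_of_mem_ne {p q : ZMod 2} {x : V} (hx : x ∈ 𝒱 p) (hpq : p ≠ q) : proj 𝒱 q x = 0 :=
  DirectSum.decompose_of_mem_ne 𝒱 hx hpq

/-- The projection to a homogeneous component as a homomorphism. -/
def projHom (p : ZMod 2) : V →+ V :=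
  AddMonoidHom.mk' (proj 𝒱 p) fun x y => by
    simp [proj, DirectSum.decompose_add]

@[simp] theorem projHom_apply (p : ZMod 2) (x : V) : projHom 𝒱 p x = proj 𝒱 p x := rfl

theorem proj_add (p : ZMod 2) (x y : V) : proj 𝒱 p (x + y) = proj 𝒱 p x + proj 𝒱 p y :=
  map_add (projHom 𝒱 p) x y

theorem proj_zsmul (p : ZMod 2) (n : ℤ) (x : V) : proj 𝒱 p (n • x) = n • proj 𝒱 p x :=
  map_zsmul (projHom 𝒱 p) n x

theorem proj_zero (p : ZMod 2) : proj 𝒱 p (0 : V) = 0 := map_zero (projHom 𝒱 p)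

/-- Additivity in every argument. -/
def MultiAdditive {N : ℕ} (f : (Fin N → V) → X) : Prop :=
  ∀ (v : Fin N → V) (i : Fin N) (x y : V), f (Function.update v i (x + y)) =
    f (Function.update v i x) + f (Function.update v i y)

variable {𝒱}
variable {N : ℕ} {f g : (Fin N → V) → X}

/-- A multi-additive function as a multilinear map over the integers. -/
def MultiAdditive.toMultilinearMap (hf : MultiAdditive f) :
    MultilinearMap ℤ (fun _ : Fin N => V) X where
  toFun := f
  map_update_add' {inst} v i x y := by
    cases Subsingleton.elim inst (instDecidableEqFin N)
    exact hf v i x y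
  map_update_smul' {inst} v i c x := by
    cases Subsingleton.elim inst (instDecidableEqFin N)
    exact map_zsmul (AddMonoidHom.mk' (fun x => f (Function.update v i x)) (hf v i)) c x

theorem MultiAdditive.update_zero (hf : MultiAdditive f) (v : Fin N → V) (i : Fin N) :
    f (Function.update v i 0) = 0 :=
  map_zero (AddMonoidHom.mk' (fun x => f (Function.update v i x)) (hf v i))

theorem MultiAdditive.eq_zero (hf : MultiAdditive f) {v : Fin N → V} {i : Fin N} (hv : v i = 0) :
    f v = 0 := by
  rw [← Function.update_eq_self i v, hv, hf.update_zero]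

variable (𝒱) in
theorem MultiAdditive.eq_sum_proj (hf : MultiAdditive f) (v : Fin N → V) :
    f v = ∑ p : Fin N → ZMod 2, f fun i => proj 𝒱 (p i) (v i) := by
  conv_lhs => rw [show v = fun i => ∑ p, proj 𝒱 p (v i) from funext fun i => (sum_proj 𝒱 _).symm]
  exact hf.toMultilinearMap.map_sum fun i p => proj 𝒱 p (v i)

variable (𝒱) in
theorem MultiAdditive.ext (hf : MultiAdditive f) (hg : MultiAdditive g)
    (h : ∀ (v : Fin N → V) (p : Fin N → ZMod 2), (∀ i, v i ∈ 𝒱 (p i)) → f v = g v) : f = g := by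
  funext v
  rw [hf.eq_sum_proj 𝒱, hg.eq_sum_proj 𝒱]
  exact Finset.sum_congr rfl fun p _ => h _ p fun i => proj_mem 𝒱 _ _

theorem MultiAdditive.comp_hom (hf : MultiAdditive f) (A : Fin N → V →+ V) :
    MultiAdditive fun v => f fun i => A i (v i) := by
  intro v i x y
  have h : ∀ z, (fun j => A j (Function.update v i z j)) =
      Function.update (fun j => A j (v j)) i (A i z) := by
    intro z
    funext j
    rcases eq_or_ne j i with rfl | hj
    · simp
    · simp [hj]
  simp only [h, map_add, hf _ _ _ _]

theorem MultiAdditive.comp_update (hf : MultiAdditive f) (i : Fin N) (A : V →+ V) :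
    MultiAdditive fun v => f (Function.update v i (A (v i))) := by
  have h := hf.comp_hom (Function.update (fun _ => AddMonoidHom.id V) i A)
  convert h using 3 with v
  funext j
  rcases eq_or_ne j i with rfl | hj
  · simp
  · simp [hj]

theorem MultiAdditive.map (hf : MultiAdditive f) {Y : Type*} [AddCommGroup Y] (A : X →+ Y) :
    MultiAdditive fun v => A (f v) := fun v i x y => by simp only [hf v i x y, map_add]

theorem MultiAdditive.sum {ι : Type*} (s : Finset ι) {F : ι → (Fin N → V) → X}
    (hF : ∀ i ∈ s, MultiAdditive (F i)) : MultiAdditive fun v => ∑ i ∈ s, F i v := fun v i x y => by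
  rw [← Finset.sum_add_distrib]
  exact Finset.sum_congr rfl fun j hj => hF j hj v i x y

end Graded

/-! ### The décalage from tuples to lists of letters -/

section Decalage

variable {K V X : Type*} [Ring K] [AddCommGroup V] [Module K V] [Module Kᵐᵒᵖ V]
  [AddCommGroup X] [Module Kᵐᵒᵖ X]

/-- The exponent of the décalage sign. -/
def decalage (e : ZMod 2) : List (V × ZMod 2) → ZMod 2
  | [] => 0
  | a :: l => (a.2 + 1) * ((l.length : ZMod 2) + e) + decalage e l

omit [AddCommGroup V] in
-- The parameter `e` acts as a number of further letters to the right: a letter contributes its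
-- parity times the number of letters that follow it, plus `e`.
theorem decalage_append (e : ZMod 2) (l₁ l₂ : List (V × ZMod 2)) :
    decalage e (l₁ ++ l₂) = decalage ((l₂.length : ZMod 2) + e) l₁ + decalage e l₂ := by
  induction l₁ with
  | nil => simp [decalage]
  | cons a l₁ ih => simp only [List.cons_append, decalage, ih, List.length_append]; push_cast; ring

omit [AddCommGroup V] in
-- This turns antisymmetry into symmetry: for labels a, b the parities are a + 1 and b + 1, and 1 +
-- (a + 1)(b + 1) + a + b = ab in ℤ/2.
theorem decalage_swap (e : ZMod 2) (l₁ l₂ : List (V × ZMod 2)) (a b : V × ZMod 2) :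
    decalage e (l₁ ++ a :: b :: l₂) = decalage e (l₁ ++ b :: a :: l₂) + a.2 + b.2 := by
  simp only [decalage_append, decalage, List.length_cons]
  push_cast
  generalize decalage ((l₂.length : ZMod 2) + 1 + 1 + e) l₁ = x
  generalize decalage e l₂ = y, a.2 = z, b.2 = t,
    (l₂.length : ZMod 2) = n
  clear * -
  decide +revert

/-- The function of lists of labelled elements that corresponds to a sequence of maps, including the
décalage sign. -/
def listForm (e : ZMod 2) (F : ∀ N : ℕ, (Fin N → V) → X) (l : List (V × ZMod 2)) : X :=
  ksign (decalage e l) • F l.length fun i => (l.get i).1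

/-- The list of the entries of `v`, labelled by their shifted parities. -/
def letters {N : ℕ} (v : Fin N → V) (p : Fin N → ZMod 2) : List (V × ZMod 2) :=
  List.ofFn fun i => (v i, p i + 1)

omit [AddCommGroup V] in
theorem listForm_ofFn (e : ZMod 2) (F : ∀ N : ℕ, (Fin N → V) → X) {N : ℕ}
    (w : Fin N → V × ZMod 2) :
    listForm e F (List.ofFn w) = ksign (decalage e (List.ofFn w)) • F N fun i => (w i).1 := by
  have key : ∀ (M : ℕ) (h : M = N) (u : Fin M → V × ZMod 2), (∀ i, u i = w (i.cast h)) →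
      (F M fun i => (u i).1) = F N fun i => (w i).1 := by
    rintro M rfl u hu
    simp [hu]
  rw [listForm, key _ (List.length_ofFn) _ fun i => by simp [Fin.cast]]

theorem add_one_add_one (a : ZMod 2) : a + 1 + 1 = a := by revert a; decide

theorem shifted_of_mem_letters {𝒱 : ZMod 2 → AddSubgroup V} {N : ℕ} {v : Fin N → V}
    {p : Fin N → ZMod 2} (hv : ∀ i, v i ∈ 𝒱 (p i)) : ∀ c ∈ letters v p, Shifted 𝒱 c := by
  intro c hc
  rw [letters, List.mem_ofFn] at hc
  obtain ⟨i, rfl⟩ := hc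
  simpa only [Shifted, add_one_add_one] using hv i

omit [AddCommGroup V] in
theorem append_singleton_eq_ofFn {α : Type*} (l : List α) (a : α) :
    l ++ [a] = List.ofFn (Fin.snoc (α := fun _ => α) l.get a) := by
  rw [List.ofFn_succ']
  simp

omit [AddCommGroup V] in
theorem listForm_append_singleton (e : ZMod 2) (F : ∀ N : ℕ, (Fin N → V) → X)
    (l : List (V × ZMod 2)) (a : V × ZMod 2) :
    listForm e F (l ++ [a]) = ksign (decalage e (l ++ [a])) •
      F (l.length + 1) (Fin.snoc (α := fun _ => V) (fun i => (l.get i).1) a.1) := by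
  rw [append_singleton_eq_ofFn, listForm_ofFn]
  congr 2
  funext i
  refine Fin.lastCases ?_ (fun i => ?_) i <;> simp

theorem headAdditive_listForm (e : ZMod 2) {F : ∀ N : ℕ, (Fin N → V) → X}
    (hF : ∀ m, MultiAdditive (F (m + 1))) : HeadAdditive (listForm e F) := by
  intro x y p l
  have key : ∀ z, listForm e F ((z, p) :: l) = ksign (decalage e ((0, p) :: l)) •
      F (l.length + 1) (Function.update (Fin.cons 0 fun i => (l.get i).1 : Fin (l.length + 1) → V)
        0 z) := by
    intro z
    rw [listForm, Fin.update_cons_zero]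
    congr 2
    funext i
    refine Fin.cases ?_ (fun i => ?_) i <;> rfl
  rw [key, key, key, hF, smul_add]

theorem swapSymm_listForm {𝒱 : ZMod 2 → AddSubgroup V} (e : ZMod 2) {F : ∀ N : ℕ, (Fin N → V) → X}
    (hF : ∀ (m : ℕ) (v : Fin (m + 1) → V) (p : Fin (m + 1) → ZMod 2), (∀ i, v i ∈ 𝒱 (p i)) →
      ∀ σ : Equiv.Perm (Fin (m + 1)),
        F (m + 1) v = ((Equiv.Perm.sign σ : ℤ) * koszul σ p) • F (m + 1) fun i => v (σ i)) :
    SwapSymm (Shifted 𝒱) (listForm e F) := by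
  intro l₁ l₂ a b hl
  have hd := decalage_swap e l₁ l₂ a b
  obtain ⟨m, w, i, h1, h2, rfl, rfl⟩ := eq_ofFn_swap l₁ l₂ a b
  rw [h1] at hl
  rw [h1, h2] at hd ⊢
  rw [listForm_ofFn, listForm_ofFn, hd]
  rw [hF m (fun i => (w i).1) (fun i => (w i).2 + 1)
    (fun i => hl _ (List.mem_ofFn.2 ⟨i, rfl⟩)) (Equiv.swap i.castSucc i.succ),
    koszul_swap_castSucc_succ, Equiv.Perm.sign_swap (Fin.castSucc_lt_succ (i := i)).ne]
  have : ((-1 : ℤˣ) : ℤ) = ksign 1 := by decide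
  rw [this, ← ksign_add, ksign_smul_ksign_smul, ksign_smul_ksign_smul]
  refine ksign_smul_congr ?_ _
  generalize (w i.castSucc).2 = x, (w i.succ).2 = y, decalage (_ : ZMod 2) _ = z
  clear * -
  decide +revert

/-- Right linearity of a cochain concerns its last argument. Symmetry moves the head letter to the
end and back, which costs the sign of the scalar against the other letters. -/
theorem headLinear_listForm {𝒦 : ZMod 2 → AddSubgroup K} {𝒱 : ZMod 2 → AddSubgroup V}
    (hV : IsSupermodule 𝒦 𝒱) (e : ZMod 2) {F : ∀ N : ℕ, (Fin N → V) → X}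
    (hF : ∀ m, IsCochain K 𝒱 (F (m + 1))) : HeadLinear 𝒦 𝒱 e (listForm e F) := by
  intro s t ht a l ha hl
  have hta := ha.op_smul hV ht
  have hsw := swapSymm_listForm e fun m => (hF m).antisymm
  have h1 := hsw.cons_eq_append [] l [] a (by simpa using ⟨ha, fun x y => hl (x, y)⟩)
  have h2 := hsw.cons_eq_append [] l [] (MulOpposite.op t • a.1, a.2 + s) (by
    intro c hc
    simp only [List.nil_append, List.append_nil, List.mem_cons] at hc
    rcases hc with rfl | hc
    exacts [hta, hl c hc])
  simp only [List.nil_append, List.append_nil] at h1 h2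
  have h3 := (hF l.length).map_op_smul (Fin.snoc (α := fun _ => V) (fun i => (l.get i).1) a.1) t
  simp only [Fin.snoc_last, Fin.update_snoc_last] at h3
  rw [h1, h2, listForm_append_singleton, listForm_append_singleton, h3,
    smul_comm (MulOpposite.op t), smul_comm (MulOpposite.op t)]
  simp only [ksign_smul_ksign_smul, decalage_append, decalage, List.length_cons, List.length_nil]
  refine ksign_smul_congr ?_ _
  generalize decalage (_ : ZMod 2) _ = x, label l = y, a.2 = z
  clear * -
  push_cast
  decide +revert

section Middle

variable {𝒦 : ZMod 2 → AddSubgroup K} {𝒱 : ZMod 2 → AddSubgroup V} {F : List (V × ZMod 2) → X}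

theorem SwapSymm.append_cons_eq_cons (hF : SwapSymm (Shifted 𝒱) F) {l₁ l₂ : List (V × ZMod 2)}
    {a : V × ZMod 2} (hl : ∀ c ∈ l₁ ++ a :: l₂, Shifted 𝒱 c) :
    F (l₁ ++ a :: l₂) = ksign (a.2 * label l₁) • F (a :: (l₁ ++ l₂)) := by
  have h := hF.cons_eq_append [] l₁ l₂ a (by
    intro c hc
    apply hl
    simp only [List.nil_append, List.cons_append, List.mem_append, List.mem_cons] at hc ⊢
    tauto)
  simp only [List.nil_append, List.cons_append] at h
  rw [h, ksign_smul_self]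

theorem SwapSymm.add_middle (hF : SwapSymm (Shifted 𝒱) F) (hFa : HeadAdditive F)
    {l₁ l₂ : List (V × ZMod 2)} {x y : V} {p : ZMod 2} (hx : x ∈ 𝒱 (p + 1)) (hy : y ∈ 𝒱 (p + 1))
    (hl : ∀ c ∈ l₁ ++ l₂, Shifted 𝒱 c) :
    F (l₁ ++ (x + y, p) :: l₂) = F (l₁ ++ (x, p) :: l₂) + F (l₁ ++ (y, p) :: l₂) := by
  have key : ∀ z ∈ 𝒱 (p + 1), ∀ c ∈ l₁ ++ (z, p) :: l₂, Shifted 𝒱 c := by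
    intro z hz c hc
    have := hl c
    simp only [List.mem_append, List.mem_cons] at hc this
    rcases hc with hc | rfl | hc
    exacts [this (Or.inl hc), hz, this (Or.inr hc)]
  rw [hF.append_cons_eq_cons (key x hx), hF.append_cons_eq_cons (key y hy),
    hF.append_cons_eq_cons (key _ (add_mem hx hy)), hFa, smul_add]

/-- Symmetry carries the letter to the head and back. The sign records the letters, and the shift
`e`, that the scalar passes on its way out to the right. -/
theorem SwapSymm.op_smul_middle (hV : IsSupermodule 𝒦 𝒱) {e : ZMod 2}
    (hF : SwapSymm (Shifted 𝒱) F) (hFl : HeadLinear 𝒦 𝒱 e F) {s : ZMod 2} {t : K} (ht : t ∈ 𝒦 s)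
    {l₁ l₂ : List (V × ZMod 2)} {a : V × ZMod 2} (hl : ∀ c ∈ l₁ ++ a :: l₂, Shifted 𝒱 c) :
    F (l₁ ++ (MulOpposite.op t • a.1, a.2 + s) :: l₂) =
      ksign (s * (label l₂ + e)) • MulOpposite.op t • F (l₁ ++ a :: l₂) := by
  have ha : Shifted 𝒱 a := hl a (by simp)
  have hl' : ∀ c ∈ l₁ ++ l₂, Shifted 𝒱 c := by
    intro c hc
    apply hl
    simp only [List.mem_append, List.mem_cons] at hc ⊢
    tauto
  rw [hF.append_cons_eq_cons hl, hF.append_cons_eq_cons (by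
    intro c hc
    have := hl' c
    simp only [List.mem_append, List.mem_cons] at hc this
    rcases hc with hc | rfl | hc
    exacts [this (Or.inl hc), ha.op_smul hV ht, this (Or.inr hc)]), hFl s t ht a _ ha hl',
    smul_comm (MulOpposite.op t)]
  simp only [ksign_smul_ksign_smul, label_append]
  refine ksign_smul_congr ?_ _
  generalize label l₁ = x, label l₂ = y, a.2 = z
  clear * -
  decide +revert

end Middle

end Decalage

end LInfty

namespace LInfty

/-! ### From symmetric functions of lists back to cochains -/

section Extend

variable {K V X : Type*} [Ring K] [AddCommGroup V] [Module K V] [Module Kᵐᵒᵖ V]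
  [AddCommGroup X] [Module Kᵐᵒᵖ X]

omit [AddCommGroup V] in
theorem decalage_congr (e : ZMod 2) {l l' : List (V × ZMod 2)}
    (h : l.map Prod.snd = l'.map Prod.snd) : decalage e l = decalage e l' := by
  induction l generalizing l' with
  | nil => rw [List.map_nil, eq_comm, List.map_eq_nil_iff] at h; rw [h]
  | cons a l ih =>
    cases l' with
    | nil => simp at h
    | cons b l' =>
      simp only [List.map_cons, List.cons.injEq] at h
      have := congrArg List.length h.2
      simp only [List.length_map] at this
      rw [decalage, decalage, ih h.2, h.1, this]

omit [AddCommGroup V] in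
theorem decalage_letters_congr (e : ZMod 2) {N : ℕ} (v v' : Fin N → V) (p : Fin N → ZMod 2) :
    decalage e (letters v p) = decalage e (letters v' p) :=
  decalage_congr e (by simp [letters, List.map_ofFn, Function.comp_def])

omit [AddCommGroup V] in
theorem exists_letters_eq (l : List (V × ZMod 2)) :
    ∃ (v : Fin l.length → V) (p : Fin l.length → ZMod 2), l = letters v p := by
  refine ⟨fun i => (l.get i).1, fun i => (l.get i).2 + 1, ?_⟩
  simp only [letters, add_one_add_one]
  exact (List.ofFn_get l).symm

theorem mem_of_shifted_letters {𝒱 : ZMod 2 → AddSubgroup V} {N : ℕ} {v : Fin N → V}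
    {p : Fin N → ZMod 2} (h : ∀ c ∈ letters v p, Shifted 𝒱 c) (i : Fin N) : v i ∈ 𝒱 (p i) := by
  have := h (v i, p i + 1) (List.mem_ofFn.2 ⟨i, rfl⟩)
  simpa only [Shifted, add_one_add_one] using this

omit [AddCommGroup V] in
theorem letters_update {N : ℕ} (v : Fin N → V) (p : Fin N → ZMod 2) (i : Fin N) (x : V)
    (q : ZMod 2) : letters (Function.update v i x) (Function.update p i q) =
      List.ofFn (Function.update (fun j => (v j, p j + 1)) i (x, q + 1)) := by
  rw [letters]
  congr 1
  funext j
  rcases eq_or_ne j i with rfl | hj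
  · simp
  · simp [hj]

omit [AddCommGroup V] in
theorem listForm_letters (e : ZMod 2) (F : ∀ N : ℕ, (Fin N → V) → X) {N : ℕ} (v : Fin N → V)
    (p : Fin N → ZMod 2) :
    listForm e F (letters v p) = ksign (decalage e (letters v p)) • F N v :=
  listForm_ofFn e F _

/-- Multi-additivity reduces every axiom to homogeneous arguments and scalars. Balancing then
compares two ways of pulling the same scalar out of neighbouring entries, and antisymmetry need only
be checked for neighbouring transpositions. -/
theorem isCochain_of_list {𝒦 : ZMod 2 → AddSubgroup K} [DirectSum.Decomposition 𝒦]
    {𝒱 : ZMod 2 → AddSubgroup V} [DirectSum.Decomposition 𝒱] (hV : IsSupermodule 𝒦 𝒱) {e : ZMod 2}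
    {F : List (V × ZMod 2) → X} (hF : SwapSymm (Shifted 𝒱) F) (hFl : HeadLinear 𝒦 𝒱 e F)
    {m : ℕ} {f : (Fin (m + 1) → V) → X} (hf : MultiAdditive f)
    (hfF : ∀ (v : Fin (m + 1) → V) (p : Fin (m + 1) → ZMod 2), (∀ i, v i ∈ 𝒱 (p i)) →
      f v = ksign (decalage e (letters v p)) • F (letters v p)) : IsCochain K 𝒱 f := by
  have hup : ∀ {v : Fin (m + 1) → V} {p : Fin (m + 1) → ZMod 2}, (∀ i, v i ∈ 𝒱 (p i)) →
      ∀ {i : Fin (m + 1)} {x : V} {q : ZMod 2}, x ∈ 𝒱 q →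
      ∀ j, Function.update v i x j ∈ 𝒱 (Function.update p i q j) := by
    intro v p hv i x q hx j
    rcases eq_or_ne j i with rfl | hj
    · simpa using hx
    · simpa [hj] using hv j
  have hadd : ∀ t, t = ∑ s, proj 𝒦 s t := fun t => (sum_proj 𝒦 t).symm
  have hop : ∀ (t : K) (x : V), MulOpposite.op t • x =
      ∑ s, MulOpposite.op (proj 𝒦 s t) • x := fun t x => by
    conv_lhs => rw [hadd t, Finset.op_sum, Finset.sum_smul]
  have hupd : ∀ (v : Fin (m + 1) → V) (i : Fin (m + 1)) (g : ZMod 2 → V),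
      f (Function.update v i (∑ s, g s)) = ∑ s, f (Function.update v i (g s)) := fun v i g =>
    map_sum (AddMonoidHom.mk' (fun x => f (Function.update v i x)) (hf v i)) g _
  refine ⟨hf, fun v i t => ?_, fun v t => ?_, antisymm_of_swap fun v p hv i => ?_⟩
  · suffices H : ∀ (s : ZMod 2) (t : K), t ∈ 𝒦 s →
        f (Function.update v i.castSucc (MulOpposite.op t • v i.castSucc)) =
          f (Function.update v i.succ (t • v i.succ)) by
      have e1 : t • v i.succ = ∑ s, proj 𝒦 s t • v i.succ := by
        conv_lhs => rw [hadd t, Finset.sum_smul]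
      rw [hop, e1, hupd, hupd]
      exact Finset.sum_congr rfl fun s _ => H s _ (proj_mem 𝒦 _ _)
    intro s t ht
    refine congrFun (MultiAdditive.ext 𝒱
      (hf.comp_update i.castSucc (DistribSMul.toAddMonoidHom V (MulOpposite.op t)))
      (hf.comp_update i.succ (DistribSMul.toAddMonoidHom V t)) fun v p hv => ?_) v
    obtain ⟨l₁, l₂, -, hl⟩ := ofFn_update_update_eq (fun j => (v j, p j + 1)) i
    have hne : i.succ ≠ i.castSucc := (Fin.castSucc_lt_succ (i := i)).ne'
    have h0 : letters v p =
        l₁ ++ (v i.castSucc, p i.castSucc + 1) :: (v i.succ, p i.succ + 1) :: l₂ := by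
      rw [← hl]; simp [letters]
    have h1 := letters_update v p i.castSucc (MulOpposite.op t • v i.castSucc) (p i.castSucc + s)
    have h2 := letters_update v p i.succ (t • v i.succ) (p i.succ + s)
    have e1 : ∀ y, (Function.update (fun j => (v j, p j + 1)) i.castSucc y) =
        Function.update (Function.update (fun j => (v j, p j + 1)) i.castSucc y) i.succ
          (v i.succ, p i.succ + 1) := by
      intro y
      rw [eq_comm, Function.update_eq_self_iff]
      simp [hne]
    have e2 : ∀ y, (Function.update (fun j => (v j, p j + 1)) i.succ y) =
        Function.update (Function.update (fun j => (v j, p j + 1)) i.castSucc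
          (v i.castSucc, p i.castSucc + 1)) i.succ y := by
      intro y
      rw [Function.update_eq_self]
    rw [e1, hl] at h1
    rw [e2, hl] at h2
    have hg := shifted_of_mem_letters hv
    have hg1 := hg
    rw [h0] at hg1
    have e4 : t • v i.succ = ksign (s * p i.succ) • MulOpposite.op t • v i.succ := by
      rw [hV.op_smul s _ t _ ht (hv _), ksign_smul_self]
    change f (Function.update v i.castSucc (MulOpposite.op t • v i.castSucc)) =
      f (Function.update v i.succ (t • v i.succ))
    have hsm : f (Function.update v i.succ (t • v i.succ)) =
        ksign (s * p i.succ) • f (Function.update v i.succ (MulOpposite.op t • v i.succ)) := by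
      rw [e4]
      exact map_zsmul (AddMonoidHom.mk' (fun x => f (Function.update v i.succ x)) (hf v i.succ)) _ _
    have h2' := letters_update v p i.succ (MulOpposite.op t • v i.succ) (p i.succ + s)
    rw [e2, hl] at h2'
    rw [hsm, hfF _ _ (hup hv (hV.op_smul_mem ht (hv i.castSucc))),
      hfF _ _ (hup hv (hV.op_smul_mem ht (hv i.succ))), h1, h2']
    -- The scalar is extracted once from each of the two neighbouring positions; the results differ
    -- by the sign of the letter in between, which matches the change of the décalage sign and the
    -- passage from left to right action.
    have k1 := hF.op_smul_middle hV hFl ht (a := (v i.castSucc, p i.castSucc + 1)) hg1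
    have k2 := hF.op_smul_middle hV hFl ht (l₁ := l₁ ++ [(v i.castSucc, p i.castSucc + 1)])
      (l₂ := l₂) (a := (v i.succ, p i.succ + 1)) (by simpa using hg1)
    simp only [List.append_assoc, List.cons_append, List.nil_append] at k2
    simp only [add_right_comm _ s 1, k1, k2]
    simp only [ksign_smul_ksign_smul, decalage_append, decalage, List.length_cons, label_cons]
    refine ksign_smul_congr ?_ _
    push_cast
    generalize decalage ((l₂.length : ZMod 2) + 1 + 1 + e) l₁ = x
    generalize decalage e l₂ = y, label l₂ = z, p i.succ = a, p i.castSucc = b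
    generalize (l₂.length : ZMod 2) = n
    have key : ∀ n b s a e : ZMod 2, (b + 1 + s + 1) * (n + 1 + e) + (a + 1 + 1) * (n + e) +
        s * (a + 1 + z + e) = s * a + ((b + 1 + 1) * (n + 1 + e) + (a + 1 + s + 1) * (n + e)) +
        s * (z + e) := by
      revert z; clear * -; decide
    linear_combination key n b s a e
  · suffices H : ∀ (s : ZMod 2) (t : K), t ∈ 𝒦 s →
        f (Function.update v (Fin.last m) (MulOpposite.op t • v (Fin.last m))) =
          MulOpposite.op t • f v by
      have e1 : MulOpposite.op t • f v = ∑ s, MulOpposite.op (proj 𝒦 s t) • f v := by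
        conv_lhs => rw [hadd t, Finset.op_sum, Finset.sum_smul]
      rw [hop, e1, hupd]
      exact Finset.sum_congr rfl fun s _ => H s _ (proj_mem 𝒦 _ _)
    intro s t ht
    refine congrFun (MultiAdditive.ext 𝒱
      (hf.comp_update (Fin.last m) (DistribSMul.toAddMonoidHom V (MulOpposite.op t)))
      (hf.map (DistribSMul.toAddMonoidHom X (MulOpposite.op t))) fun v p hv => ?_) v
    obtain ⟨l₁, l₂, hlen, hl⟩ := ofFn_update_eq (fun j => (v j, p j + 1)) (Fin.last m)
    have hl₂ : l₂ = [] := by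
      have := congrArg List.length (hl (v 0, 0))
      simp only [List.length_ofFn, List.length_append, hlen, List.length_cons, Fin.val_last] at this
      exact List.length_eq_zero_iff.1 (by omega)
    subst hl₂
    have h0 : letters v p = l₁ ++ [(v (Fin.last m), p (Fin.last m) + 1)] := by
      rw [← hl]; simp [letters]
    have h1 := letters_update v p (Fin.last m) (MulOpposite.op t • v (Fin.last m))
      (p (Fin.last m) + s)
    rw [hl] at h1
    have hg := shifted_of_mem_letters hv
    rw [h0] at hg
    have k1 := hF.op_smul_middle hV hFl ht hg
    change f (Function.update v (Fin.last m) (MulOpposite.op t • v (Fin.last m))) =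
      MulOpposite.op t • f v
    rw [hfF _ _ hv, hfF _ _ (hup hv (hV.op_smul_mem ht (hv (Fin.last m)))), h1, h0,
      add_right_comm _ s 1, k1, smul_comm (MulOpposite.op t)]
    simp only [ksign_smul_ksign_smul, decalage_append, decalage, List.length_nil, List.length_cons,
      label_nil]
    refine ksign_smul_congr ?_ _
    push_cast
    ring_nf
    have : (2 : ZMod 2) = 0 := by decide
    simp only [this, mul_zero, add_zero]
  · obtain ⟨l₁, l₂, -, h1, h2⟩ := ofFn_swap_eq (fun j => (v j, p j + 1)) i
    have hg := shifted_of_mem_letters hv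
    rw [hfF v p hv, hfF _ (fun j => p (Equiv.swap i.castSucc i.succ j)) fun j => hv _]
    simp only [letters] at hg ⊢
    rw [h1] at hg ⊢
    rw [h2, hF _ _ _ _ hg, decalage_swap]
    simp only [ksign_smul_ksign_smul]
    refine ksign_smul_congr ?_ _
    generalize decalage e _ = x
    generalize p i.castSucc = y, p i.succ = z
    clear * -
    decide +revert

variable (𝒱 : ZMod 2 → AddSubgroup V) [DirectSum.Decomposition 𝒱]

/-- The multi-additive function of `N` arguments determined by a function of lists of homogeneous
elements. -/
def extend (e : ZMod 2) (F : List (V × ZMod 2) → X) (N : ℕ) (v : Fin N → V) : X :=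
  ∑ p : Fin N → ZMod 2, ksign (decalage e (letters (fun i => proj 𝒱 (p i) (v i)) p)) •
    F (letters (fun i => proj 𝒱 (p i) (v i)) p)

variable {𝒱}

theorem shifted_letters_proj {N : ℕ} (v : Fin N → V) (p : Fin N → ZMod 2) :
    ∀ c ∈ letters (fun i => proj 𝒱 (p i) (v i)) p, Shifted 𝒱 c :=
  shifted_of_mem_letters fun _ => proj_mem 𝒱 _ _

theorem extend_of_mem {e : ZMod 2} {F : List (V × ZMod 2) → X} (hF : SwapSymm (Shifted 𝒱) F)
    (hFa : HeadAdditive F) {N : ℕ} {v : Fin N → V} {p : Fin N → ZMod 2} (hv : ∀ i, v i ∈ 𝒱 (p i)) :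
    extend 𝒱 e F N v = ksign (decalage e (letters v p)) • F (letters v p) := by
  rw [extend, Finset.sum_eq_single p]
  · simp only [proj_of_mem 𝒱 (hv _)]
  · intro q _ hq
    obtain ⟨i, hi⟩ := Function.ne_iff.1 hq
    obtain ⟨l₁, l₂, -, hl⟩ :=
      ofFn_update_eq (fun j => (proj 𝒱 (q j) (v j), q j + 1)) i
    have h := hl (0, q i + 1)
    have e0 : Function.update (fun j => (proj 𝒱 (q j) (v j), q j + 1)) i (0, q i + 1) =
        fun j => (proj 𝒱 (q j) (v j), q j + 1) := by
      rw [Function.update_eq_self_iff, proj_of_mem_ne 𝒱 (hv i) (Ne.symm hi)]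
    rw [e0] at h
    have hg := shifted_letters_proj (𝒱 := 𝒱) v q
    simp only [letters] at hg ⊢
    rw [h] at hg ⊢
    -- A summand with the wrong parities contains a zero letter, and additivity for 0 + 0 = 0 makes
    -- `F` vanish there.
    have := hF.add_middle hFa (l₁ := l₁) (l₂ := l₂) (p := q i + 1) (zero_mem _) (zero_mem _)
      (fun c hc => hg c (by
        simp only [List.mem_append, List.mem_cons] at hc ⊢; tauto))
    rw [add_zero, left_eq_add] at this
    rw [this, smul_zero]
  · simp

theorem multiAdditive_extend (e : ZMod 2) {F : List (V × ZMod 2) → X}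
    (hF : SwapSymm (Shifted 𝒱) F) (hFa : HeadAdditive F) (N : ℕ) :
    MultiAdditive (extend 𝒱 e F N) := by
  refine MultiAdditive.sum _ fun p _ v i x y => ?_
  obtain ⟨l₁, l₂, -, hl⟩ := ofFn_update_eq (fun j => (proj 𝒱 (p j) (v j), p j + 1)) i
  have key : ∀ z, letters (fun j => proj 𝒱 (p j) (Function.update v i z j)) p =
      l₁ ++ (proj 𝒱 (p i) z, p i + 1) :: l₂ := by
    intro z
    rw [← hl, letters]
    congr 1
    funext j
    rcases eq_or_ne j i with rfl | hj
    · simp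
    · simp [hj]
  have hg := shifted_letters_proj (𝒱 := 𝒱) (Function.update v i x) p
  rw [key] at hg
  rw [decalage_letters_congr e (fun j => proj 𝒱 (p j) (Function.update v i (x + y) j))
      (fun j => proj 𝒱 (p j) (Function.update v i x j)),
    decalage_letters_congr e (fun j => proj 𝒱 (p j) (Function.update v i y j))
      (fun j => proj 𝒱 (p j) (Function.update v i x j)), ← smul_add]
  congr 1
  rw [key, key, key, proj_add]
  have hm : ∀ z, proj 𝒱 (p i) z ∈ 𝒱 (p i + 1 + 1) := fun z => by
    rw [add_one_add_one]; exact proj_mem 𝒱 _ _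
  exact hF.add_middle hFa (hm x) (hm y) fun c hc => hg c (by
    simp only [List.mem_append, List.mem_cons] at hc ⊢; tauto)

theorem isCochain_extend {𝒦 : ZMod 2 → AddSubgroup K} [DirectSum.Decomposition 𝒦]
    (hV : IsSupermodule 𝒦 𝒱) {e : ZMod 2} {F : List (V × ZMod 2) → X}
    (hF : SwapSymm (Shifted 𝒱) F) (hFa : HeadAdditive F) (hFl : HeadLinear 𝒦 𝒱 e F) (m : ℕ) :
    IsCochain K 𝒱 (extend 𝒱 e F (m + 1)) :=
  isCochain_of_list hV hF hFl (multiAdditive_extend e hF hFa _) fun _ _ hv =>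
    extend_of_mem hF hFa hv

theorem listForm_extend {e : ZMod 2} {F : List (V × ZMod 2) → X} (hF : SwapSymm (Shifted 𝒱) F)
    (hFa : HeadAdditive F) {l : List (V × ZMod 2)} (hl : ∀ c ∈ l, Shifted 𝒱 c) :
    listForm e (extend 𝒱 e F) l = F l := by
  obtain ⟨v, p, h⟩ := exists_letters_eq l
  rw [h] at hl ⊢
  rw [listForm_letters, extend_of_mem hF hFa (mem_of_shifted_letters hl), ksign_smul_self]

/-- The sequence of maps indexed by the number of arguments. -/
def cochainSeq (φ : CochainFamily V) : ∀ N : ℕ, (Fin N → V) → V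
  | 0 => 0
  | d + 1 => φ d

/-- The sequence of scalar valued maps indexed by the number of arguments. -/
def formSeq (f : FormFamily V K) : ∀ N : ℕ, (Fin N → V) → K
  | 0 => 0
  | 1 => 0
  | d + 2 => f d

omit [Module K V] [Module Kᵐᵒᵖ V] in
-- Forms start with two arguments, whereas lists have any length, so agreement requires `F` to
-- vanish on lists of length at most one.
theorem formSeq_eq_extend {e : ZMod 2} {f : FormFamily V K} {F : List (V × ZMod 2) → K}
    (h0 : F [] = 0) (h1 : ∀ a, F [a] = 0) (hf : ∀ d, f d = extend 𝒱 e F (d + 2)) :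
    formSeq f = extend 𝒱 e F := by
  funext N v
  match N with
  | 0 => simp [formSeq, extend, letters, h0]
  | 1 => simp [formSeq, extend, letters, h1]
  | d + 2 => rw [formSeq, hf]

theorem cochainSeq_eq_extend {e : ZMod 2} {φ : CochainFamily V} {F : List (V × ZMod 2) → V}
    (h0 : F [] = 0) (hφ : ∀ d, φ d = extend 𝒱 e F (d + 1)) : cochainSeq φ = extend 𝒱 e F := by
  funext N v
  match N with
  | 0 => simp [cochainSeq, extend, letters, h0]
  | d + 1 => rw [cochainSeq, hφ]

end Extend

end LInfty

namespace LInfty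

/-! ### Unshuffle permutations as splittings of a list -/

section Bridge

variable {X : Type*} [AddCommGroup X]

/-- A splitting of a strictly increasing list is a choice of subset. The head is the least letter:
in R it precedes every chosen letter and contributes all its factors, while in T no letter precedes
it. -/
theorem unshuffleSum_eq_sum_powerset {N : ℕ} (w : Fin N → Fin N → ℤ) {l : List (Fin N)}
    (hl : l.Pairwise (· < ·)) (F : List (Fin N) → List (Fin N) → X) :
    unshuffleSum w l F = ∑ s ∈ l.toFinset.powerset,
      (∏ t ∈ s, ∏ u ∈ (l.toFinset \ s).filter (· < t), w t u) •
        F (l.filter (· ∈ s)) (l.filter (· ∉ s)) := by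
  induction l generalizing F with
  | nil => simp [unshuffleSum]
  | cons a l ih =>
    rw [List.pairwise_cons] at hl
    have ha : a ∉ l := fun h => lt_irrefl _ (hl.1 a h)
    have ha' : a ∉ l.toFinset := by simpa using ha
    rw [unshuffleSum, ih hl.2, ih hl.2, List.toFinset_cons, Finset.sum_powerset_insert ha', add_comm]
    congr 1
    · refine Finset.sum_congr rfl fun s hs => ?_
      rw [Finset.mem_powerset] at hs
      have has : a ∉ s := fun h => ha' (hs h)
      have e1 : (a :: l).filter (· ∈ s) = l.filter (· ∈ s) := by simp [has]
      have e2 : (a :: l).filter (· ∉ s) = a :: l.filter (· ∉ s) := by simp [has]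
      have e3 : (l.filter (· ∈ s)).toFinset = s := by
        ext x
        simp only [List.mem_toFinset, List.mem_filter, decide_eq_true_eq, and_iff_right_iff_imp]
        exact fun hx => by simpa using hs hx
      rw [e1, e2, smul_smul]
      congr 1
      rw [← List.prod_toFinset (fun t => w t a) ((hl.2.imp fun h => h.ne).filter _), e3,
        ← Finset.prod_mul_distrib]
      refine Finset.prod_congr rfl fun t ht => ?_
      have hat : a < t := hl.1 t (by simpa using hs ht)
      rw [Finset.insert_sdiff_of_notMem _ has, Finset.filter_insert, if_pos hat,
        Finset.prod_insert, mul_comm]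
      simp [ha']
    · refine Finset.sum_congr rfl fun s hs => ?_
      rw [Finset.mem_powerset] at hs
      have has : a ∉ s := fun h => ha' (hs h)
      have e1 : (a :: l).filter (· ∈ insert a s) = a :: l.filter (· ∈ s) := by
        rw [List.filter_cons_of_pos (by simp)]
        congr 1
        refine List.filter_congr fun x hx => ?_
        have : x ≠ a := fun h => ha (h ▸ hx)
        simp [this]
      have e2 : (a :: l).filter (· ∉ insert a s) = l.filter (· ∉ s) := by
        rw [List.filter_cons_of_neg (by simp)]
        refine List.filter_congr fun x hx => ?_
        have : x ≠ a := fun h => ha (h ▸ hx)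
        simp [this]
      rw [e1, e2]
      congr 1
      have e3 : insert a l.toFinset \ insert a s = l.toFinset \ s := by
        ext x
        simp only [Finset.mem_sdiff, Finset.mem_insert]
        constructor
        · rintro ⟨h1 | h1, h2⟩ <;> tauto
        · rintro ⟨h1, h2⟩
          have : x ≠ a := fun h => ha' (h ▸ h1)
          tauto
      rw [e3, Finset.prod_insert has]
      have e4 : (l.toFinset \ s).filter (· < a) = ∅ := by
        refine Finset.filter_eq_empty_iff.2 fun x hx => not_lt_of_gt (hl.1 x ?_)
        simpa using (Finset.mem_sdiff.1 hx).1
      rw [e4, Finset.prod_empty, one_mul]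

/-- The set of letters that an unshuffle moves to the first `k` positions. -/
def frontSet {N : ℕ} (k : ℕ) (σ : Equiv.Perm (Fin N)) : Finset (Fin N) :=
  Finset.univ.filter fun x => (σ.symm x).val < k

theorem apply_mem_frontSet {N : ℕ} (k : ℕ) (σ : Equiv.Perm (Fin N)) (i : Fin N) :
    σ i ∈ frontSet k σ ↔ i.val < k := by simp [frontSet]

theorem mem_unshuffles {N k : ℕ} {σ : Equiv.Perm (Fin N)} : σ ∈ unshuffles k N ↔
    ∀ i j : Fin N, i < j → (j.val < k ∨ k ≤ i.val) → σ i < σ j := by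
  simp [unshuffles]

/-- Both signs are products over inversions. An unshuffle is increasing on each block of positions,
so its inversions pair a front letter with a smaller letter outside the front set. -/
theorem sign_mul_koszul {N : ℕ} {k : ℕ} {σ : Equiv.Perm (Fin N)} (hσ : σ ∈ unshuffles k N)
    (p : Fin N → ZMod 2) :
    (Equiv.Perm.sign σ : ℤ) * koszul σ p = ∏ t ∈ frontSet k σ,
      ∏ u ∈ (Finset.univ \ frontSet k σ).filter (· < t), ksign (1 + p t * p u) := by
  have e1 : (Equiv.Perm.sign σ : ℤ) * koszul σ p = ∏ j, ∏ i,
      if i < j ∧ σ j < σ i then ksign (1 + p (σ i) * p (σ j)) else 1 := by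
    rw [Equiv.Perm.sign_eq_prod_prod_Iio, koszul_eq_prod]
    simp only [Units.coe_prod, ← Finset.prod_mul_distrib]
    refine Finset.prod_congr rfl fun j _ => ?_
    have : Finset.Iio j = Finset.univ.filter (· < j) := by ext; simp
    rw [this, Finset.prod_filter]
    refine Finset.prod_congr rfl fun i _ => ?_
    by_cases hij : i < j
    · have hne : σ i ≠ σ j := fun h => hij.ne (σ.injective h)
      have h1 : ksign 1 = -1 := by decide
      rcases hne.lt_or_gt with h | h
      · simp [hij, h, h.not_gt]
      · simp [hij, h, h.not_gt, ksign_add, h1]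
    · simp [hij]
  have e2 : ∀ t u, (if t ∈ frontSet k σ ∧ u ∉ frontSet k σ ∧ u < t then ksign (1 + p t * p u)
      else 1) = if t ∈ frontSet k σ then if u ∈ (Finset.univ \ frontSet k σ).filter (· < t) then
        ksign (1 + p t * p u) else 1 else 1 := by
    intro t u
    by_cases h1 : t ∈ frontSet k σ <;> simp [h1]
  have e3 : ∏ t ∈ frontSet k σ,
      ∏ u ∈ (Finset.univ \ frontSet k σ).filter (· < t), ksign (1 + p t * p u) =
      ∏ t, ∏ u, if t ∈ frontSet k σ ∧ u ∉ frontSet k σ ∧ u < t then ksign (1 + p t * p u)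
        else 1 := by
    simp only [e2]
    rw [← Finset.prod_subset (Finset.subset_univ (frontSet k σ))]
    · refine Finset.prod_congr rfl fun t ht => ?_
      rw [← Finset.prod_subset (Finset.subset_univ ((Finset.univ \ frontSet k σ).filter (· < t)))]
      · exact Finset.prod_congr rfl fun u hu => by rw [if_pos ht, if_pos hu]
      · intro u _ hu
        rw [if_pos ht, if_neg hu]
    · intro t _ ht
      simp [ht]
  rw [e1, e3, Finset.prod_comm]
  refine (Finset.prod_congr rfl fun i _ => ?_).trans (Equiv.prod_comp σ fun t => ∏ u,
    if t ∈ frontSet k σ ∧ u ∉ frontSet k σ ∧ u < t then ksign (1 + p t * p u) else 1)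
  refine (Finset.prod_congr rfl fun j _ => ?_).trans (Equiv.prod_comp σ fun u =>
    if σ i ∈ frontSet k σ ∧ u ∉ frontSet k σ ∧ u < σ i then ksign (1 + p (σ i) * p u) else 1)
  congr 1
  rw [apply_mem_frontSet, apply_mem_frontSet, eq_iff_iff]
  constructor
  · rintro ⟨h1, h2⟩
    have := (mem_unshuffles.1 hσ) i j h1
    refine ⟨?_, ?_, h2⟩
    · by_contra h
      exact absurd (this (Or.inr (not_lt.1 h))) h2.not_gt
    · intro h
      exact absurd (this (Or.inl h)) h2.not_gt
  · rintro ⟨h1, h2, h3⟩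
    exact ⟨Fin.lt_def.2 (by omega), h3⟩

/-- Each half of the word of an unshuffle is strictly increasing, and a sorted list is determined by
its set of entries. -/
theorem take_drop_ofFn {N : ℕ} {k : ℕ} {σ : Equiv.Perm (Fin N)} (hσ : σ ∈ unshuffles k N) :
    (List.ofFn σ).take k = (List.finRange N).filter (· ∈ frontSet k σ) ∧
      (List.ofFn σ).drop k = (List.finRange N).filter (· ∉ frontSet k σ) := by
  have hnd : (List.ofFn σ).Nodup := List.nodup_ofFn.2 σ.injective
  have hfr := List.pairwise_lt_finRange N
  have hfn := List.nodup_finRange N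
  have huns := mem_unshuffles.1 hσ
  constructor
  · refine List.Perm.eq_of_pairwise (le := (· < ·)) (fun a b _ _ h1 h2 => absurd h1 h2.not_gt) ?_
      (hfr.filter _) ?_
    · rw [List.pairwise_iff_getElem]
      intro i j hi hj hij
      simp only [List.length_take, List.length_ofFn] at hi hj
      simp only [List.getElem_take, List.getElem_ofFn]
      exact huns _ _ (Fin.lt_def.2 hij) (Or.inl (by simp; omega))
    · rw [List.perm_ext_iff_of_nodup (hnd.sublist (List.take_sublist _ _)) (hfn.filter _)]
      intro x
      simp only [List.mem_take_iff_getElem, List.mem_filter, List.mem_finRange, true_and,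
        decide_eq_true_eq, List.length_ofFn, List.getElem_ofFn]
      constructor
      · rintro ⟨j, hj, rfl⟩
        rw [apply_mem_frontSet]
        simp; omega
      · intro hx
        simp only [frontSet, Finset.mem_filter, Finset.mem_univ, true_and] at hx
        exact ⟨σ.symm x, by have := (σ.symm x).isLt; omega, by simp⟩
  · refine List.Perm.eq_of_pairwise (le := (· < ·)) (fun a b _ _ h1 h2 => absurd h1 h2.not_gt) ?_
      (hfr.filter _) ?_
    · rw [List.pairwise_iff_getElem]
      intro i j hi hj hij
      simp only [List.length_drop, List.length_ofFn] at hi hj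
      simp only [List.getElem_drop, List.getElem_ofFn]
      exact huns _ _ (Fin.lt_def.2 (by simp; omega)) (Or.inr (by simp))
    · rw [List.perm_ext_iff_of_nodup (hnd.sublist (List.drop_sublist _ _)) (hfn.filter _)]
      intro x
      simp only [List.mem_drop_iff_getElem, List.mem_filter, List.mem_finRange, true_and,
        decide_eq_true_eq, List.length_ofFn, List.getElem_ofFn]
      constructor
      · rintro ⟨j, hj, rfl⟩
        rw [apply_mem_frontSet]
        simp
      · intro hx
        simp only [frontSet, Finset.mem_filter, Finset.mem_univ, true_and, not_lt] at hx
        refine ⟨σ.symm x - k, by have := (σ.symm x).isLt; omega, ?_⟩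
        have : (⟨k + ((σ.symm x : ℕ) - k), by have := (σ.symm x).isLt; omega⟩ : Fin N) =
            σ.symm x := Fin.ext (by simp; omega)
        rw [this, Equiv.apply_symm_apply]

theorem card_frontSet {k m : ℕ} (σ : Equiv.Perm (Fin (k + m))) : (frontSet k σ).card = k := by
  have : frontSet k σ = (Finset.univ.filter fun i : Fin (k + m) => i.val < k).map σ.toEmbedding := by
    ext x
    simp [frontSet]
  rw [this, Finset.card_map, Fin.card_filter_val_lt]
  omega

/-- Unshuffles correspond to the `k`-element subsets of the letters through `frontSet`. -/
theorem sum_unshuffles_eq {k m : ℕ} (p : Fin (k + m) → ZMod 2)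
    (G : List (Fin (k + m)) → List (Fin (k + m)) → X) :
    ∑ σ ∈ unshuffles k (k + m), ((Equiv.Perm.sign σ : ℤ) * koszul σ p) •
        G ((List.ofFn σ).take k) ((List.ofFn σ).drop k) =
      unshuffleSum (fun a b => ksign (1 + p a * p b)) (List.finRange (k + m))
        fun T R => if T.length = k then G T R else 0 := by
  rw [unshuffleSum_eq_sum_powerset _ (List.pairwise_lt_finRange _)]
  have hlen : ∀ s : Finset (Fin (k + m)), ((List.finRange (k + m)).filter (· ∈ s)).length =
      s.card := by
    intro s
    rw [← List.toFinset_card_of_nodup ((List.nodup_finRange _).filter _)]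
    congr 1
    ext x
    simp
  have huniv : (List.finRange (k + m)).toFinset = Finset.univ := by ext; simp
  simp only [huniv, hlen, smul_ite, smul_zero]
  rw [← Finset.sum_filter]
  refine Finset.sum_bij (fun σ _ => frontSet k σ) ?_ ?_ ?_ ?_
  · intro σ _
    simp [card_frontSet]
  · intro σ hσ τ hτ h
    have e : List.ofFn σ = List.ofFn τ := by
      rw [← List.take_append_drop k (List.ofFn σ), ← List.take_append_drop k (List.ofFn τ),
        (take_drop_ofFn hσ).1, (take_drop_ofFn hσ).2, (take_drop_ofFn hτ).1, (take_drop_ofFn hτ).2]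
      simp only [h]
    exact Equiv.coe_fn_injective (List.ofFn_injective e)
  · intro s hs
    have hs' : s.card = k := (Finset.mem_filter.1 hs).2
    have hsc : sᶜ.card = m := by rw [Finset.card_compl, hs', Fintype.card_fin]; omega
    -- The inverse of σ ↦ `frontSet k σ`: list `s` in increasing order, then its complement in
    -- increasing order.
    let σ : Equiv.Perm (Fin (k + m)) := finSumFinEquiv.symm.trans (finSumEquivOfFinset hs' hsc)
    have hl : ∀ i : Fin k, σ (Fin.castAdd m i) = s.orderEmbOfFin hs' i := fun i => by simp [σ]
    have hr : ∀ i : Fin m, σ (Fin.natAdd k i) = sᶜ.orderEmbOfFin hsc i := fun i => by simp [σ]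
    refine ⟨σ, mem_unshuffles.2 fun i j hij h => ?_, ?_⟩
    · induction i using Fin.addCases with
      | left i =>
        induction j using Fin.addCases with
        | left j =>
          rw [hl, hl]
          exact (s.orderEmbOfFin hs').strictMono (Fin.lt_def.2 (Fin.lt_def.1 hij))
        | right j =>
          exfalso
          have := i.isLt
          simp at h
          omega
      | right i =>
        induction j using Fin.addCases with
        | left j =>
          exfalso
          have := j.isLt
          simp [Fin.lt_def] at hij
          omega
        | right j =>
          rw [hr, hr]
          exact (sᶜ.orderEmbOfFin hsc).strictMono
            (Fin.lt_def.2 (Nat.lt_of_add_lt_add_left (Fin.lt_def.1 hij)))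
    · refine (Finset.eq_of_subset_of_card_le (fun x hx => ?_) ?_)
      · obtain ⟨i, rfl⟩ := σ.surjective x
        rw [apply_mem_frontSet] at hx
        have : i = Fin.castAdd m ⟨i, hx⟩ := rfl
        rw [this, hl]
        exact Finset.orderEmbOfFin_mem _ _ _
      · rw [card_frontSet, hs']
  · intro σ hσ
    rw [sign_mul_koszul hσ, (take_drop_ofFn hσ).1, (take_drop_ofFn hσ).2]

end Bridge

end LInfty

namespace LInfty

/-! ### The unshuffle formula in terms of list insertion -/

section InsertAt

variable {V X : Type*} [AddCommGroup V] [AddCommGroup X]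

/-- One summand of `insertAt` in terms of the lists of inserted and of remaining arguments. -/
def insertTerm {m b : ℕ} (f : (Fin (m + 1) → V) → X) (g : (Fin (b + 1) → V) → V)
    (T R : List (V × ZMod 2)) : X :=
  f (Fin.cons (g fun i => (T.map Prod.fst).getD i 0) fun j : Fin m => (R.map Prod.fst).getD j 0)

theorem argAt_eq_getD {N : ℕ} (v : Fin N → V) (i : ℕ) : argAt v i = (List.ofFn v).getD i 0 := by
  unfold argAt
  split_ifs with h
  · rw [List.getD_eq_getElem _ _ (by simpa using h), List.getElem_ofFn]
  · rw [List.getD_eq_default _ _ (by simpa using h)]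

theorem insertAt_eq_unshuffleSum {m b N : ℕ} (hN : b + 1 + m = N) (f : (Fin (m + 1) → V) → X)
    (g : (Fin (b + 1) → V) → V) (p : Fin N → ZMod 2) (v : Fin N → V) :
    insertAt f g p v = unshuffleSum (fun a b => ksign (1 + (a.2 + 1) * (b.2 + 1))) (letters v p)
      fun T R => if T.length = b + 1 then insertTerm f g T R else 0 := by
  subst hN
  have h1 : letters v p = (List.finRange _).map fun i => (v i, p i + 1) := List.ofFn_eq_map
  rw [h1, unshuffleSum_map]
  simp only [add_one_add_one, List.length_map]
  rw [← sum_unshuffles_eq p fun T R => insertTerm f g (T.map fun i => (v i, p i + 1))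
    (R.map fun i => (v i, p i + 1)), insertAt]
  refine Finset.sum_congr rfl fun σ _ => ?_
  congr 1
  simp only [insertTerm, argAt_eq_getD, Function.comp_def, List.map_take,
    List.map_drop, List.map_ofFn]
  congr 2
  · congr 1
    funext i
    simp only [List.getD_eq_getElem?_getD]
    rw [List.getElem?_take_of_lt i.isLt]
  · funext j
    simp only [List.getD_eq_getElem?_getD]
    rw [List.getElem?_drop]

omit [AddCommGroup V] in
theorem decalage_eq_add (e : ZMod 2) (l : List (V × ZMod 2)) :
    decalage e l = decalage 0 l + e * (label l + (l.length : ZMod 2)) := by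
  induction l with
  | nil => simp [decalage]
  | cons a l ih =>
    simp only [decalage, label_cons, List.length_cons]
    rw [ih]
    push_cast
    ring

omit [AddCommGroup V] in
-- Rearranging a list into T followed by R turns the antisymmetric sign into the Koszul sign, up to
-- the ratio of the décalage signs before and after. The exponent inside the sum is that of T ++ R:
-- each letter of T is followed by all of R, and label T + |T| is the sum of the parities in T.
theorem unshuffleSum_eq_koszulSum (e : ZMod 2) (l : List (V × ZMod 2))
    (F : List (V × ZMod 2) → List (V × ZMod 2) → X) :
    unshuffleSum (fun a b => ksign (1 + (a.2 + 1) * (b.2 + 1))) l F =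
      ksign (decalage e l) • koszulSum l fun T R => ksign (decalage e T + decalage e R +
        (label T + (T.length : ZMod 2)) * (R.length : ZMod 2)) • F T R := by
  have hprod : ∀ (T : List (V × ZMod 2)) (a : V × ZMod 2),
      (T.map fun t => ksign (1 + (t.2 + 1) * (a.2 + 1))).prod =
        ksign ((T.length : ZMod 2) + (label T + (T.length : ZMod 2)) * (a.2 + 1)) := by
    intro T a
    induction T with
    | nil => simp [ksign_zero]
    | cons t T ih =>
      rw [List.map_cons, List.prod_cons, ih, ← ksign_add]
      congr 1
      simp only [List.length_cons, label_cons]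
      push_cast
      ring
  induction l generalizing F with
  | nil => simp [unshuffleSum, koszulSum_nil, decalage, ksign_zero]
  | cons a l ih =>
    rw [koszulSum_cons, unshuffleSum, ih, ih, smul_add]
    simp only [koszulSum, ← unshuffleSum_smul]
    congr 1
    · refine unshuffleSum_congr _ _ fun T R hp => ?_
      have hlen : (l.length : ZMod 2) = T.length + R.length := by
        rw [← hp.length_eq, List.length_append]; push_cast; rfl
      simp only [ksign_smul_ksign_smul, decalage, label_cons, List.length_cons, hlen]
      refine ksign_smul_congr ?_ _
      push_cast
      generalize decalage e l = x, decalage e T = y, decalage e R = z, label T = t, a.2 = c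
      generalize (T.length : ZMod 2) = n, (R.length : ZMod 2) = k
      have key : ∀ c n k t e : ZMod 2, (t + n) * k =
          (c + 1) * (n + k + e) + (c + 1) * (n + e) + (c + t + (n + 1)) * k := by
        clear * -; decide
      linear_combination key c n k t e
    · refine unshuffleSum_congr _ _ fun T R hp => ?_
      have hlen : (l.length : ZMod 2) = T.length + R.length := by
        rw [← hp.length_eq, List.length_append]; push_cast; rfl
      rw [hprod]
      simp only [ksign_smul_ksign_smul, decalage, List.length_cons, hlen]
      refine ksign_smul_congr ?_ _
      push_cast
      generalize decalage e l = x, decalage e T = y, decalage e R = z, label T = t, a.2 = c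
      generalize (T.length : ZMod 2) = n, (R.length : ZMod 2) = k
      have key : ∀ c n k t e : ZMod 2, (t + n) * k + (n + (t + n) * (c + 1)) =
          (c + 1) * (n + k + e) + t * c + (c + 1) * (k + e) + (t + n) * (k + 1) := by
        clear * -; decide
      linear_combination key c n k t e

/-- The inserted letter has parity (γ + b) plus the parities of its arguments, where b = `mb.2`. In
its décalage exponent the second part is absorbed by the arguments, and the first leaves (γ + b)(m +
e), with m = `mb.1`: this is the origin of the sign in the modified bracket. -/
theorem sum_insertAt (e γ : ZMod 2) {F : ∀ N : ℕ, (Fin N → V) → X} {G : ∀ N : ℕ, (Fin N → V) → V}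
    (hF : HeadAdditive (listForm e F)) (hG : G 0 = 0) {n : ℕ} (v : Fin (n + 1) → V)
    (p : Fin (n + 1) → ZMod 2) :
    ∑ mb ∈ Finset.HasAntidiagonal.antidiagonal n, ksign ((γ + mb.2) * (mb.1 + e)) •
        insertAt (F (mb.1 + 1)) (G (mb.2 + 1)) p v =
      ksign (decalage e (letters v p)) •
        listComp γ (listForm e F) (listForm 0 G) (letters v p) := by
  have h1 : ∀ mb ∈ Finset.HasAntidiagonal.antidiagonal n, ksign ((γ + mb.2) * (mb.1 + e)) •
      insertAt (F (mb.1 + 1)) (G (mb.2 + 1)) p v = ksign (decalage e (letters v p)) •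
        koszulSum (letters v p) fun T R => ksign ((γ + mb.2) * (mb.1 + e) + (decalage e T +
          decalage e R + (label T + (T.length : ZMod 2)) * (R.length : ZMod 2))) •
          if T.length = mb.2 + 1 then insertTerm (F (mb.1 + 1)) (G (mb.2 + 1)) T R else 0 := by
    intro mb hmb
    rw [Finset.HasAntidiagonal.mem_antidiagonal] at hmb
    rw [insertAt_eq_unshuffleSum (by omega), unshuffleSum_eq_koszulSum e, smul_comm]
    simp only [koszulSum, ← unshuffleSum_smul, ksign_smul_ksign_smul]
  rw [Finset.sum_congr rfl h1, ← Finset.smul_sum]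
  simp only [koszulSum]
  rw [← unshuffleSum_sum, listComp]
  congr 1
  refine unshuffleSum_congr _ _ fun T R hp => ?_
  have hlen := hp.length_eq
  simp only [List.length_append, letters, List.length_ofFn] at hlen
  cases T with
  | nil =>
    -- An empty T has no counterpart among the cochains; its term vanishes since `G` is zero without
    -- arguments.
    have e1 : listForm 0 G [] = 0 := by
      rw [listForm]
      have : G ([] : List (V × ZMod 2)).length = 0 := hG
      rw [this, Pi.zero_apply, smul_zero]
    rw [e1, hF.zero]
    exact Finset.sum_eq_zero fun mb _ => by simp
  | cons a T =>
    rw [List.length_cons] at hlen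
    -- The sizes of the two pieces select a single pair of arities.
    rw [Finset.sum_eq_single (R.length, T.length)]
    · simp only [List.length_cons, if_true]
      have e2 : insertTerm (F (R.length + 1)) (G (T.length + 1)) (a :: T) R =
          F (R.length + 1) (Fin.cons (G (T.length + 1) fun i => ((a :: T).get i).1)
            fun i => (R.get i).1) := by
        rw [insertTerm]
        congr 2
        · congr 1
          funext i
          rw [List.getD_eq_getElem _ _ (by simp; omega), List.getElem_map]
          rfl
        · funext i
          rw [List.getD_eq_getElem _ _ (by simp), List.getElem_map]
          rfl
      have e3 : ∀ x q, listForm e F ((x, q) :: R) = ksign (decalage e ((x, q) :: R)) •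
          F (R.length + 1) (Fin.cons x fun i => (R.get i).1) := by
        intro x q
        rw [listForm]
        congr 2
        funext i
        refine Fin.cases ?_ (fun i => ?_) i <;> rfl
      rw [e2, show listForm 0 G (a :: T) = ksign (decalage 0 (a :: T)) •
        G (T.length + 1) fun i => ((a :: T).get i).1 from rfl, hF.zsmul, e3, ksign_smul_ksign_smul]
      refine ksign_smul_congr ?_ _
      rw [decalage_eq_add e (a :: T)]
      simp only [decalage, label_cons, List.length_cons]
      push_cast
      generalize decalage 0 T = x, decalage e R = y, label T = z, a.2 = c
      generalize (T.length : ZMod 2) = s, (R.length : ZMod 2) = t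
      have key : ∀ γ s t e c z : ZMod 2, (γ + s) * (t + e) + e * (c + z + (s + 1)) +
          (c + z + (s + 1)) * t = (γ + (c + z) + 1) * (t + e) := by
        clear * -; decide
      linear_combination key γ s t e c z
    · intro mb hmb hne
      rw [if_neg, smul_zero]
      intro h
      rw [Finset.HasAntidiagonal.mem_antidiagonal] at hmb
      rw [List.length_cons] at h
      exact hne (Prod.ext (by simp; omega) (by simp; omega))
    · intro h
      exact absurd (Finset.HasAntidiagonal.mem_antidiagonal.2 (by change R.length + T.length = n; omega)) h

end InsertAt

end LInfty

namespace LInfty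

/-! ### Homogeneous components of functions of lists -/

section HomPart

variable {K V X : Type*} [Ring K] [AddCommGroup V] [Module K V] [Module Kᵐᵒᵖ V]
  [AddCommGroup X] [Module Kᵐᵒᵖ X]

/-- The component of degree `γ` of a function of lists. -/
def homPart (𝒳 : ZMod 2 → AddSubgroup X) [DirectSum.Decomposition 𝒳] (u γ : ZMod 2)
    (f : List (V × ZMod 2) → X) (l : List (V × ZMod 2)) : X :=
  proj 𝒳 (γ + label l + u) (f l)

variable {𝒱 : ZMod 2 → AddSubgroup V} {𝒳 : ZMod 2 → AddSubgroup X} [DirectSum.Decomposition 𝒳]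
  {u γ : ZMod 2} {f : List (V × ZMod 2) → X}

theorem hasDegree_homPart : HasDegree 𝒱 𝒳 u γ (homPart 𝒳 u γ f) := fun _ _ => proj_mem 𝒳 _ _

theorem SwapSymm.homPart (hf : SwapSymm (Shifted 𝒱) f) :
    SwapSymm (Shifted 𝒱) (homPart 𝒳 u γ f) := by
  intro l₁ l₂ a b hl
  have e : label (l₁ ++ a :: b :: l₂) = label (l₁ ++ b :: a :: l₂) := by
    simp only [label_append, label_cons]; ring
  rw [LInfty.homPart, hf _ _ _ _ hl, proj_zsmul, e, LInfty.homPart]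

theorem HeadAdditive.homPart (hf : HeadAdditive f) : HeadAdditive (homPart 𝒳 u γ f) := by
  intro x y p l
  simp only [LInfty.homPart, hf x y p l, proj_add, label_cons]

theorem proj_op_smul {𝒦 : ZMod 2 → AddSubgroup K}
    (hX : ∀ (s p : ZMod 2) (t : K) (x : X), t ∈ 𝒦 s → x ∈ 𝒳 p → MulOpposite.op t • x ∈ 𝒳 (p + s))
    {s : ZMod 2} {t : K} (ht : t ∈ 𝒦 s) (p : ZMod 2) (x : X) :
    proj 𝒳 (p + s) (MulOpposite.op t • x) = MulOpposite.op t • proj 𝒳 p x := by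
  have h : ∀ q, proj 𝒳 (p + s) (MulOpposite.op t • proj 𝒳 q x) =
      if q = p then MulOpposite.op t • proj 𝒳 q x else 0 := by
    intro q
    split_ifs with h
    · rw [h]
      exact proj_of_mem 𝒳 (hX _ _ _ _ ht (proj_mem 𝒳 _ _))
    · exact proj_of_mem_ne 𝒳 (hX _ _ _ _ ht (proj_mem 𝒳 _ _)) fun h' => h (add_right_cancel h')
  conv_lhs => rw [← sum_proj 𝒳 x, Finset.smul_sum, ← projHom_apply, map_sum]
  simp only [projHom_apply, h, Finset.sum_ite_eq', Finset.mem_univ, if_true]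

omit [Module K V] in
theorem HeadLinear.homPart {𝒦 : ZMod 2 → AddSubgroup K} {e : ZMod 2}
    (hX : ∀ (s p : ZMod 2) (t : K) (x : X), t ∈ 𝒦 s → x ∈ 𝒳 p → MulOpposite.op t • x ∈ 𝒳 (p + s))
    (hf : HeadLinear 𝒦 𝒱 e f) : HeadLinear 𝒦 𝒱 e (homPart 𝒳 u γ f) := by
  intro s t ht a l ha hl
  rw [LInfty.homPart, hf s t ht a l ha hl, proj_zsmul, LInfty.homPart, ← proj_op_smul hX ht]
  simp only [label_cons]
  congr 2
  ring

omit [AddCommGroup V] in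
theorem sum_homPart (l : List (V × ZMod 2)) : ∑ γ, homPart 𝒳 u γ f l = f l := by
  conv_rhs => rw [← sum_proj 𝒳 (f l)]
  refine Fintype.sum_equiv (Equiv.addRight (label l + u)) _ _ fun γ => ?_
  rw [homPart, Equiv.coe_addRight, add_assoc]

theorem homPart_of_hasDegree (hf : HasDegree 𝒱 𝒳 u γ f) {l : List (V × ZMod 2)}
    (hl : ∀ c ∈ l, Shifted 𝒱 c) : homPart 𝒳 u γ f l = f l :=
  proj_of_mem 𝒳 (hf l hl)

theorem homPart_of_hasDegree_ne (hf : HasDegree 𝒱 𝒳 u γ f) {γ' : ZMod 2} (h : γ' ≠ γ)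
    {l : List (V × ZMod 2)} (hl : ∀ c ∈ l, Shifted 𝒱 c) : homPart 𝒳 u γ' f l = 0 :=
  proj_of_mem_ne 𝒳 (hf l hl) fun h' => h (by
    rw [add_assoc, add_assoc] at h'; exact (add_right_cancel h').symm)

end HomPart

section ParityPart

variable {V : Type*} [AddCommGroup V] {𝒱 : ZMod 2 → AddSubgroup V} [DirectSum.Decomposition 𝒱]
  {N : ℕ}

theorem parityPart_of_mem {f : (Fin N → V) → V} (hf : MultiAdditive f) (q : ZMod 2)
    {v : Fin N → V} {p : Fin N → ZMod 2} (hv : ∀ i, v i ∈ 𝒱 (p i)) :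
    parityPart 𝒱 q f v = proj 𝒱 (q + ∑ i, p i) (f v) := by
  rw [parityPart, Finset.sum_eq_single p]
  · simp only [proj_of_mem 𝒱 (hv _)]
  · intro p' _ hp'
    obtain ⟨i, hi⟩ := Function.ne_iff.1 hp'
    rw [hf.eq_zero (i := i) (proj_of_mem_ne 𝒱 (hv i) (Ne.symm hi)), proj_zero]
  · simp

theorem multiAdditive_parityPart {f : (Fin N → V) → V} (hf : MultiAdditive f) (q : ZMod 2) :
    MultiAdditive (parityPart 𝒱 q f) :=
  MultiAdditive.sum _ fun p _ =>
    (hf.comp_hom fun i => projHom 𝒱 (p i)).map (projHom 𝒱 (q + ∑ i, p i))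

theorem parityPart_of_hasParity {f : (Fin N → V) → V} (hf : MultiAdditive f) {q : ZMod 2}
    (hq : HasParity 𝒱 𝒱 q f) : parityPart 𝒱 q f = f :=
  MultiAdditive.ext 𝒱 (multiAdditive_parityPart hf q) hf fun v p hv => by
    rw [parityPart_of_mem hf q hv, proj_of_mem 𝒱 (hq v p hv)]

theorem parityPart_of_hasParity_ne {f : (Fin N → V) → V} (hf : MultiAdditive f) {q q' : ZMod 2}
    (hq : HasParity 𝒱 𝒱 q f) (h : q ≠ q') : parityPart 𝒱 q' f = 0 :=
  MultiAdditive.ext 𝒱 (multiAdditive_parityPart hf q') (fun _ _ _ _ => (add_zero 0).symm)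
    fun v p hv => by
      rw [parityPart_of_mem hf q' hv, proj_of_mem_ne 𝒱 (hq v p hv) fun h' => h (add_right_cancel h')]
      rfl

omit [AddCommGroup V] in
theorem label_letters (v : Fin N → V) (p : Fin N → ZMod 2) :
    label (letters v p) = ∑ i, p i + N := by
  simp [label, letters, List.map_ofFn, List.sum_ofFn, Finset.sum_add_distrib]

theorem multiAdditive_cochainSeq {φ : CochainFamily V} (hφ : ∀ d, MultiAdditive (φ d)) (m : ℕ) :
    MultiAdditive (cochainSeq φ (m + 1)) := hφ m

/-- Degree γ on lists is the total parity: in exterior degree d it selects parity γ + d. -/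
theorem listForm_parityPart {φ : CochainFamily V} (hφ : ∀ d, MultiAdditive (φ d)) (γ : ZMod 2)
    {l : List (V × ZMod 2)} (hl : ∀ c ∈ l, Shifted 𝒱 c) :
    listForm 0 (cochainSeq fun d => parityPart 𝒱 (γ + d) (φ d)) l =
      homPart 𝒱 1 γ (listForm 0 (cochainSeq φ)) l := by
  obtain ⟨v, p, h⟩ := exists_letters_eq l
  generalize l.length = N at v p h
  subst h
  rw [homPart, listForm_letters, listForm_letters, proj_zsmul, label_letters]
  congr 1
  cases N with
  | zero => exact (proj_zero 𝒱 _).symm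
  | succ d =>
    rw [cochainSeq, cochainSeq, parityPart_of_mem (hφ d) _ (mem_of_shifted_letters hl)]
    congr 1
    push_cast
    generalize ∑ i, p i = x
    generalize (d : ZMod 2) = y
    clear * -
    decide +revert

end ParityPart

/-! ### Cyclicity as symmetry under rotation -/

section InnerProduct

variable {K V : Type*} [Ring K] [AddCommGroup V] [Module K V] [Module Kᵐᵒᵖ V]
  {𝒦 : ZMod 2 → AddSubgroup K} [GradedRing 𝒦] {𝒱 : ZMod 2 → AddSubgroup V}
  [DirectSum.Decomposition 𝒱] {ip : V →+ V →+ K}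

theorem op_smul_mem_of_gradedRing (s p : ZMod 2) (t x : K) (ht : t ∈ 𝒦 s) (hx : x ∈ 𝒦 p) :
    MulOpposite.op t • x ∈ 𝒦 (p + s) := by
  rw [op_smul_eq_mul]
  exact SetLike.mul_mem_graded hx ht

omit [GradedRing 𝒦] [DirectSum.Decomposition 𝒱] in
theorem IsInnerProduct.ext (hip : IsInnerProduct 𝒦 𝒱 ip) {x y : V} (h : ∀ w, ip x w = ip y w) :
    x = y := by
  let g : V →ₗ[Kᵐᵒᵖ] K :=
    { toFun := ip y
      map_add' := map_add _
      map_smul' := fun t w => by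
        have := hip.map_op_smul y w t.unop
        simpa [MulOpposite.smul_eq_mul_unop] using this }
  exact (hip.nondegenerate g).unique h fun _ => rfl

omit [GradedRing 𝒦] in
theorem IsInnerProduct.ext_homogeneous (hip : IsInnerProduct 𝒦 𝒱 ip) {x y : V}
    (h : ∀ (q : ZMod 2) (w : V), w ∈ 𝒱 q → ip x w = ip y w) : x = y := by
  refine hip.ext fun w => ?_
  rw [← sum_proj 𝒱 w, map_sum, map_sum]
  exact Finset.sum_congr rfl fun q _ => h q _ (proj_mem 𝒱 _ _)

theorem IsInnerProduct.proj_left (hip : IsInnerProduct 𝒦 𝒱 ip) (p : ZMod 2) {q : ZMod 2} (x : V)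
    {w : V} (hw : w ∈ 𝒱 q) : proj 𝒦 (p + q) (ip x w) = ip (proj 𝒱 p x) w := by
  have h : ∀ r, proj 𝒦 (p + q) (ip (proj 𝒱 r x) w) = if r = p then ip (proj 𝒱 r x) w else 0 := by
    intro r
    have hm := hip.even _ _ _ _ (proj_mem 𝒱 r x) hw
    split_ifs with h
    · rw [← h]
      exact proj_of_mem 𝒦 hm
    · exact proj_of_mem_ne 𝒦 hm fun h' => h (add_right_cancel h')
  conv_lhs => rw [← sum_proj 𝒱 x, map_sum, AddMonoidHom.finsetSum_apply, ← projHom_apply, map_sum]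
  simp only [projHom_apply, h, Finset.sum_ite_eq', Finset.mem_univ, if_true]

/-- The inner product is even, so projecting the values amounts to projecting `x`; non-degeneracy
then identifies `x` with its own component. -/
theorem IsInnerProduct.mem_of_forall (hip : IsInnerProduct 𝒦 𝒱 ip) {p : ZMod 2} {x : V}
    (h : ∀ (q : ZMod 2) (w : V), w ∈ 𝒱 q → ip x w ∈ 𝒦 (p + q)) : x ∈ 𝒱 p := by
  have : x = proj 𝒱 p x := hip.ext_homogeneous fun q w hw => by
    rw [← hip.proj_left p x hw, proj_of_mem 𝒦 (h q w hw)]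
  rw [this]
  exact proj_mem 𝒱 _ _

omit [GradedRing 𝒦] [DirectSum.Decomposition 𝒱] in
theorem IsInnerProduct.op_smul_left (hV : IsSupermodule 𝒦 𝒱) (hip : IsInnerProduct 𝒦 𝒱 ip)
    {s q : ZMod 2} {t : K} (ht : t ∈ 𝒦 s) (x : V) {w : V} (hw : w ∈ 𝒱 q) :
    ip (MulOpposite.op t • x) w = ksign (s * q) • MulOpposite.op t • ip x w := by
  have e : t • w = ksign (s * q) • MulOpposite.op t • w := by
    rw [hV.op_smul s q t w ht hw, ksign_smul_self]
  rw [hip.balanced, e, map_zsmul, hip.map_op_smul, op_smul_eq_mul]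

omit [Module K V] [Module Kᵐᵒᵖ V] in
theorem listForm_tilde (φ : CochainFamily V) (l : List (V × ZMod 2)) (w : V × ZMod 2) :
    listForm 1 (formSeq (tilde ip φ)) (l ++ [w]) =
      ksign (w.2 + 1) • ip (listForm 0 (cochainSeq φ) l) w.1 := by
  rw [listForm_append_singleton]
  cases l with
  | nil =>
    have : listForm 0 (cochainSeq φ) [] = 0 := smul_zero _
    rw [this, map_zero, AddMonoidHom.zero_apply, smul_zero]
    exact smul_zero _
  | cons a l =>
    -- For a letter of `l`, the extra letter `w` and the shift `e = 1` cancel mod 2, so only the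
    -- parity of `w` remains. This is why forms use `e = 1` and cochains `e = 0`.
    have e : decalage 1 (a :: l ++ [w]) = w.2 + 1 + decalage 0 (a :: l) := by
      rw [decalage_append, show (([w].length : ℕ) : ZMod 2) + 1 = 0 by
        rw [List.length_singleton]; decide]
      simp only [decalage, List.length_nil]
      push_cast
      ring
    rw [e, listForm, map_zsmul, AddMonoidHom.zsmul_apply, ksign_smul_ksign_smul]
    congr 1
    change tilde ip φ l.length _ = _
    rw [tilde]
    simp only [Fin.snoc_castSucc]
    exact congrArg _ (Fin.snoc_last (α := fun _ => V) _ _)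

theorem homPart_append_singleton (hip : IsInnerProduct 𝒦 𝒱 ip) (γ : ZMod 2)
    {f : List (V × ZMod 2) → K} {φ : List (V × ZMod 2) → V} {l : List (V × ZMod 2)}
    {w : V × ZMod 2} (hw : Shifted 𝒱 w) (h : f (l ++ [w]) = ksign (w.2 + 1) • ip (φ l) w.1) :
    homPart 𝒦 0 γ f (l ++ [w]) = ksign (w.2 + 1) • ip (homPart 𝒱 1 γ φ l) w.1 := by
  rw [homPart, h, proj_zsmul, homPart, ← hip.proj_left _ _ hw]
  congr 2
  simp only [label_append, label_cons, label_nil]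
  generalize label l = x, w.2 = y
  clear * -
  decide +revert

omit [Module K V] [Module Kᵐᵒᵖ V] in
theorem multiAdditive_tilde {φ : CochainFamily V} (hφ : ∀ d, MultiAdditive (φ d)) (d : ℕ) :
    MultiAdditive (tilde ip φ d) := by
  intro v i x y
  refine Fin.lastCases ?_ (fun i => ?_) i
  · have h : ∀ z, (fun j : Fin (d + 1) => Function.update v (Fin.last (d + 1)) z j.castSucc) =
        fun j => v j.castSucc := fun z => funext fun j => by
      rw [Function.update_of_ne (Fin.castSucc_lt_last j).ne]
    simp only [tilde, h, Function.update_self, map_add]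
  · have h : ∀ z, (fun j : Fin (d + 1) => Function.update v i.castSucc z j.castSucc) =
        Function.update (fun j => v j.castSucc) i z := fun z => funext fun j => by
      rcases eq_or_ne j i with rfl | hj
      · simp
      · simp [hj]
    have h' : ∀ z, Function.update v i.castSucc z (Fin.last (d + 1)) = v (Fin.last (d + 1)) :=
      fun z => Function.update_of_ne (Fin.castSucc_lt_last i).ne' _ _
    simp only [tilde, h, h', hφ d _ i x y, map_add, AddMonoidHom.add_apply]

/-- Writing the right side with `f` in the first slot adds the sign p₀(q + ∑ p), which cancels the
dependence on the parity q. The conditions on all components then combine into one on `f`. -/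
theorem isCyclic_iff (hip : IsInnerProduct 𝒦 𝒱 ip) {d : ℕ} {f : (Fin (d + 1) → V) → V}
    (hf : MultiAdditive f) : IsCyclic 𝒱 ip f ↔
      ∀ (v : Fin (d + 2) → V) (p : Fin (d + 2) → ZMod 2), (∀ i, v i ∈ 𝒱 (p i)) →
        ip (f fun i => v i.castSucc) (v (Fin.last (d + 1))) =
          ksign ((d : ZMod 2) + 1 + p 0 * ∑ i : Fin (d + 1), p i.succ) •
            ip (f fun i => v i.succ) (v 0) := by
  have key : ∀ (q : ZMod 2) (v : Fin (d + 2) → V) (p : Fin (d + 2) → ZMod 2),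
      (∀ i, v i ∈ 𝒱 (p i)) →
      (ip (parityPart 𝒱 q f fun i => v i.castSucc) (v (Fin.last (d + 1))) =
        ksign ((d : ZMod 2) + 1 + p 0 * q) • ip (v 0) (parityPart 𝒱 q f fun i => v i.succ) ↔
      proj 𝒦 (q + ∑ i, p i) (ip (f fun i => v i.castSucc) (v (Fin.last (d + 1)))) =
        proj 𝒦 (q + ∑ i, p i) (ksign ((d : ZMod 2) + 1 + p 0 * ∑ i : Fin (d + 1), p i.succ) •
          ip (f fun i => v i.succ) (v 0))) := by
    intro q v p hv
    rw [parityPart_of_mem hf q (fun i : Fin (d + 1) => hv i.castSucc),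
      parityPart_of_mem hf q (fun i : Fin (d + 1) => hv i.succ),
      ← hip.proj_left _ _ (hv _), hip.symm _ _ _ _ (hv 0) (proj_mem 𝒱 _ _),
      ← hip.proj_left _ _ (hv _), proj_zsmul, ksign_smul_ksign_smul]
    have e1 : q + ∑ i : Fin (d + 1), p i.castSucc + p (Fin.last (d + 1)) = q + ∑ i, p i := by
      rw [Fin.sum_univ_castSucc p, add_assoc]
    have e2 : q + ∑ i : Fin (d + 1), p i.succ + p 0 = q + ∑ i, p i := by
      rw [Fin.sum_univ_succ p]; ring
    have e3 : (d : ZMod 2) + 1 + p 0 * q + p 0 * (q + ∑ i : Fin (d + 1), p i.succ) =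
        (d : ZMod 2) + 1 + p 0 * ∑ i : Fin (d + 1), p i.succ := by
      generalize (d : ZMod 2) = x, p 0 = y, ∑ i : Fin (d + 1), p i.succ = z
      clear * -
      decide +revert
    rw [e1, e2, e3]
  constructor
  · intro h v p hv
    rw [← sum_proj 𝒦 (ip _ _), ← sum_proj 𝒦 (ksign _ • ip _ _)]
    refine Finset.sum_congr rfl fun r _ => ?_
    have := (key (r - ∑ i, p i) v p hv).1 (h _ v p hv)
    rwa [sub_add_cancel] at this
  · intro h q v p hv
    rw [key q v p hv, h v p hv]

/-- After décalage the cyclicity sign is exactly the Koszul sign of moving the first letter past all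
the others. -/
theorem isCyclic_iff_rotate (hip : IsInnerProduct 𝒦 𝒱 ip) {φ : CochainFamily V}
    (hφ : ∀ d, MultiAdditive (φ d)) : (∀ d, IsCyclic 𝒱 ip (φ d)) ↔
      ∀ (a : V × ZMod 2) (l : List (V × ZMod 2)), l ≠ [] → (∀ c ∈ a :: l, Shifted 𝒱 c) →
        listForm 1 (formSeq (tilde ip φ)) (a :: l) =
          ksign (a.2 * label l) • listForm 1 (formSeq (tilde ip φ)) (l ++ [a]) := by
  have key : ∀ (d : ℕ) (v : Fin (d + 2) → V) (p : Fin (d + 2) → ZMod 2), (∀ i, v i ∈ 𝒱 (p i)) →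
      (ip (φ d fun i => v i.castSucc) (v (Fin.last (d + 1))) =
          ksign ((d : ZMod 2) + 1 + p 0 * ∑ i : Fin (d + 1), p i.succ) •
            ip (φ d fun i => v i.succ) (v 0) ↔
        listForm 1 (formSeq (tilde ip φ)) (letters v p) = ksign ((p 0 + 1) *
          label (letters (fun i : Fin (d + 1) => v i.succ) fun i => p i.succ)) •
          listForm 1 (formSeq (tilde ip φ))
            (letters (fun i : Fin (d + 1) => v i.succ) (fun i => p i.succ) ++ [(v 0, p 0 + 1)])) := by
    intro d v p hv
    have e1 : listForm 1 (formSeq (tilde ip φ)) (letters v p) =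
        ksign (decalage 1 (letters v p)) •
          ip (φ d fun i => v i.castSucc) (v (Fin.last (d + 1))) := by
      rw [listForm_letters]; rfl
    have e2 : decalage 1 (letters v p) = (p 0) * (d + 2) +
        decalage 1 (letters (fun i : Fin (d + 1) => v i.succ) fun i => p i.succ) := by
      rw [letters, List.ofFn_succ, decalage, add_one_add_one]
      simp only [List.length_ofFn, letters]
      push_cast
      ring
    have e3 := decalage_eq_add 1 (letters (fun i : Fin (d + 1) => v i.succ) fun i => p i.succ)
    have e4 : (letters (fun i : Fin (d + 1) => v i.succ) fun i => p i.succ).length = d + 1 := by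
      simp [letters]
    rw [listForm_tilde, e1, listForm_letters, e2, e3, label_letters, e4, map_zsmul,
      AddMonoidHom.zsmul_apply, cochainSeq]
    simp only [ksign_smul_ksign_smul]
    rw [← eq_ksign_smul_iff, ksign_smul_ksign_smul]
    have e5 : ∀ (A B : ZMod 2) (x y : K), A = B → ((x = ksign A • y) ↔ (x = ksign B • y)) := by
      rintro A _ x y rfl; rfl
    refine e5 _ _ _ _ ?_
    push_cast
    generalize decalage 0 (letters (fun i : Fin (d + 1) => v i.succ) fun i => p i.succ) = t
    generalize (d : ZMod 2) = x, p 0 = y, ∑ i : Fin (d + 1), p i.succ = z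
    clear * -
    decide +revert
  constructor
  · intro h a l hl hg
    obtain ⟨v, p, e⟩ := exists_letters_eq (a :: l)
    obtain ⟨d, hd⟩ : ∃ d, (a :: l).length = d + 2 := by
      obtain ⟨b, l', rfl⟩ := List.exists_cons_of_ne_nil hl
      exact ⟨l'.length, rfl⟩
    generalize (a :: l).length = N at hd v p e
    subst hd
    rw [e] at hg
    have hv := mem_of_shifted_letters hg
    have h1 := (key d v p hv).1 ((isCyclic_iff hip (hφ d)).1 (h d) v p hv)
    have h2 := e
    rw [letters, List.ofFn_succ] at h2
    rw [List.cons.injEq] at h2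
    rw [← e] at h1
    rw [h1, h2.1, h2.2]
    rfl
  · intro h d
    rw [isCyclic_iff hip (hφ d)]
    intro v p hv
    rw [key d v p hv]
    have hg := shifted_of_mem_letters hv
    rw [letters, List.ofFn_succ] at hg
    have := h (v 0, p 0 + 1) (letters (fun i : Fin (d + 1) => v i.succ) fun i => p i.succ)
      (by simp [letters]) hg
    rw [← this, letters, List.ofFn_succ]
    rfl

omit [GradedRing 𝒦] [DirectSum.Decomposition 𝒱] [Module K V] [Module Kᵐᵒᵖ V] in
-- Away from the last place a transposition only touches the arguments of φ. The last two letters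
-- are first rotated inwards; when there are no other letters, rotation is itself the transposition.
theorem swapSymm_tilde {φ : CochainFamily V}
    (hφ : SwapSymm (Shifted 𝒱) (listForm 0 (cochainSeq φ)))
    (hrot : ∀ (a : V × ZMod 2) (l : List (V × ZMod 2)), l ≠ [] → (∀ c ∈ a :: l, Shifted 𝒱 c) →
        listForm 1 (formSeq (tilde ip φ)) (a :: l) =
          ksign (a.2 * label l) • listForm 1 (formSeq (tilde ip φ)) (l ++ [a])) :
    SwapSymm (Shifted 𝒱) (listForm 1 (formSeq (tilde ip φ))) := by
  have h1 : ∀ (l₁ l₂ : List (V × ZMod 2)) (a b w : V × ZMod 2),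
      (∀ c ∈ l₁ ++ a :: b :: l₂, Shifted 𝒱 c) →
      listForm 1 (formSeq (tilde ip φ)) ((l₁ ++ a :: b :: l₂) ++ [w]) = ksign (a.2 * b.2) •
        listForm 1 (formSeq (tilde ip φ)) ((l₁ ++ b :: a :: l₂) ++ [w]) := by
    intro l₁ l₂ a b w hl
    rw [listForm_tilde, listForm_tilde, hφ _ _ _ _ hl, map_zsmul, AddMonoidHom.zsmul_apply,
      smul_comm]
  intro l₁ l₂ a b hl
  rcases List.eq_nil_or_concat l₂ with rfl | ⟨l₂, w, rfl⟩
  · cases l₁ with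
    | nil => simpa using hrot a [b] (by simp) hl
    | cons c l₁ =>
      have hl' : ∀ x ∈ c :: (l₁ ++ [b, a]), Shifted 𝒱 x := by
        intro x hx
        apply hl
        simp only [List.cons_append, List.mem_cons, List.mem_append] at hx ⊢
        tauto
      rw [List.cons_append, List.cons_append, hrot c (l₁ ++ [a, b]) (by simp) hl,
        hrot c (l₁ ++ [b, a]) (by simp) hl',
        h1 _ _ _ _ _ (fun x hx => hl x (by simp only [List.cons_append, List.mem_cons]; tauto)),
        smul_comm]
      simp only [label_append, label_cons, label_nil]
      congr 1
      refine ksign_smul_congr ?_ _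
      ring
  · simp only [List.concat_eq_append] at hl ⊢
    have := h1 l₁ l₂ a b w (fun c hc => hl c (by
      simp only [List.mem_append, List.mem_cons] at hc ⊢; tauto))
    simpa using this

end InnerProduct

end LInfty

namespace LInfty

set_option linter.unusedSectionVars false

/-! ### Cyclic cochains and symmetric forms -/

section Sharp

variable {K V : Type*} [Ring K] [AddCommGroup V] [Module K V] [Module Kᵐᵒᵖ V]
  {𝒦 : ZMod 2 → AddSubgroup K} [GradedRing 𝒦] {𝒱 : ZMod 2 → AddSubgroup V}
  [DirectSum.Decomposition 𝒱] {ip : V →+ V →+ K}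

/-- The function of lists of a sequence of cochains. -/
abbrev cochainList (φ : CochainFamily V) : List (V × ZMod 2) → V := listForm 0 (cochainSeq φ)

/-- The function of lists of a sequence of scalar valued cochains. -/
abbrev formList (f : FormFamily V K) : List (V × ZMod 2) → K := listForm 1 (formSeq f)

theorem isCochain_formSeq {f : FormFamily V K} (hf : f ∈ Forms K 𝒱) (m : ℕ) :
    IsCochain K 𝒱 (formSeq f (m + 1)) := by
  cases m with
  | zero => exact ⟨by simp [formSeq], by simp [formSeq], by simp [formSeq], by simp [formSeq]⟩
  | succ d => exact hf d

theorem swapSymm_cochainList {φ : CochainFamily V} (hφ : InC K 𝒱 φ) :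
    SwapSymm (Shifted 𝒱) (cochainList φ) := swapSymm_listForm 0 fun m => (hφ m).antisymm

theorem swapSymm_formList {f : FormFamily V K} (hf : f ∈ Forms K 𝒱) :
    SwapSymm (Shifted 𝒱) (formList f) :=
  swapSymm_listForm 1 fun m => (isCochain_formSeq hf m).antisymm

theorem headAdditive_cochainList {φ : CochainFamily V} (hφ : ∀ d, MultiAdditive (φ d)) :
    HeadAdditive (cochainList φ) := headAdditive_listForm 0 hφ

theorem multiAdditive_formSeq {f : FormFamily V K} (hf : ∀ d, MultiAdditive (f d)) (m : ℕ) :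
    MultiAdditive (formSeq f (m + 1)) := by
  cases m with
  | zero => exact fun _ _ _ _ => (add_zero 0).symm
  | succ d => exact hf d

theorem headAdditive_formList {f : FormFamily V K} (hf : ∀ d, MultiAdditive (f d)) :
    HeadAdditive (formList f) := headAdditive_listForm 1 (multiAdditive_formSeq hf)

theorem formList_nil (f : FormFamily V K) : formList f [] = 0 := smul_zero _

theorem formList_singleton (f : FormFamily V K) (a : V × ZMod 2) : formList f [a] = 0 :=
  smul_zero _

theorem cochainList_nil (φ : CochainFamily V) : cochainList φ [] = 0 := smul_zero _

/-- Every form has at least two arguments, so lists with a distinguished last letter suffice; there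
the inner product formulas apply. -/
theorem forms_ext {f g : FormFamily V K} (hf : ∀ d, MultiAdditive (f d))
    (hg : ∀ d, MultiAdditive (g d))
    (h : ∀ l w, (∀ c ∈ l, Shifted 𝒱 c) → Shifted 𝒱 w →
      formList f (l ++ [w]) = formList g (l ++ [w])) : f = g := by
  funext d
  refine (hf d).ext 𝒱 (hg d) fun v p hv => ?_
  have hg := shifted_of_mem_letters hv
  have e : letters v p = letters (fun i : Fin (d + 1) => v i.castSucc) (fun i => p i.castSucc) ++
      [(v (Fin.last (d + 1)), p (Fin.last (d + 1)) + 1)] := by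
    rw [letters, List.ofFn_succ', List.concat_eq_append]; rfl
  rw [e] at hg
  have h1 := h _ _ (fun c hc => hg c (List.mem_append_left _ hc))
    (hg _ (List.mem_append_right _ (List.mem_singleton_self _)))
  rw [← e, formList, formList, listForm_letters, listForm_letters] at h1
  rw [← ksign_smul_self (decalage 1 (letters v p)) (f d v),
    ← ksign_smul_self (decalage 1 (letters v p)) (g d v)]
  exact congrArg _ h1

theorem tilde_injective (hip : IsInnerProduct 𝒦 𝒱 ip) : Function.Injective (tilde ip) := by
  intro φ ψ h
  funext d v
  refine hip.ext fun w => ?_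
  have := congrFun (congrFun h d) (Fin.snoc (α := fun _ => V) v w)
  simpa only [tilde, Fin.snoc_castSucc, Fin.snoc_last] using this

theorem tilde_mem_forms (hV : IsSupermodule 𝒦 𝒱) (hip : IsInnerProduct 𝒦 𝒱 ip)
    {φ : CochainFamily V} (hφ : φ ∈ CC 𝒱 ip) : tilde ip φ ∈ Forms K 𝒱 := by
  have hφa : ∀ d, MultiAdditive (φ d) := fun d => (hφ.1 d).add
  have hlin : HeadLinear 𝒦 𝒱 1 (formList (tilde ip φ)) := by
    intro s t ht a l ha hl
    rcases List.eq_nil_or_concat l with rfl | ⟨l, w, rfl⟩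
    · rw [formList_singleton, formList_singleton, smul_zero, smul_zero]
    · rw [List.concat_eq_append] at hl ⊢
      have hw : Shifted 𝒱 w := hl w (by simp)
      rw [← List.cons_append, ← List.cons_append, formList, listForm_tilde, listForm_tilde,
        headLinear_listForm hV 0 (F := cochainSeq φ) hφ.1 s t ht a l ha fun c hc => hl c (by simp [hc]), map_zsmul,
        AddMonoidHom.zsmul_apply, hip.op_smul_left hV ht _ hw, smul_comm (MulOpposite.op t)]
      simp only [ksign_smul_ksign_smul, label_append, label_cons, label_nil]
      refine ksign_smul_congr ?_ _
      ring
  exact fun d => isCochain_of_list hV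
    (swapSymm_tilde (swapSymm_cochainList hφ.1) ((isCyclic_iff_rotate hip hφa).1 hφ.2)) hlin
    (multiAdditive_tilde hφa d) fun v p _ => by
      rw [listForm_letters, ksign_smul_self]; rfl

/-- The cochain that corresponds to a scalar valued cochain under the inner product. -/
noncomputable def sharp (hip : IsInnerProduct 𝒦 𝒱 ip) (f : Forms K 𝒱) : CochainFamily V :=
  fun d v => (hip.nondegenerate
    { toFun := fun w => f.1 d (Fin.snoc (α := fun _ => V) v w)
      map_add' := fun x y => by
        have := (f.2 d).add (Fin.snoc (α := fun _ => V) v 0) (Fin.last _) x y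
        simpa only [Fin.update_snoc_last] using this
      map_smul' := fun t x => by
        have := (f.2 d).map_op_smul (Fin.snoc (α := fun _ => V) v x) t.unop
        simpa only [Fin.update_snoc_last, Fin.snoc_last, MulOpposite.op_unop, RingHom.id_apply]
          using this }).choose

theorem ip_sharp (hip : IsInnerProduct 𝒦 𝒱 ip) (f : Forms K 𝒱) (d : ℕ) (v : Fin (d + 1) → V)
    (w : V) : ip (sharp hip f d v) w = f.1 d (Fin.snoc (α := fun _ => V) v w) :=
  (hip.nondegenerate _).choose_spec.1 w

theorem tilde_sharp (hip : IsInnerProduct 𝒦 𝒱 ip) (f : Forms K 𝒱) :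
    tilde ip (sharp hip f) = f.1 := by
  funext d v
  rw [tilde, ip_sharp]
  exact congrArg _ (Fin.snoc_init_self (α := fun _ => V) v)

theorem sharp_eq_of_tilde (hip : IsInnerProduct 𝒦 𝒱 ip) {f : Forms K 𝒱} {φ : CochainFamily V}
    (h : f.1 = tilde ip φ) : sharp hip f = φ :=
  tilde_injective hip (by rw [tilde_sharp, h])

theorem formList_append_singleton (hip : IsInnerProduct 𝒦 𝒱 ip) (f : Forms K 𝒱)
    (l : List (V × ZMod 2)) (w : V × ZMod 2) :
    formList f.1 (l ++ [w]) = ksign (w.2 + 1) • ip (cochainList (sharp hip f) l) w.1 := by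
  rw [← tilde_sharp hip f]
  simp only [formList, listForm_tilde]

theorem multiAdditive_sharp (hip : IsInnerProduct 𝒦 𝒱 ip) (f : Forms K 𝒱) (d : ℕ) :
    MultiAdditive (sharp hip f d) := by
  intro v i x y
  refine hip.ext fun w => ?_
  rw [map_add, AddMonoidHom.add_apply]
  simp only [ip_sharp, Fin.snoc_update]
  exact (f.2 d).add _ _ _ _

/-- Each axiom is tested by pairing with a homogeneous vector, where it becomes an axiom of the form
with one more argument. Rotation is a special case of full graded symmetry, so cyclicity is
automatic. -/
theorem sharp_mem (hV : IsSupermodule 𝒦 𝒱) (hip : IsInnerProduct 𝒦 𝒱 ip) (f : Forms K 𝒱) :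
    sharp hip f ∈ CC 𝒱 ip := by
  have ha := multiAdditive_sharp hip f
  have hs := swapSymm_formList f.2
  have hl := headLinear_listForm hV 1 (isCochain_formSeq f.2)
  have hip' : ∀ (l : List (V × ZMod 2)) (q : ZMod 2) (w : V),
      ip (cochainList (sharp hip f) l) w = ksign q • formList f.1 (l ++ [(w, q + 1)]) := by
    intro l q w
    rw [formList_append_singleton hip, add_one_add_one, ksign_smul_self]
  have hw' : ∀ {q : ZMod 2} {w : V}, w ∈ 𝒱 q → Shifted 𝒱 (w, q + 1) := fun hw => by
    rwa [Shifted, add_one_add_one]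
  refine ⟨fun d => isCochain_of_list (e := 0) (F := cochainList (sharp hip f)) hV ?_ ?_ (ha d)
    fun v p _ => by rw [cochainList, listForm_letters, ksign_smul_self]; rfl, ?_⟩
  · intro l₁ l₂ a b hg
    refine hip.ext_homogeneous fun q w hw => ?_
    rw [map_zsmul, AddMonoidHom.zsmul_apply, hip' _ q, hip' _ q, List.append_assoc,
      List.append_assoc, List.cons_append, List.cons_append, List.cons_append, List.cons_append,
      hs, smul_comm]
    intro c hc
    have := hg c
    simp only [List.mem_append, List.mem_cons, List.not_mem_nil, or_false] at hc this
    rcases hc with hc | hc | hc | hc | rfl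
    exacts [this (Or.inl hc), this (Or.inr (Or.inl hc)), this (Or.inr (Or.inr (Or.inl hc))),
      this (Or.inr (Or.inr (Or.inr hc))), hw' hw]
  · intro s t ht a l ha hl'
    refine hip.ext_homogeneous fun q w hw => ?_
    rw [map_zsmul, AddMonoidHom.zsmul_apply, hip.op_smul_left hV ht _ hw, hip' _ q, hip' _ q,
      List.cons_append, List.cons_append]
    refine (congrArg _ (hl s t ht a (l ++ [(w, q + 1)]) ha ?_)).trans ?_
    · intro c hc
      simp only [List.mem_append, List.mem_cons, List.not_mem_nil, or_false] at hc
      rcases hc with hc | rfl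
      exacts [hl' c hc, hw' hw]
    · rw [smul_comm (MulOpposite.op t)]
      simp only [ksign_smul_ksign_smul, label_append, label_cons, label_nil]
      refine ksign_smul_congr ?_ _
      generalize label l = x
      clear * -
      decide +revert
  · refine (isCyclic_iff_rotate hip ha).2 fun a l _ hg => ?_
    rw [tilde_sharp]
    have := hs.cons_eq_append [] l [] a (by simpa using ⟨hg a (by simp), fun x y h => hg _ (by
      simp [h])⟩)
    simpa using this

theorem bijOn_tilde (hV : IsSupermodule 𝒦 𝒱) (hip : IsInnerProduct 𝒦 𝒱 ip) :
    Set.BijOn (tilde ip) (CC 𝒱 ip) (Forms K 𝒱 : Set (FormFamily V K)) :=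
  ⟨fun _ hφ => tilde_mem_forms hV hip hφ, (tilde_injective hip).injOn,
    fun f hf => ⟨sharp hip ⟨f, hf⟩, sharp_mem hV hip _, tilde_sharp hip _⟩⟩

end Sharp

end LInfty

namespace LInfty

set_option linter.unusedSectionVars false

/-! ### Additivity of insertions -/

section SecondAdditive

variable {K V X : Type*} [Ring K] [AddCommGroup V] [Module K V] [Module Kᵐᵒᵖ V]
  [AddCommGroup X] [Module Kᵐᵒᵖ X]

/-- Additivity in the second entry. -/
def SecondAdditive (f : List (V × ZMod 2) → X) : Prop :=
  ∀ (a : V × ZMod 2) (x y : V) (p : ZMod 2) (l : List (V × ZMod 2)),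
    f (a :: (x + y, p) :: l) = f (a :: (x, p) :: l) + f (a :: (y, p) :: l)

theorem secondAdditive_listForm (e : ZMod 2) {F : ∀ N : ℕ, (Fin N → V) → X}
    (hF : ∀ m, MultiAdditive (F (m + 1))) : SecondAdditive (listForm e F) := by
  intro a x y p l
  have key : ∀ z, listForm e F (a :: (z, p) :: l) = ksign (decalage e (a :: (0, p) :: l)) •
      F (l.length + 2) (Function.update (Fin.cons a.1 (Fin.cons 0 fun i => (l.get i).1 :
        Fin (l.length + 1) → V) : Fin (l.length + 2) → V) (Fin.succ 0) z) := by
    intro z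
    rw [listForm, ← Fin.cons_update, Fin.update_cons_zero]
    congr 2
    funext i
    refine Fin.cases rfl (fun i => ?_) i
    refine Fin.cases rfl (fun i => ?_) i
    rfl
  rw [key, key, key, hF, smul_add]

theorem SecondAdditive.homPart {𝒳 : ZMod 2 → AddSubgroup X} [DirectSum.Decomposition 𝒳]
    {u γ : ZMod 2} {f : List (V × ZMod 2) → X} (hf : SecondAdditive f) :
    SecondAdditive (homPart 𝒳 u γ f) := by
  intro a x y p l
  simp only [LInfty.homPart, hf a x y p l, proj_add, label_cons]

/-- A head letter not consumed by `g` lands in the second entry of `f`. Additivity is claimed for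
arbitrary letters, where graded symmetry is not available, hence the separate hypothesis. -/
theorem HeadAdditive.listComp {γ : ZMod 2} {f : List (V × ZMod 2) → X}
    {g : List (V × ZMod 2) → V} (hf : HeadAdditive f) (hf' : SecondAdditive f)
    (hg : HeadAdditive g) : HeadAdditive (listComp γ f g) := by
  intro x y p l
  simp only [LInfty.listComp, koszulSum_cons, hg _ _ _ _, hf _ _ _ _, hf' _ _ _ _ _, label_cons,
    smul_add, unshuffleSum_add]
  abel

theorem SwapSymm.add {good : V × ZMod 2 → Prop} {f g : List (V × ZMod 2) → X}
    (hf : SwapSymm good f) (hg : SwapSymm good g) : SwapSymm good fun l => f l + g l := by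
  intro l₁ l₂ a b hl
  beta_reduce
  rw [hf _ _ _ _ hl, hg _ _ _ _ hl, smul_add]

theorem SwapSymm.zsmul {good : V × ZMod 2 → Prop} {f : List (V × ZMod 2) → X}
    (hf : SwapSymm good f) (n : ℤ) : SwapSymm good fun l => n • f l := by
  intro l₁ l₂ a b hl
  beta_reduce
  rw [hf _ _ _ _ hl, smul_comm]

theorem SwapSymm.sum {ι : Type*} (s : Finset ι) {good : V × ZMod 2 → Prop}
    {f : ι → List (V × ZMod 2) → X} (hf : ∀ i, SwapSymm good (f i)) :
    SwapSymm good fun l => ∑ i ∈ s, f i l := by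
  intro l₁ l₂ a b hl
  simp only [hf _ _ _ _ _ hl, ← Finset.smul_sum]

theorem HeadAdditive.add {f g : List (V × ZMod 2) → X} (hf : HeadAdditive f)
    (hg : HeadAdditive g) : HeadAdditive fun l => f l + g l := by
  intro x y p l
  simp only [hf x y p l, hg x y p l]
  abel

theorem HeadAdditive.const_zsmul {f : List (V × ZMod 2) → X} (hf : HeadAdditive f) (n : ℤ) :
    HeadAdditive fun l => n • f l := by
  intro x y p l
  simp only [hf x y p l, smul_add]

theorem HeadAdditive.sum {ι : Type*} (s : Finset ι) {f : ι → List (V × ZMod 2) → X}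
    (hf : ∀ i, HeadAdditive (f i)) : HeadAdditive fun l => ∑ i ∈ s, f i l := by
  intro x y p l
  simp only [hf _ x y p l, Finset.sum_add_distrib]

theorem HeadLinear.sum {ι : Type*} (s : Finset ι) {𝒦 : ZMod 2 → AddSubgroup K}
    {𝒱 : ZMod 2 → AddSubgroup V} {e : ZMod 2} {f : ι → List (V × ZMod 2) → X}
    (hf : ∀ i, HeadLinear 𝒦 𝒱 e (f i)) : HeadLinear 𝒦 𝒱 e fun l => ∑ i ∈ s, f i l := by
  intro t ht t' a l ha hl
  simp only [hf _ t ht t' a l ha hl, Finset.smul_sum]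

end SecondAdditive

/-! ### Insertion into forms and the modified bracket -/

section Action

variable {K V : Type*} [Ring K] [AddCommGroup V] [Module K V] [Module Kᵐᵒᵖ V]
  {𝒦 : ZMod 2 → AddSubgroup K} [GradedRing 𝒦] (𝒱 : ZMod 2 → AddSubgroup V)
  [DirectSum.Decomposition 𝒱] {ip : V →+ V →+ K}

/-- The insertion of a sequence of cochains into a sequence of forms, on lists. -/
def actList (f : FormFamily V K) (ψ : CochainFamily V) (l : List (V × ZMod 2)) : K :=
  ∑ γ, listComp γ (formList f) (homPart 𝒱 1 γ (cochainList ψ)) l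

/-- The insertion of a sequence of cochains into a sequence of forms. -/
def act (f : FormFamily V K) (ψ : CochainFamily V) : FormFamily V K :=
  fun d => extend 𝒱 1 (actList 𝒱 f ψ) (d + 2)

/-- The modified bracket on lists. -/
def bracketList (φ ψ : CochainFamily V) (l : List (V × ZMod 2)) : V :=
  ∑ γ₁, ∑ γ₂, (listComp γ₂ (homPart 𝒱 1 γ₁ (cochainList φ)) (homPart 𝒱 1 γ₂ (cochainList ψ)) l +
    ksign (γ₁ * γ₂ + 1) •
      listComp γ₁ (homPart 𝒱 1 γ₂ (cochainList ψ)) (homPart 𝒱 1 γ₁ (cochainList φ)) l)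

variable {𝒱}

theorem forms_multiAdditive {f : FormFamily V K} (hf : f ∈ Forms K 𝒱) (d : ℕ) :
    MultiAdditive (f d) := (hf d).add

theorem swapSymm_actList {f : FormFamily V K} (hf : f ∈ Forms K 𝒱) {ψ : CochainFamily V}
    (hψ : InC K 𝒱 ψ) : SwapSymm (Shifted 𝒱) (actList 𝒱 f ψ) :=
  SwapSymm.sum _ fun _ => (swapSymm_formList hf).listComp
    (headAdditive_formList (forms_multiAdditive hf)) (swapSymm_cochainList hψ).homPart
      hasDegree_homPart

theorem headAdditive_actList {f : FormFamily V K} (hf : ∀ d, MultiAdditive (f d))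
    {ψ : CochainFamily V} (hψ : ∀ d, MultiAdditive (ψ d)) : HeadAdditive (actList 𝒱 f ψ) :=
  HeadAdditive.sum _ fun _ => (headAdditive_formList hf).listComp
    (secondAdditive_listForm 1 (multiAdditive_formSeq hf)) (headAdditive_cochainList hψ).homPart

theorem headLinear_actList (hV : IsSupermodule 𝒦 𝒱) {f : FormFamily V K} (hf : f ∈ Forms K 𝒱)
    {ψ : CochainFamily V} (hψ : InC K 𝒱 ψ) : HeadLinear 𝒦 𝒱 1 (actList 𝒱 f ψ) :=
  HeadLinear.sum _ fun _ => HeadLinear.listComp hV (swapSymm_formList hf)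
    (headAdditive_formList (forms_multiAdditive hf))
    (headLinear_listForm hV 1 (isCochain_formSeq hf))
    ((headLinear_listForm hV 0 (F := cochainSeq ψ) hψ).homPart
      fun _ _ _ _ ht hx => hV.op_smul_mem ht hx) hasDegree_homPart

theorem act_mem (hV : IsSupermodule 𝒦 𝒱) {f : FormFamily V K} (hf : f ∈ Forms K 𝒱)
    {ψ : CochainFamily V} (hψ : InC K 𝒱 ψ) : act 𝒱 f ψ ∈ Forms K 𝒱 := fun d =>
  isCochain_extend hV (swapSymm_actList hf hψ)
    (headAdditive_actList (forms_multiAdditive hf) fun d => (hψ d).add)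
    (headLinear_actList hV hf hψ) (d + 1)

theorem actList_nil (f : FormFamily V K) (ψ : CochainFamily V) : actList 𝒱 f ψ [] = 0 :=
  Finset.sum_eq_zero fun _ _ => formList_singleton _ _

theorem actList_singleton {f : FormFamily V K} (hf : ∀ d, MultiAdditive (f d))
    (ψ : CochainFamily V) (a : V × ZMod 2) : actList 𝒱 f ψ [a] = 0 :=
  Finset.sum_eq_zero fun γ _ => by
    have : homPart 𝒱 1 γ (cochainList ψ) [] = 0 := by
      rw [homPart, cochainList_nil, proj_zero]
    rw [listComp, koszulSum_cons, koszulSum_nil, koszulSum_nil, formList_singleton, this,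
      (headAdditive_formList hf).zero, smul_zero, add_zero]

theorem formList_act {f : FormFamily V K} (hf : f ∈ Forms K 𝒱) {ψ : CochainFamily V}
    (hψ : InC K 𝒱 ψ) {l : List (V × ZMod 2)} (hl : ∀ c ∈ l, Shifted 𝒱 c) :
    formList (act 𝒱 f ψ) l = actList 𝒱 f ψ l := by
  have hfa := forms_multiAdditive hf
  rw [formList, formSeq_eq_extend (f := act 𝒱 f ψ) (actList_nil f ψ) (actList_singleton hfa ψ) fun _ => rfl]
  exact listForm_extend (swapSymm_actList hf hψ)
    (headAdditive_actList hfa fun d => (hψ d).add) hl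

theorem insertAt_zero_left {X : Type*} [AddCommGroup X] {m b N : ℕ} (g : (Fin (b + 1) → V) → V)
    (p : Fin N → ZMod 2) (v : Fin N → V) :
    insertAt (0 : (Fin (m + 1) → V) → X) g p v = 0 := by
  simp [insertAt]

theorem insertAt_zero_right {X : Type*} [AddCommGroup X] {m b N : ℕ} {f : (Fin (m + 1) → V) → X}
    (hf : MultiAdditive f) (p : Fin N → ZMod 2) (v : Fin N → V) :
    insertAt f (0 : (Fin (b + 1) → V) → V) p v = 0 :=
  Finset.sum_eq_zero fun σ _ => by
    rw [hf.eq_zero (i := 0) (by simp), smul_zero]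

theorem act_apply {f : FormFamily V K} (hf : f ∈ Forms K 𝒱) {ψ : CochainFamily V}
    (hψ : InC K 𝒱 ψ) {d : ℕ} {v : Fin (d + 2) → V} {p : Fin (d + 2) → ZMod 2}
    (hv : ∀ i, v i ∈ 𝒱 (p i)) :
    act 𝒱 f ψ d v = ∑ ab ∈ Finset.HasAntidiagonal.antidiagonal d, ∑ γ,
      ksign ((ab.1 : ZMod 2) * (γ + ab.2)) •
        insertAt (f ab.1) (parityPart 𝒱 (γ + ab.2) (ψ ab.2)) p v := by
  have hfa := forms_multiAdditive hf
  have hψa : ∀ d, MultiAdditive (ψ d) := fun d => (hψ d).add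
  have hg := shifted_of_mem_letters hv
  rw [act, extend_of_mem (swapSymm_actList hf hψ) (headAdditive_actList hfa hψa) hv, actList,
    Finset.smul_sum, Finset.sum_comm]
  refine Finset.sum_congr rfl fun γ _ => ?_
  have h1 := listComp_congr (𝒱 := 𝒱) (γ := γ) (f := formList f) (f' := formList f)
    (g := homPart 𝒱 1 γ (cochainList ψ)) hasDegree_homPart (fun _ _ => rfl)
    (fun l hl => (listForm_parityPart hψa γ hl).symm) hg
  rw [h1]
  have h2 := sum_insertAt 1 γ (headAdditive_formList hfa)
    (G := cochainSeq fun d => parityPart 𝒱 (γ + d) (ψ d)) rfl v p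
  -- On lists the outer map may also have one argument. That term vanishes for forms, and dropping
  -- it shifts the index by one; the shift `e = 1` then gives the exponent (k - 1)|ψ_l|.
  rw [← h2, Finset.Nat.sum_antidiagonal_succ]
  have h3 : insertAt (formSeq f (0 + 1)) (cochainSeq (fun d => parityPart 𝒱 (γ + d) (ψ d))
      (d + 1 + 1)) p v = 0 := insertAt_zero_left _ _ _
  rw [h3, smul_zero, zero_add]
  refine Finset.sum_congr rfl fun ab _ => ?_
  have h4 : (γ + ab.2) * (((ab.1 + 1 : ℕ) : ZMod 2) + 1) = (ab.1 : ZMod 2) * (γ + ab.2) := by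
    push_cast
    rw [add_one_add_one, mul_comm]
  simp only [h4]
  rfl

theorem act_apply_of_hasParity {f : FormFamily V K} (hf : f ∈ Forms K 𝒱) {ψ : CochainFamily V}
    (hψ : InC K 𝒱 ψ) {q : ℕ → ZMod 2} (hq : ∀ b, HasParity 𝒱 𝒱 (q b) (ψ b)) {d : ℕ}
    {v : Fin (d + 2) → V} {p : Fin (d + 2) → ZMod 2} (hv : ∀ i, v i ∈ 𝒱 (p i)) :
    act 𝒱 f ψ d v = ∑ ab ∈ Finset.HasAntidiagonal.antidiagonal d,
      ksign ((ab.1 : ZMod 2) * q ab.2) • insertAt (f ab.1) (ψ ab.2) p v := by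
  rw [act_apply hf hψ hv]
  refine Finset.sum_congr rfl fun ab _ => ?_
  rw [Finset.sum_eq_single (q ab.2 - ab.2)]
  · rw [sub_add_cancel, parityPart_of_hasParity (hψ _).add (hq _)]
  · intro γ _ hγ
    rw [parityPart_of_hasParity_ne (hψ _).add (hq _) fun h => hγ (by rw [h, add_sub_cancel_right]),
      insertAt_zero_right (forms_multiAdditive hf _), smul_zero]
  · simp

theorem swapSymm_bracketList {φ ψ : CochainFamily V} (hφ : InC K 𝒱 φ) (hψ : InC K 𝒱 ψ) :
    SwapSymm (Shifted 𝒱) (bracketList 𝒱 φ ψ) := by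
  have key : ∀ {φ ψ : CochainFamily V}, InC K 𝒱 φ → InC K 𝒱 ψ → ∀ γ₁ γ₂ : ZMod 2,
      SwapSymm (Shifted 𝒱) (listComp γ₂ (homPart 𝒱 1 γ₁ (cochainList φ))
        (homPart 𝒱 1 γ₂ (cochainList ψ))) := fun hφ hψ γ₁ γ₂ =>
    (swapSymm_cochainList hφ).homPart.listComp
      (headAdditive_cochainList fun d => (hφ d).add).homPart (swapSymm_cochainList hψ).homPart
      hasDegree_homPart
  exact SwapSymm.sum _ fun γ₁ => SwapSymm.sum _ fun γ₂ =>
    (key hφ hψ γ₁ γ₂).add ((key hψ hφ γ₂ γ₁).zsmul _)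

theorem headAdditive_bracketList {φ ψ : CochainFamily V} (hφ : ∀ d, MultiAdditive (φ d))
    (hψ : ∀ d, MultiAdditive (ψ d)) : HeadAdditive (bracketList 𝒱 φ ψ) := by
  have key : ∀ {φ ψ : CochainFamily V}, (∀ d, MultiAdditive (φ d)) → (∀ d, MultiAdditive (ψ d)) →
      ∀ γ₁ γ₂ : ZMod 2, HeadAdditive (listComp γ₂ (homPart 𝒱 1 γ₁ (cochainList φ))
        (homPart 𝒱 1 γ₂ (cochainList ψ))) := fun hφ hψ γ₁ γ₂ =>
    (headAdditive_cochainList hφ).homPart.listComp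
      (secondAdditive_listForm 0 (multiAdditive_cochainSeq hφ)).homPart
      (headAdditive_cochainList hψ).homPart
  exact HeadAdditive.sum _ fun γ₁ => HeadAdditive.sum _ fun γ₂ =>
    (key hφ hψ γ₁ γ₂).add ((key hψ hφ γ₂ γ₁).const_zsmul _)

theorem bracketList_nil {φ ψ : CochainFamily V} (hφ : ∀ d, MultiAdditive (φ d))
    (hψ : ∀ d, MultiAdditive (ψ d)) : bracketList 𝒱 φ ψ [] = 0 := by
  refine Finset.sum_eq_zero fun γ₁ _ => Finset.sum_eq_zero fun γ₂ _ => ?_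
  have h : ∀ (γ : ZMod 2) (χ : CochainFamily V), homPart 𝒱 1 γ (cochainList χ) [] = 0 := by
    intro γ χ
    rw [homPart, cochainList_nil, proj_zero]
  rw [listComp, listComp, koszulSum_nil, koszulSum_nil, h γ₂ ψ, h γ₁ φ,
    (headAdditive_cochainList hφ).homPart.zero, (headAdditive_cochainList hψ).homPart.zero,
    smul_zero, add_zero]

theorem sum_insertAt_parityPart {φ ψ : CochainFamily V} (hφ : ∀ d, MultiAdditive (φ d))
    (hψ : ∀ d, MultiAdditive (ψ d)) (γ₁ γ₂ : ZMod 2) {d : ℕ} {v : Fin (d + 1) → V}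
    {p : Fin (d + 1) → ZMod 2} (hv : ∀ i, v i ∈ 𝒱 (p i)) :
    ksign (decalage 0 (letters v p)) • listComp γ₂ (homPart 𝒱 1 γ₁ (cochainList φ))
        (homPart 𝒱 1 γ₂ (cochainList ψ)) (letters v p) =
      ∑ ab ∈ Finset.HasAntidiagonal.antidiagonal d, ksign ((γ₂ + ab.2) * ab.1) •
        insertAt (parityPart 𝒱 (γ₁ + ab.1) (φ ab.1)) (parityPart 𝒱 (γ₂ + ab.2) (ψ ab.2)) p v := by
  have hφ' : ∀ d : ℕ, MultiAdditive (parityPart 𝒱 (γ₁ + d) (φ d)) := fun d =>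
    multiAdditive_parityPart (hφ d) _
  have h1 := listComp_congr (𝒱 := 𝒱) (γ := γ₂) (f := homPart 𝒱 1 γ₁ (cochainList φ))
    (g := homPart 𝒱 1 γ₂ (cochainList ψ)) hasDegree_homPart
    (fun l hl => (listForm_parityPart hφ γ₁ hl).symm)
    (fun l hl => (listForm_parityPart hψ γ₂ hl).symm) (shifted_of_mem_letters hv)
  have h2 := sum_insertAt 0 γ₂ (headAdditive_cochainList hφ')
    (G := cochainSeq fun d => parityPart 𝒱 (γ₂ + d) (ψ d)) rfl v p
  rw [h1, ← h2]
  simp only [add_zero]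
  rfl

/-- In total degrees γ₁ = q + a and γ₂ = r + b, the modified bracket becomes the plain graded
commutator with sign γ₁γ₂. -/
theorem modBracket_eq_extend {φ ψ : CochainFamily V} (hφ : ∀ d, MultiAdditive (φ d))
    (hψ : ∀ d, MultiAdditive (ψ d)) (d : ℕ) :
    modBracket 𝒱 φ ψ d = extend 𝒱 0 (bracketList 𝒱 φ ψ) (d + 1) := by
  funext v
  have h1 : ∀ p : Fin (d + 1) → ZMod 2,
      ksign (decalage 0 (letters (fun i => proj 𝒱 (p i) (v i)) p)) •
        bracketList 𝒱 φ ψ (letters (fun i => proj 𝒱 (p i) (v i)) p) =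
      ∑ ab ∈ Finset.HasAntidiagonal.antidiagonal d, ∑ q : ZMod 2, ∑ r : ZMod 2,
        ksign ((ab.1 : ZMod 2) * r) •
          (insertAt (parityPart 𝒱 q (φ ab.1)) (parityPart 𝒱 r (ψ ab.2)) p
              (fun i => proj 𝒱 (p i) (v i)) -
            ksign (q * r + (ab.1 : ZMod 2) * ab.2) •
              insertAt (parityPart 𝒱 r (ψ ab.2)) (parityPart 𝒱 q (φ ab.1)) p
                (fun i => proj 𝒱 (p i) (v i))) := by
    intro p
    have hv : ∀ i, proj 𝒱 (p i) (v i) ∈ 𝒱 (p i) := fun i => proj_mem 𝒱 _ _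
    have e1 : ∀ γ₁ γ₂ : ZMod 2, ksign (decalage 0 (letters (fun i => proj 𝒱 (p i) (v i)) p)) •
        (listComp γ₂ (homPart 𝒱 1 γ₁ (cochainList φ)) (homPart 𝒱 1 γ₂ (cochainList ψ))
          (letters (fun i => proj 𝒱 (p i) (v i)) p) + ksign (γ₁ * γ₂ + 1) •
          listComp γ₁ (homPart 𝒱 1 γ₂ (cochainList ψ)) (homPart 𝒱 1 γ₁ (cochainList φ))
            (letters (fun i => proj 𝒱 (p i) (v i)) p)) =
        ∑ ab ∈ Finset.HasAntidiagonal.antidiagonal d,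
          (ksign ((γ₂ + ab.2) * ab.1) • insertAt (parityPart 𝒱 (γ₁ + ab.1) (φ ab.1))
              (parityPart 𝒱 (γ₂ + ab.2) (ψ ab.2)) p (fun i => proj 𝒱 (p i) (v i)) +
            ksign (γ₁ * γ₂ + 1 + (γ₁ + ab.1) * ab.2) • insertAt (parityPart 𝒱 (γ₂ + ab.2) (ψ ab.2))
              (parityPart 𝒱 (γ₁ + ab.1) (φ ab.1)) p (fun i => proj 𝒱 (p i) (v i))) := by
      intro γ₁ γ₂
      rw [smul_add, smul_comm _ (ksign (γ₁ * γ₂ + 1)), sum_insertAt_parityPart hφ hψ γ₁ γ₂ hv,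
        sum_insertAt_parityPart hψ hφ γ₂ γ₁ hv, Finset.sum_add_distrib, Finset.smul_sum]
      congr 1
      -- In the second term of the commutator ψ is the outer map, so the two arities exchange roles.
      rw [← Finset.Nat.sum_antidiagonal_swap]
      refine Finset.sum_congr rfl fun ab _ => ?_
      rw [ksign_smul_ksign_smul]
      rfl
    rw [bracketList, Finset.smul_sum]
    simp only [Finset.smul_sum, e1]
    have e2 : ∀ F : ZMod 2 → ZMod 2 → ℕ × ℕ → V,
        ∑ γ₁, ∑ γ₂, ∑ ab ∈ Finset.HasAntidiagonal.antidiagonal d, F γ₁ γ₂ ab =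
          ∑ ab ∈ Finset.HasAntidiagonal.antidiagonal d, ∑ γ₁, ∑ γ₂, F γ₁ γ₂ ab := fun _ =>
      (Finset.sum_congr rfl fun _ _ => Finset.sum_comm).trans Finset.sum_comm
    rw [e2]
    refine Finset.sum_congr rfl fun ab _ => ?_
    refine Fintype.sum_equiv (Equiv.addRight (ab.1 : ZMod 2)) _ _ fun γ₁ => ?_
    refine Fintype.sum_equiv (Equiv.addRight (ab.2 : ZMod 2)) _ _ fun γ₂ => ?_
    simp only [Equiv.coe_addRight]
    rw [sub_eq_add_neg, neg_eq_ksign_smul, smul_add]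
    simp only [ksign_smul_ksign_smul]
    congr 1
    · rw [mul_comm]
    · refine ksign_smul_congr ?_ _
      generalize (ab.1 : ZMod 2) = x, (ab.2 : ZMod 2) = y
      clear * -
      decide +revert
  rw [extend]
  simp only [h1, modBracket, coderBracket, insertion]
  refine Eq.trans ?_ Finset.sum_comm
  refine Finset.sum_congr rfl fun ab _ => ?_
  refine Eq.trans ?_ Finset.sum_comm
  refine Finset.sum_congr rfl fun q _ => ?_
  refine Eq.trans ?_ Finset.sum_comm
  refine Finset.sum_congr rfl fun r _ => ?_
  rw [← Finset.smul_sum, Finset.sum_sub_distrib, Finset.smul_sum]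

theorem multiAdditive_modBracket {φ ψ : CochainFamily V} (hφ : InC K 𝒱 φ) (hψ : InC K 𝒱 ψ)
    (d : ℕ) : MultiAdditive (modBracket 𝒱 φ ψ d) := by
  have hφ' : ∀ d, MultiAdditive (φ d) := fun d => (hφ d).add
  have hψ' : ∀ d, MultiAdditive (ψ d) := fun d => (hψ d).add
  rw [modBracket_eq_extend hφ' hψ']
  exact multiAdditive_extend 0 (swapSymm_bracketList hφ hψ) (headAdditive_bracketList hφ' hψ') _

theorem cochainList_modBracket {φ ψ : CochainFamily V} (hφ : InC K 𝒱 φ) (hψ : InC K 𝒱 ψ)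
    {l : List (V × ZMod 2)} (hl : ∀ c ∈ l, Shifted 𝒱 c) :
    cochainList (modBracket 𝒱 φ ψ) l = bracketList 𝒱 φ ψ l := by
  have hφ' : ∀ d, MultiAdditive (φ d) := fun d => (hφ d).add
  have hψ' : ∀ d, MultiAdditive (ψ d) := fun d => (hψ d).add
  rw [cochainList, cochainSeq_eq_extend (bracketList_nil hφ' hψ') (modBracket_eq_extend hφ' hψ')]
  exact listForm_extend (swapSymm_bracketList hφ hψ) (headAdditive_bracketList hφ' hψ') hl

/-- The identity of `listComp_append_singleton`, summed over the homogeneous components of φ and ψ.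
-/
theorem tilde_modBracket (hV : IsSupermodule 𝒦 𝒱) (hip : IsInnerProduct 𝒦 𝒱 ip)
    {φ ψ : CochainFamily V} (hφ : φ ∈ CC 𝒱 ip) (hψ : ψ ∈ CC 𝒱 ip) :
    tilde ip (modBracket 𝒱 φ ψ) = act 𝒱 (tilde ip φ) ψ := by
  have hf := tilde_mem_forms hV hip hφ
  have hg := tilde_mem_forms hV hip hψ
  refine forms_ext (𝒱 := 𝒱) (multiAdditive_tilde (multiAdditive_modBracket hφ.1 hψ.1))
    (forms_multiAdditive (act_mem hV hf hψ.1)) fun l w hl hw => ?_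
  have hlw : ∀ c ∈ l ++ [w], Shifted 𝒱 c := by
    intro c hc
    simp only [List.mem_append, List.mem_cons, List.not_mem_nil, or_false] at hc
    rcases hc with hc | rfl
    exacts [hl c hc, hw]
  rw [formList_act hf hψ.1 hlw, formList, listForm_tilde]
  have h1 := cochainList_modBracket hφ.1 hψ.1 hl
  rw [cochainList] at h1
  -- Only ψ is split in the definition of the action; the form of φ must be split as well, since the
  -- commutator sign needs both degrees.
  have h2 : ∀ γ₂, listComp γ₂ (formList (tilde ip φ)) (homPart 𝒱 1 γ₂ (cochainList ψ)) (l ++ [w]) =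
      ∑ γ₁, listComp γ₂ (homPart 𝒦 0 γ₁ (formList (tilde ip φ)))
        (homPart 𝒱 1 γ₂ (cochainList ψ)) (l ++ [w]) := by
    intro γ₂
    simp only [listComp, koszulSum]
    rw [← unshuffleSum_sum]
    simp only [sum_homPart]
  have h3 : ∀ γ₁ γ₂, listComp γ₂ (homPart 𝒦 0 γ₁ (formList (tilde ip φ)))
      (homPart 𝒱 1 γ₂ (cochainList ψ)) (l ++ [w]) = ksign (w.2 + 1) •
        ip (listComp γ₂ (homPart 𝒱 1 γ₁ (cochainList φ)) (homPart 𝒱 1 γ₂ (cochainList ψ)) l +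
          ksign (γ₁ * γ₂ + 1) • listComp γ₁ (homPart 𝒱 1 γ₂ (cochainList ψ))
            (homPart 𝒱 1 γ₁ (cochainList φ)) l) w.1 := by
    intro γ₁ γ₂
    have e : ∀ x : V, ksign (γ₁ * γ₂ + 1) • x = -(ksign (γ₁ * γ₂) • x) := fun x => by
      rw [add_comm, ← ksign_smul_ksign_smul, ← neg_eq_ksign_smul]
    rw [e, ← sub_eq_add_neg]
    exact listComp_append_singleton hip γ₁ γ₂ (swapSymm_formList hf).homPart
      (swapSymm_formList hg).homPart hasDegree_homPart hasDegree_homPart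
      (fun l w _ hw => homPart_append_singleton hip γ₁ hw (listForm_tilde φ l w))
      (fun l w _ hw => homPart_append_singleton hip γ₂ hw (listForm_tilde ψ l w)) hl hw
  rw [h1, actList, bracketList, map_sum, AddMonoidHom.finsetSum_apply]
  simp only [h2, h3, map_sum, AddMonoidHom.finsetSum_apply, ← Finset.smul_sum]
  rw [Finset.sum_comm]

/-- No direct check of cyclicity is needed: the form of the bracket is an insertion, hence a
symmetric form, and the cochain of any symmetric form is cyclic. -/
theorem modBracket_mem (hV : IsSupermodule 𝒦 𝒱) (hip : IsInnerProduct 𝒦 𝒱 ip)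
    {φ ψ : CochainFamily V} (hφ : φ ∈ CC 𝒱 ip) (hψ : ψ ∈ CC 𝒱 ip) :
    modBracket 𝒱 φ ψ ∈ CC 𝒱 ip := by
  have h := act_mem hV (tilde_mem_forms hV hip hφ) hψ.1
  rw [← tilde_modBracket hV hip hφ hψ] at h
  rw [← sharp_eq_of_tilde hip (f := ⟨_, h⟩) rfl]
  exact sharp_mem hV hip _

end Action

end LInfty

namespace LInfty

set_option linter.unusedSectionVars false

/-! ### Linearity of the action and the bracket on forms -/

section Linearity

variable {K V : Type*} [Ring K] [AddCommGroup V] [Module K V] [Module Kᵐᵒᵖ V]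
  {𝒦 : ZMod 2 → AddSubgroup K} [GradedRing 𝒦] {𝒱 : ZMod 2 → AddSubgroup V}
  [DirectSum.Decomposition 𝒱] {ip : V →+ V →+ K}

theorem formSeq_add (f g : FormFamily V K) (N : ℕ) (v : Fin N → V) :
    formSeq (f + g) N v = formSeq f N v + formSeq g N v := by
  match N with
  | 0 => exact (add_zero 0).symm
  | 1 => exact (add_zero 0).symm
  | d + 2 => rfl

theorem formSeq_smul (t : K) (f : FormFamily V K) (N : ℕ) (v : Fin N → V) :
    formSeq (t • f) N v = t * formSeq f N v := by
  match N with
  | 0 => exact (mul_zero t).symm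
  | 1 => exact (mul_zero t).symm
  | d + 2 => rfl

theorem cochainSeq_add (φ ψ : CochainFamily V) (N : ℕ) (v : Fin N → V) :
    cochainSeq (φ + ψ) N v = cochainSeq φ N v + cochainSeq ψ N v := by
  match N with
  | 0 => exact (add_zero 0).symm
  | d + 1 => rfl

theorem formList_add (f g : FormFamily V K) (l : List (V × ZMod 2)) :
    formList (f + g) l = formList f l + formList g l := by
  rw [formList, listForm, formSeq_add, smul_add]
  rfl

theorem formList_zero (l : List (V × ZMod 2)) : formList (0 : FormFamily V K) l = 0 :=
  map_zero (AddMonoidHom.mk' (fun f : FormFamily V K => formList f l)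
    fun f g => formList_add f g l)

theorem formList_smul (t : K) (f : FormFamily V K) (l : List (V × ZMod 2)) :
    formList (t • f) l = t * formList f l := by
  rw [formList, listForm, formSeq_smul, ← mul_smul_comm]
  rfl

theorem formList_sum {ι : Type*} (s : Finset ι) (f : ι → FormFamily V K)
    (l : List (V × ZMod 2)) : formList (∑ i ∈ s, f i) l = ∑ i ∈ s, formList (f i) l :=
  map_sum (AddMonoidHom.mk' (fun f : FormFamily V K => formList f l)
    fun f g => formList_add f g l) f s

theorem formList_zsmul (n : ℤ) (f : FormFamily V K) (l : List (V × ZMod 2)) :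
    formList (n • f) l = n • formList f l :=
  map_zsmul (AddMonoidHom.mk' (fun f : FormFamily V K => formList f l)
    fun f g => formList_add f g l) n f

theorem cochainList_add (φ ψ : CochainFamily V) (l : List (V × ZMod 2)) :
    cochainList (φ + ψ) l = cochainList φ l + cochainList ψ l := by
  rw [cochainList, listForm, cochainSeq_add, smul_add]
  rfl

theorem actList_add_left (f g : FormFamily V K) (ψ : CochainFamily V) (l : List (V × ZMod 2)) :
    actList 𝒱 (f + g) ψ l = actList 𝒱 f ψ l + actList 𝒱 g ψ l := by
  rw [actList, actList, actList, ← Finset.sum_add_distrib]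
  refine Finset.sum_congr rfl fun γ _ => ?_
  rw [← listComp_add_left]
  congr 1
  exact funext (formList_add f g)

theorem actList_smul_left (t : K) (f : FormFamily V K) (ψ : CochainFamily V)
    (l : List (V × ZMod 2)) : actList 𝒱 (t • f) ψ l = t * actList 𝒱 f ψ l := by
  rw [actList, actList, Finset.mul_sum]
  refine Finset.sum_congr rfl fun γ _ => ?_
  have h := map_unshuffleSum (fun a b : V × ZMod 2 => ksign (a.2 * b.2)) (AddMonoidHom.mulLeft t) l fun T R =>
    formList f ((homPart 𝒱 1 γ (cochainList ψ) T, γ + label T) :: R)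
  simp only [AddMonoidHom.coe_mulLeft] at h
  rw [listComp, listComp, koszulSum, koszulSum, h]
  simp only [formList_smul]

theorem actList_add_right {f : FormFamily V K} (hf : ∀ d, MultiAdditive (f d))
    (φ ψ : CochainFamily V) (l : List (V × ZMod 2)) :
    actList 𝒱 f (φ + ψ) l = actList 𝒱 f φ l + actList 𝒱 f ψ l := by
  rw [actList, actList, actList, ← Finset.sum_add_distrib]
  refine Finset.sum_congr rfl fun γ _ => ?_
  rw [← listComp_add_right γ (headAdditive_formList hf)]
  congr 1
  funext l
  simp only [homPart, cochainList_add, proj_add]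

theorem act_add_left (f g : FormFamily V K) (ψ : CochainFamily V) :
    act 𝒱 (f + g) ψ = act 𝒱 f ψ + act 𝒱 g ψ := by
  funext d v
  simp only [act, extend, actList_add_left, smul_add, Finset.sum_add_distrib, Pi.add_apply]

theorem act_add_right {f : FormFamily V K} (hf : ∀ d, MultiAdditive (f d))
    (φ ψ : CochainFamily V) : act 𝒱 f (φ + ψ) = act 𝒱 f φ + act 𝒱 f ψ := by
  funext d v
  simp only [act, extend, actList_add_right hf, smul_add, Finset.sum_add_distrib, Pi.add_apply]

theorem act_smul_left (t : K) (f : FormFamily V K) (ψ : CochainFamily V) :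
    act 𝒱 (t • f) ψ = t • act 𝒱 f ψ := by
  funext d v
  simp only [act, extend, actList_smul_left, Pi.smul_apply, smul_eq_mul, Finset.mul_sum,
    mul_smul_comm]

theorem sharp_add (hip : IsInnerProduct 𝒦 𝒱 ip) (f g : Forms K 𝒱) :
    sharp hip (f + g) = sharp hip f + sharp hip g := by
  refine sharp_eq_of_tilde hip ?_
  rw [Submodule.coe_add, ← tilde_sharp hip f, ← tilde_sharp hip g]
  funext d v
  simp only [tilde, Pi.add_apply, map_add, AddMonoidHom.add_apply]

variable (𝒱 ip)

/-- The operation of a sequence of cochains on scalar valued cochains. -/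
def actHom (hV : IsSupermodule 𝒦 𝒱) {ψ : CochainFamily V} (hψ : InC K 𝒱 ψ) :
    Forms K 𝒱 →ₗ[K] Forms K 𝒱 where
  toFun f := ⟨act 𝒱 f.1 ψ, act_mem hV f.2 hψ⟩
  map_add' _ _ := Subtype.ext (act_add_left _ _ _)
  map_smul' _ _ := Subtype.ext (act_smul_left _ _ _)

variable {ip}

/-- The bracket on scalar valued cochains. -/
noncomputable def formBracket (hV : IsSupermodule 𝒦 𝒱) (hip : IsInnerProduct 𝒦 𝒱 ip) :
    Forms K 𝒱 →+ Forms K 𝒱 →+ Forms K 𝒱 :=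
  AddMonoidHom.mk' (fun f => AddMonoidHom.mk' (fun g => actHom 𝒱 hV (sharp_mem hV hip g).1 f)
    fun g g' => Subtype.ext (by
      change act 𝒱 f.1 _ = act 𝒱 f.1 _ + act 𝒱 f.1 _
      rw [sharp_add, act_add_right (forms_multiAdditive f.2)]))
    fun f f' => AddMonoidHom.ext fun g => map_add (actHom 𝒱 hV (sharp_mem hV hip g).1) f f'

variable {𝒱}

theorem forms_ext_of_list {f g : Forms K 𝒱} (h : ∀ l : List (V × ZMod 2), (∀ c ∈ l, Shifted 𝒱 c) →
    formList f.1 l = formList g.1 l) : f = g := by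
  refine Subtype.ext (forms_ext (𝒱 := 𝒱) (forms_multiAdditive f.2) (forms_multiAdditive g.2)
    fun l w hl hw => h _ fun c hc => ?_)
  simp only [List.mem_append, List.mem_cons, List.not_mem_nil, or_false] at hc
  rcases hc with hc | rfl
  exacts [hl c hc, hw]

end Linearity

/-! ### Degrees, antisymmetry and the action identity on forms -/

section Degree

variable {K V : Type*} [Ring K] [AddCommGroup V] [Module K V] [Module Kᵐᵒᵖ V]
  {𝒦 : ZMod 2 → AddSubgroup K} [GradedRing 𝒦] {𝒱 : ZMod 2 → AddSubgroup V}
  [DirectSum.Decomposition 𝒱] {ip : V →+ V →+ K}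

theorem hasDegree_cochainList {s : ZMod 2} {φ : CochainFamily V}
    (h : ∀ d : ℕ, HasParity 𝒱 𝒱 (s + d) (φ d)) : HasDegree 𝒱 𝒱 1 s (cochainList φ) := by
  intro l hl
  obtain ⟨v, p, e⟩ := exists_letters_eq l
  generalize l.length = N at v p e
  subst e
  rw [cochainList, listForm_letters, label_letters]
  refine (𝒱 _).zsmul_mem ?_ _
  match N with
  | 0 => exact zero_mem _
  | d + 1 =>
    have := h d v p (mem_of_shifted_letters hl)
    convert this using 1
    · refine congrArg _ ?_
      push_cast
      generalize ∑ i, p i = x, (d : ZMod 2) = y, s = z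
      clear * -
      decide +revert
    · rfl

theorem mem_totalParityPart_iff {s : ZMod 2} {f : Forms K 𝒱} :
    f ∈ totalParityPart 𝒦 𝒱 s ↔ HasDegree 𝒱 𝒦 0 s (formList f.1) := by
  constructor
  · intro h l hl
    obtain ⟨v, p, e⟩ := exists_letters_eq l
    generalize l.length = N at v p e
    subst e
    rw [formList, listForm_letters, label_letters]
    refine (𝒦 _).zsmul_mem ?_ _
    match N with
    | 0 => exact zero_mem _
    | 1 => exact zero_mem _
    | d + 2 =>
      have := h d v p (mem_of_shifted_letters hl)
      convert this using 1
      · refine congrArg _ ?_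
        push_cast
        generalize ∑ i, p i = x, (d : ZMod 2) = y, s = z
        clear * -
        decide +revert
      · rfl
  · intro h d v p hv
    have := h _ (shifted_of_mem_letters hv)
    rw [formList, listForm_letters, label_letters] at this
    have := (𝒦 _).zsmul_mem this (ksign (decalage 1 (letters v p)))
    rw [ksign_smul_self] at this
    convert this using 1
    · refine congrArg _ ?_
      push_cast
      generalize ∑ i, p i = x, (d : ZMod 2) = y, s = z
      clear * -
      decide +revert
    · rfl

theorem hasDegree_sharp (hip : IsInnerProduct 𝒦 𝒱 ip) {s : ZMod 2} {f : Forms K 𝒱}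
    (hf : f ∈ totalParityPart 𝒦 𝒱 s) : HasDegree 𝒱 𝒱 1 s (cochainList (sharp hip f)) := by
  intro l hl
  refine hip.mem_of_forall fun q w hw => ?_
  have hw' : Shifted 𝒱 (w, q + 1) := by simpa only [Shifted, add_one_add_one] using hw
  have h1 := mem_totalParityPart_iff.1 hf (l ++ [(w, q + 1)]) (by
    intro c hc
    simp only [List.mem_append, List.mem_cons, List.not_mem_nil, or_false] at hc
    rcases hc with hc | rfl
    exacts [hl c hc, hw'])
  rw [formList_append_singleton hip] at h1
  have h2 := (𝒦 _).zsmul_mem h1 (ksign (q + 1 + 1))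
  rw [ksign_smul_self] at h2
  convert h2 using 1
  refine congrArg _ ?_
  simp only [label_append, label_cons, label_nil]
  generalize label l = x
  clear * -
  decide +revert

theorem actList_of_hasDegree {f : FormFamily V K} (hf : ∀ d, MultiAdditive (f d)) {t : ZMod 2}
    {ψ : CochainFamily V} (hψ : HasDegree 𝒱 𝒱 1 t (cochainList ψ)) {l : List (V × ZMod 2)}
    (hl : ∀ c ∈ l, Shifted 𝒱 c) :
    actList 𝒱 f ψ l = listComp t (formList f) (cochainList ψ) l := by
  have hfa := headAdditive_formList hf
  rw [actList, Finset.sum_eq_single t]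
  · exact listComp_congr (𝒱 := 𝒱) hasDegree_homPart (fun _ _ => rfl)
      (fun l hl => homPart_of_hasDegree hψ hl) hl
  · intro γ _ hγ
    -- The vanishing component is written as a zero multiple so that additivity of insertion in its
    -- inner argument applies.
    rw [listComp_congr (𝒱 := 𝒱) (f' := formList f) (g' := fun l => (0 : ℤ) • cochainList ψ l)
      hasDegree_homPart (fun _ _ => rfl)
      (fun l hl => (homPart_of_hasDegree_ne hψ hγ hl).trans (zero_smul ℤ _).symm) hl,
      listComp_zsmul_right γ hfa, zero_smul]
  · simp

theorem formList_actHom (hV : IsSupermodule 𝒦 𝒱) {ψ : CochainFamily V} (hψ : InC K 𝒱 ψ)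
    {t : ZMod 2} (ht : HasDegree 𝒱 𝒱 1 t (cochainList ψ)) (f : Forms K 𝒱) {l : List (V × ZMod 2)}
    (hl : ∀ c ∈ l, Shifted 𝒱 c) :
    formList (actHom 𝒱 hV hψ f).1 l = listComp t (formList f.1) (cochainList ψ) l :=
  (formList_act f.2 hψ hl).trans (actList_of_hasDegree (forms_multiAdditive f.2) ht hl)

theorem actHom_mem (hV : IsSupermodule 𝒦 𝒱) {ψ : CochainFamily V} (hψ : InC K 𝒱 ψ)
    {s t : ZMod 2} (ht : HasDegree 𝒱 𝒱 1 t (cochainList ψ)) {f : Forms K 𝒱}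
    (hf : f ∈ totalParityPart 𝒦 𝒱 s) : actHom 𝒱 hV hψ f ∈ totalParityPart 𝒦 𝒱 (s + t) :=
  mem_totalParityPart_iff.2 fun l hl => by
    rw [formList_actHom hV hψ ht f hl]
    exact (mem_totalParityPart_iff.1 hf).listComp ht l hl

section Bracket

variable (hV : IsSupermodule 𝒦 𝒱) (hip : IsInnerProduct 𝒦 𝒱 ip)
include hV

theorem formBracket_mem {s t : ZMod 2} {f g : Forms K 𝒱} (hf : f ∈ totalParityPart 𝒦 𝒱 s)
    (hg : g ∈ totalParityPart 𝒦 𝒱 t) : formBracket 𝒱 hV hip f g ∈ totalParityPart 𝒦 𝒱 (s + t) :=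
  actHom_mem hV (sharp_mem hV hip g).1 (hasDegree_sharp hip hg) hf

theorem formList_formBracket {t : ZMod 2} (f : Forms K 𝒱) {g : Forms K 𝒱}
    (hg : g ∈ totalParityPart 𝒦 𝒱 t) {l : List (V × ZMod 2)} (hl : ∀ c ∈ l, Shifted 𝒱 c) :
    formList (formBracket 𝒱 hV hip f g).1 l =
      listComp t (formList f.1) (cochainList (sharp hip g)) l :=
  formList_actHom hV (sharp_mem hV hip g).1 (hasDegree_sharp hip hg) f hl

theorem formList_formBracket_append_singleton {s t : ZMod 2} {f g : Forms K 𝒱}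
    (hf : f ∈ totalParityPart 𝒦 𝒱 s) (hg : g ∈ totalParityPart 𝒦 𝒱 t) {l : List (V × ZMod 2)}
    {w : V × ZMod 2} (hl : ∀ c ∈ l, Shifted 𝒱 c) (hw : Shifted 𝒱 w) :
    formList (formBracket 𝒱 hV hip f g).1 (l ++ [w]) = ksign (w.2 + 1) •
      ip (listComp t (cochainList (sharp hip f)) (cochainList (sharp hip g)) l -
        ksign (s * t) • listComp s (cochainList (sharp hip g)) (cochainList (sharp hip f)) l) w.1 := by
  rw [formList_formBracket hV hip f hg (by
    intro c hc
    simp only [List.mem_append, List.mem_cons, List.not_mem_nil, or_false] at hc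
    rcases hc with hc | rfl
    exacts [hl c hc, hw])]
  exact listComp_append_singleton hip s t (swapSymm_formList f.2) (swapSymm_formList g.2)
    (hasDegree_sharp hip hf) (hasDegree_sharp hip hg)
    (fun l w _ _ => formList_append_singleton hip f l w)
    (fun l w _ _ => formList_append_singleton hip g l w) hl hw

/-- Non-degeneracy strips off the last letter: the cochain of the bracket is the graded commutator
of the cochains. -/
theorem cochainList_sharp_formBracket {s t : ZMod 2} {f g : Forms K 𝒱}
    (hf : f ∈ totalParityPart 𝒦 𝒱 s) (hg : g ∈ totalParityPart 𝒦 𝒱 t) {l : List (V × ZMod 2)}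
    (hl : ∀ c ∈ l, Shifted 𝒱 c) :
    cochainList (sharp hip (formBracket 𝒱 hV hip f g)) l =
      listComp t (cochainList (sharp hip f)) (cochainList (sharp hip g)) l -
        ksign (s * t) • listComp s (cochainList (sharp hip g)) (cochainList (sharp hip f)) l := by
  refine hip.ext_homogeneous fun q w hw => ?_
  have hw' : Shifted 𝒱 (w, q + 1) := by simpa only [Shifted, add_one_add_one] using hw
  have h := formList_formBracket_append_singleton hV hip hf hg hl hw'
  rw [formList_append_singleton hip, eq_ksign_smul_iff, ksign_smul_self] at h
  exact h

theorem formBracket_antisymm {s t : ZMod 2} {f g : Forms K 𝒱} (hf : f ∈ totalParityPart 𝒦 𝒱 s)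
    (hg : g ∈ totalParityPart 𝒦 𝒱 t) :
    formBracket 𝒱 hV hip f g = -(ksign (s * t) • formBracket 𝒱 hV hip g f) := by
  refine Subtype.ext (forms_ext (𝒱 := 𝒱) (forms_multiAdditive (formBracket 𝒱 hV hip f g).2)
    (forms_multiAdditive (-(ksign (s * t) • formBracket 𝒱 hV hip g f)).2) fun l w hl hw => ?_)
  rw [neg_eq_ksign_smul, Submodule.coe_smul_of_tower, Submodule.coe_smul_of_tower, formList_zsmul,
    formList_zsmul, formList_formBracket_append_singleton hV hip hf hg hl hw,
    formList_formBracket_append_singleton hV hip hg hf hl hw, mul_comm t s,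
    smul_comm _ (ksign (w.2 + 1)), smul_comm _ (ksign (w.2 + 1))]
  congr 1
  rw [← neg_eq_ksign_smul, map_sub, map_sub, AddMonoidHom.sub_apply, AddMonoidHom.sub_apply,
    smul_sub, map_zsmul, map_zsmul, AddMonoidHom.zsmul_apply, AddMonoidHom.zsmul_apply,
    ksign_smul_self, neg_sub]

/-- The action identity `listComp_bracket` on forms, with the inner bracket read as a commutator of
cochains. Since `f` is only acted upon, it need not be homogeneous. -/
theorem formBracket_formBracket {s t : ZMod 2} (f : Forms K 𝒱) {g h : Forms K 𝒱}
    (hg : g ∈ totalParityPart 𝒦 𝒱 s) (hh : h ∈ totalParityPart 𝒦 𝒱 t) :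
    formBracket 𝒱 hV hip (formBracket 𝒱 hV hip f g) h =
      formBracket 𝒱 hV hip f (formBracket 𝒱 hV hip g h) +
        ksign (s * t) • formBracket 𝒱 hV hip (formBracket 𝒱 hV hip f h) g := by
  have hgh := formBracket_mem hV hip hg hh
  refine forms_ext_of_list fun l hl => ?_
  have h1 := listComp_congr (𝒱 := 𝒱) (f := formList f.1) (hasDegree_sharp hip hgh)
    (fun _ _ => rfl) (fun l hl => cochainList_sharp_formBracket hV hip hg hh hl) hl
  rw [listComp_bracket s t (headAdditive_formList (forms_multiAdditive f.2)) (swapSymm_formList f.2)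
    (hasDegree_sharp hip hg) (hasDegree_sharp hip hh) hl] at h1
  rw [Submodule.coe_add, Submodule.coe_smul_of_tower, formList_add, formList_zsmul,
    formList_formBracket hV hip _ hh hl, formList_formBracket hV hip _ hgh hl,
    formList_formBracket hV hip _ hg hl, h1,
    listComp_congr (hasDegree_sharp hip hh) (fun l hl => formList_formBracket hV hip f hg hl)
      (fun _ _ => rfl) hl,
    listComp_congr (hasDegree_sharp hip hg) (fun l hl => formList_formBracket hV hip f hh hl)
      (fun _ _ => rfl) hl, sub_add_cancel]

end Bracket

end Degree

end LInfty

namespace LInfty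

set_option linter.unusedSectionVars false

/-! ### Graded Lie algebra structures and bihomogeneous components -/

section Lie

variable {K V : Type*} [Ring K] [AddCommGroup V] [Module K V] [Module Kᵐᵒᵖ V]
  {𝒦 : ZMod 2 → AddSubgroup K} [GradedRing 𝒦] {𝒱 : ZMod 2 → AddSubgroup V}
  [DirectSum.Decomposition 𝒱] {ip : V →+ V →+ K}

/-- The component of total parity `γ` of a sequence of scalar valued cochains. -/
def totalPart (hV : IsSupermodule 𝒦 𝒱) (γ : ZMod 2) (f : Forms K 𝒱) : Forms K 𝒱 :=
  ⟨fun d => extend 𝒱 1 (homPart 𝒦 0 γ (formList f.1)) (d + 2), fun d =>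
    isCochain_extend hV (swapSymm_formList f.2).homPart
      (headAdditive_formList (forms_multiAdditive f.2)).homPart
      ((headLinear_listForm hV 1 (isCochain_formSeq f.2)).homPart op_smul_mem_of_gradedRing)
      (d + 1)⟩

theorem formList_totalPart (hV : IsSupermodule 𝒦 𝒱) (γ : ZMod 2) (f : Forms K 𝒱)
    {l : List (V × ZMod 2)} (hl : ∀ c ∈ l, Shifted 𝒱 c) :
    formList (totalPart hV γ f).1 l = homPart 𝒦 0 γ (formList f.1) l := by
  have h0 : homPart 𝒦 0 γ (formList f.1) [] = 0 := by rw [homPart, formList_nil, proj_zero]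
  have h1 : ∀ a, homPart 𝒦 0 γ (formList f.1) [a] = 0 := fun a => by
    rw [homPart, formList_singleton, proj_zero]
  rw [formList, formSeq_eq_extend (f := (totalPart hV γ f).1) h0 h1 fun _ => rfl]
  exact listForm_extend (swapSymm_formList f.2).homPart
    (headAdditive_formList (forms_multiAdditive f.2)).homPart hl

theorem totalPart_mem (hV : IsSupermodule 𝒦 𝒱) (γ : ZMod 2) (f : Forms K 𝒱) :
    totalPart hV γ f ∈ totalParityPart 𝒦 𝒱 γ :=
  mem_totalParityPart_iff.2 fun l hl => by
    rw [formList_totalPart hV γ f hl]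
    exact hasDegree_homPart l hl

theorem sum_totalPart (hV : IsSupermodule 𝒦 𝒱) (f : Forms K 𝒱) : ∑ γ, totalPart hV γ f = f :=
  forms_ext_of_list fun l hl => by
    rw [Submodule.coe_sum, formList_sum]
    simp only [formList_totalPart hV _ f hl, sum_homPart]

/-- Antisymmetry turns the action identity into the Jacobi identity. It needs the degree of `h`, so
`h` is decomposed by total parity. -/
theorem formBracket_jacobi (hV : IsSupermodule 𝒦 𝒱) (hip : IsInnerProduct 𝒦 𝒱 ip)
    {s t : ZMod 2} {f g : Forms K 𝒱} (hf : f ∈ totalParityPart 𝒦 𝒱 s)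
    (hg : g ∈ totalParityPart 𝒦 𝒱 t) (h : Forms K 𝒱) :
    formBracket 𝒱 hV hip f (formBracket 𝒱 hV hip g h) =
      formBracket 𝒱 hV hip (formBracket 𝒱 hV hip f g) h +
        ksign (s * t) • formBracket 𝒱 hV hip g (formBracket 𝒱 hV hip f h) := by
  have key : ∀ γ, formBracket 𝒱 hV hip f (formBracket 𝒱 hV hip g (totalPart hV γ h)) =
      formBracket 𝒱 hV hip (formBracket 𝒱 hV hip f g) (totalPart hV γ h) +
        ksign (s * t) • formBracket 𝒱 hV hip g (formBracket 𝒱 hV hip f (totalPart hV γ h)) := by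
    intro γ
    have hh := totalPart_mem hV γ h
    rw [formBracket_formBracket hV hip f hg hh,
      formBracket_antisymm hV hip (formBracket_mem hV hip hf hh) hg, neg_eq_ksign_smul]
    simp only [ksign_smul_ksign_smul]
    have e : ksign (t * γ + (1 + (s + γ) * t)) • formBracket 𝒱 hV hip g
        (formBracket 𝒱 hV hip f (totalPart hV γ h)) = -(ksign (s * t) • formBracket 𝒱 hV hip g
          (formBracket 𝒱 hV hip f (totalPart hV γ h))) := by
      rw [neg_eq_ksign_smul, ksign_smul_ksign_smul]
      refine ksign_smul_congr ?_ _
      clear * -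
      decide +revert
    rw [e, neg_add_cancel_right]
  rw [← sum_totalPart hV h]
  simp only [map_sum, key, Finset.sum_add_distrib, Finset.smul_sum]

theorem isGradedLieBracket_total (hV : IsSupermodule 𝒦 𝒱) (hip : IsInnerProduct 𝒦 𝒱 ip) :
    IsGradedLieBracket K (totalParityPart 𝒦 𝒱) (fun s t => s * t) (formBracket 𝒱 hV hip) where
  mem _ _ _ _ hf hg := formBracket_mem hV hip hf hg
  smul_left t f g := map_smul (actHom 𝒱 hV (sharp_mem hV hip g).1) t f
  antisymm _ _ _ _ hf hg := formBracket_antisymm hV hip hf hg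
  jacobi _ _ _ _ h hf hg := formBracket_jacobi hV hip hf hg h

theorem mem_totalParityPart_of_mem_bidegreePart {g : ZMod 2 × ℤ} {f : Forms K 𝒱}
    (hf : f ∈ bidegreePart 𝒦 𝒱 g) : f ∈ totalParityPart 𝒦 𝒱 (g.1 + (g.2 : ZMod 2)) := by
  intro d
  by_cases hd : (d : ℤ) = g.2
  · have h := hf.2 d
    have e : g.1 + (g.2 : ZMod 2) + d = g.1 := by
      rw [← hd, Int.cast_natCast, add_assoc, CharTwo.add_self_eq_zero, add_zero]
    rwa [e]
  · intro v p _
    rw [hf.1 d hd]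
    exact zero_mem _

theorem mem_bidegreePart {q : ZMod 2} {n : ℤ} {f : Forms K 𝒱}
    (hf : f ∈ totalParityPart 𝒦 𝒱 (q + (n : ZMod 2))) (h : ∀ d : ℕ, (d : ℤ) ≠ n → f.1 d = 0) :
    f ∈ bidegreePart 𝒦 𝒱 (q, n) := by
  refine ⟨h, fun d => ?_⟩
  by_cases hd : (d : ℤ) = n
  · have h := hf d
    have e : q + (n : ZMod 2) + d = q := by
      rw [← hd, Int.cast_natCast, add_assoc, CharTwo.add_self_eq_zero, add_zero]
    rwa [e] at h
  · intro v p _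
    rw [h d hd]
    exact zero_mem _

theorem sharp_eq_zero (hip : IsInnerProduct 𝒦 𝒱 ip) {f : Forms K 𝒱} {d : ℕ} (h : f.1 d = 0) :
    sharp hip f d = 0 := by
  funext v
  refine hip.ext fun w => ?_
  rw [ip_sharp, h, Pi.zero_apply, Pi.zero_apply, map_zero, AddMonoidHom.zero_apply]

/-- Exterior degrees add under insertion, so each summand in degree `d` contains a vanishing factor.
-/
theorem formBracket_apply_eq_zero (hV : IsSupermodule 𝒦 𝒱) (hip : IsInnerProduct 𝒦 𝒱 ip)
    {m n : ℤ} {f g : Forms K 𝒱} (hf : ∀ d : ℕ, (d : ℤ) ≠ m → f.1 d = 0)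
    (hg : ∀ d : ℕ, (d : ℤ) ≠ n → g.1 d = 0) {d : ℕ} (hd : (d : ℤ) ≠ m + n) :
    (formBracket 𝒱 hV hip f g).1 d = 0 := by
  refine (forms_multiAdditive (formBracket 𝒱 hV hip f g).2 d).ext 𝒱
    (fun _ _ _ _ => (add_zero 0).symm) fun v p hv => ?_
  refine (act_apply f.2 (sharp_mem hV hip g).1 hv).trans
    (Finset.sum_eq_zero fun ab hab => Finset.sum_eq_zero fun γ _ => ?_)
  rw [Finset.HasAntidiagonal.mem_antidiagonal] at hab
  by_cases ha : (ab.1 : ℤ) = m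
  · have hb : (ab.2 : ℤ) ≠ n := fun hb => hd (by rw [← hab, ← ha, ← hb]; push_cast; rfl)
    have h0 : parityPart 𝒱 (γ + ab.2) (sharp hip g ab.2) = 0 := by
      funext v
      simp only [parityPart, sharp_eq_zero hip (hg _ hb), Pi.zero_apply, proj_zero,
        Finset.sum_const_zero]
    rw [h0, insertAt_zero_right (forms_multiAdditive f.2 _), smul_zero]
  · rw [hf _ ha, insertAt_zero_left, smul_zero]

theorem isGradedLieBracket_bidegree (hV : IsSupermodule 𝒦 𝒱) (hip : IsInnerProduct 𝒦 𝒱 ip) :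
    IsGradedLieBracket K (bidegreePart 𝒦 𝒱) totalForm (formBracket 𝒱 hV hip) where
  mem g h f f' hf hf' := by
    refine mem_bidegreePart ?_ fun d hd => formBracket_apply_eq_zero hV hip hf.1 hf'.1 hd
    have := formBracket_mem hV hip (mem_totalParityPart_of_mem_bidegreePart hf)
      (mem_totalParityPart_of_mem_bidegreePart hf')
    rw [Int.cast_add, add_add_add_comm]
    exact this
  smul_left := (isGradedLieBracket_total hV hip).smul_left
  antisymm _ _ _ _ hf hg := formBracket_antisymm hV hip
    (mem_totalParityPart_of_mem_bidegreePart hf) (mem_totalParityPart_of_mem_bidegreePart hg)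
  jacobi _ _ _ _ h hf hg := formBracket_jacobi hV hip
    (mem_totalParityPart_of_mem_bidegreePart hf) (mem_totalParityPart_of_mem_bidegreePart hg) h

/-- The component of exterior degree `d`. -/
def truncate (d : ℕ) (f : Forms K 𝒱) : Forms K 𝒱 :=
  ⟨fun e => if e = d then f.1 e else 0, fun e => by
    dsimp only
    split_ifs
    exacts [f.2 e, (Forms K 𝒱).zero_mem e]⟩

theorem truncate_mem {d : ℕ} {s : ZMod 2} {f : Forms K 𝒱} (hf : f ∈ totalParityPart 𝒦 𝒱 s) :
    truncate d f ∈ totalParityPart 𝒦 𝒱 s := by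
  intro e v p hv
  change (if e = d then f.1 e else 0) v ∈ _
  split_ifs
  exacts [hf e v p hv, zero_mem _]

theorem eq_of_sum_eq_of_hasParity {N : ℕ} {F G : ZMod 2 → (Fin N → V) → K}
    (hF : ∀ q, MultiAdditive (F q)) (hG : ∀ q, MultiAdditive (G q))
    (hFq : ∀ q, HasParity 𝒱 𝒦 q (F q)) (hGq : ∀ q, HasParity 𝒱 𝒦 q (G q))
    (h : ∑ q, F q = ∑ q, G q) : F = G := by
  funext q
  refine (hF q).ext 𝒱 (hG q) fun v p hv => ?_
  have key : ∀ {F : ZMod 2 → (Fin N → V) → K}, (∀ q, HasParity 𝒱 𝒦 q (F q)) →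
      proj 𝒦 (q + ∑ i, p i) ((∑ q, F q) v) = F q v := by
    intro F hFq
    have := map_sum (projHom 𝒦 (q + ∑ i, p i)) (fun q => F q v) Finset.univ
    rw [Finset.sum_apply]
    refine this.trans ((Finset.sum_eq_single q ?_ (by simp)).trans (proj_of_mem 𝒦 (hFq q v p hv)))
    intro q' _ hq'
    exact proj_of_mem_ne 𝒦 (hFq q' v p hv) fun h => hq' (add_right_cancel h)
  rw [← key hFq, h, key hGq]

theorem existsUnique_bihomogeneous (hV : IsSupermodule 𝒦 𝒱) (f : Forms K 𝒱) :
    ∃! c : ZMod 2 → ℕ → Forms K 𝒱,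
      (∀ (q : ZMod 2) (d : ℕ), c q d ∈ bidegreePart 𝒦 𝒱 (q, (d : ℤ))) ∧
        ∀ d : ℕ, f.1 d = ∑ q : ZMod 2, (c q d).1 d := by
  refine existsUnique_of_exists_of_unique
    -- Parity q in exterior degree d is total parity q + d, cut down to that degree.
    ⟨fun q d => truncate d (totalPart hV (q + d) f), fun q d => ?_, fun d => ?_⟩ ?_
  · refine mem_bidegreePart ?_ fun e he => if_neg fun h => he (by rw [h])
    rw [Int.cast_natCast]
    exact truncate_mem (totalPart_mem hV _ f)
  · conv_lhs => rw [← sum_totalPart hV f, Submodule.coe_sum, Finset.sum_apply]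
    exact (Fintype.sum_equiv (Equiv.addRight (d : ZMod 2)) _ _ fun q => if_pos rfl).symm
  · rintro c c' ⟨hc, hs⟩ ⟨hc', hs'⟩
    have key : ∀ d, (fun q => (c q d).1 d) = fun q => (c' q d).1 d := fun d =>
      eq_of_sum_eq_of_hasParity (𝒦 := 𝒦) (𝒱 := 𝒱) (fun q => forms_multiAdditive (c q d).2 d)
        (fun q => forms_multiAdditive (c' q d).2 d) (fun q => (hc q d).2 d)
        (fun q => (hc' q d).2 d) ((hs d).symm.trans (hs' d))
    funext q d
    refine Subtype.ext (funext fun e => ?_)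
    by_cases he : e = d
    · subst he
      exact congrFun (key e) q
    · have he' : (e : ℤ) ≠ d := fun h => he (Int.natCast_inj.1 h)
      rw [(hc q d).1 e he', (hc' q d).1 e he']

end Lie

/-! ### The differential of an L_∞ structure -/

section Differential

variable {K V : Type*} [Ring K] [AddCommGroup V] [Module K V] [Module Kᵐᵒᵖ V]
  {𝒦 : ZMod 2 → AddSubgroup K} [GradedRing 𝒦] {𝒱 : ZMod 2 → AddSubgroup V}
  [DirectSum.Decomposition 𝒱] {ip : V →+ V →+ K}

/-- `K` need not be a domain, but 2 lies in the even part, a field of characteristic zero, and so is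
invertible. -/
theorem eq_zero_of_eq_neg [CharZero K] (hK0 : IsField (𝒦 0)) {x : K} (h : x = -x) : x = 0 := by
  have h2 : (2 : 𝒦 0) ≠ 0 := fun h => by
    have := congrArg (Subtype.val : 𝒦 0 → K) h
    exact two_ne_zero this
  obtain ⟨y, hy⟩ := hK0.mul_inv_cancel h2
  have hy' : (2 : K) * y = 1 := congrArg (Subtype.val : 𝒦 0 → K) hy
  have hx : x * 2 = 0 := by rw [mul_two]; nth_rw 1 [h]; exact neg_add_cancel x
  rw [← mul_one x, ← hy', ← mul_assoc, hx, zero_mul]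

theorem IsLInfty.hasDegree {φ : CochainFamily V} (h : IsLInfty K 𝒱 φ) :
    HasDegree 𝒱 𝒱 1 1 (cochainList φ) :=
  hasDegree_cochainList fun d => by
    rw [add_comm]
    exact h.parity d

/-- The parity of l_k makes `l` homogeneous of total degree one, and all L_∞ relations together say
l∘l = 0 on lists. -/
theorem IsLInfty.listComp_eq_zero {φ : CochainFamily V} (h : IsLInfty K 𝒱 φ)
    {l : List (V × ZMod 2)} (hl : ∀ c ∈ l, Shifted 𝒱 c) :
    listComp 1 (cochainList φ) (cochainList φ) l = 0 := by
  have ha := headAdditive_cochainList fun d => (h.cochain d).add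
  obtain ⟨v, p, e⟩ := exists_letters_eq l
  generalize l.length = N at v p e
  subst e
  match N with
  | 0 =>
    change cochainList φ [(cochainList φ [], _)] = 0
    rw [cochainList_nil, ha.zero]
  | d + 1 =>
    have h1 := sum_insertAt 0 1 ha (G := cochainSeq φ) rfl v p
    have h2 := h.relation d v p (mem_of_shifted_letters hl)
    rw [eq_ksign_smul_iff] at h1
    rw [← h1]
    convert smul_zero (ksign (decalage 0 (letters v p))) using 2
    refine Eq.trans (Finset.sum_congr rfl fun ab _ => ?_) h2
    rw [add_zero, mul_comm, add_comm 1 (ab.2 : ZMod 2)]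
    rfl

theorem actHom_actHom [CharZero K] (hK0 : IsField (𝒦 0)) (hV : IsSupermodule 𝒦 𝒱)
    {φ : CochainFamily V} (h : IsLInfty K 𝒱 φ) (f : Forms K 𝒱) :
    actHom 𝒱 hV h.cochain (actHom 𝒱 hV h.cochain f) = 0 := by
  have hd := h.hasDegree
  have hfa := headAdditive_formList (forms_multiAdditive f.2)
  refine forms_ext_of_list fun l hl => ?_
  rw [formList_actHom hV h.cochain hd _ hl,
    listComp_congr hd (fun l hl => formList_actHom hV h.cochain hd f hl) (fun _ _ => rfl) hl,
    listComp_listComp 1 1 hfa,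
    listComp_congr (𝒱 := 𝒱) (f' := formList f.1) (g' := fun l => (0 : ℤ) • cochainList φ l)
      (hd.listComp hd) (fun _ _ => rfl)
      (fun l hl => (h.listComp_eq_zero hl).trans (zero_smul ℤ _).symm) hl,
    listComp_zsmul_right _ hfa, zero_smul, zero_add]
  -- What is left has both copies of `l` in separate arguments of `f`; exchanging two copies of
  -- degree one changes its sign.
  refine (eq_zero_of_eq_neg hK0 ?_).trans (formList_zero l).symm
  rw [neg_eq_ksign_smul]
  exact listPair_swap 1 1 (swapSymm_formList f.2) hd hd hl

theorem isDifferential_actHom [CharZero K] (hK0 : IsField (𝒦 0)) (hV : IsSupermodule 𝒦 𝒱)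
    {φ : CochainFamily V} (h : IsLInfty K 𝒱 φ) :
    IsDifferential (totalParityPart 𝒦 𝒱) (actHom 𝒱 hV h.cochain) :=
  ⟨fun _ _ hf => actHom_mem hV h.cochain h.hasDegree hf, actHom_actHom hK0 hV h⟩

end Differential

end LInfty

/-! ### The theorem -/

open LInfty in
theorem mainTheorem6 {K V : Type*} [Ring K] [CharZero K]
    (𝒦 : ZMod 2 → AddSubgroup K) [GradedRing 𝒦] (hK : IsSupercommutative 𝒦)
    (hK0 : IsField (𝒦 0))
    [AddCommGroup V] [Module K V] [Module Kᵐᵒᵖ V]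
    (𝒱 : ZMod 2 → AddSubgroup V) [DirectSum.Decomposition 𝒱] (hV : IsSupermodule 𝒦 𝒱)
    (ip : V →+ V →+ K) (hip : IsInnerProduct 𝒦 𝒱 ip) :
    -- the bracket preserves cyclic cochains
    (∀ φ ∈ CC 𝒱 ip, ∀ ψ ∈ CC 𝒱 ip, modBracket 𝒱 φ ψ ∈ CC 𝒱 ip) ∧
    -- the unshuffle formula, for `ψ` with homogeneous components `ψ_l` of parity `q l`
    (∀ φ ∈ CC 𝒱 ip, ∀ ψ ∈ CC 𝒱 ip, ∀ q : ℕ → ZMod 2, (∀ b, HasParity 𝒱 𝒱 (q b) (ψ b)) →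
      ∀ (d : ℕ) (v : Fin (d + 2) → V) (p : Fin (d + 2) → ZMod 2), (∀ i, v i ∈ 𝒱 (p i)) →
        tilde ip (modBracket 𝒱 φ ψ) d v =
          ∑ ab ∈ Finset.HasAntidiagonal.antidiagonal d, ksign ((ab.1 : ZMod 2) * q ab.2) •
            insertAt (tilde ip φ ab.1) (ψ ab.2) p v) ∧
    -- `φ ↦ φ̃` identifies `CC(V)` with the module of scalar valued cochains, which is
    -- the product of its bihomogeneous parts
    Set.BijOn (tilde ip) (CC 𝒱 ip) (Forms K 𝒱 : Set (FormFamily V K)) ∧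
    (∀ f : Forms K 𝒱, ∃! c : ZMod 2 → ℕ → Forms K 𝒱,
      (∀ (q : ZMod 2) (d : ℕ), c q d ∈ bidegreePart 𝒦 𝒱 (q, (d : ℤ))) ∧
        ∀ d : ℕ, f.1 d = ∑ q : ZMod 2, (c q d).1 d) ∧
    -- the induced graded Lie algebra
    ∃ B : Forms K 𝒱 →+ Forms K 𝒱 →+ Forms K 𝒱,
      (∀ φ ∈ CC 𝒱 ip, ∀ ψ ∈ CC 𝒱 ip, ∀ f g : Forms K 𝒱, f.1 = tilde ip φ → g.1 = tilde ip ψ →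
        (B f g).1 = tilde ip (modBracket 𝒱 φ ψ)) ∧
      IsGradedLieBracket K (bidegreePart 𝒦 𝒱) totalForm B ∧
      IsGradedLieBracket K (totalParityPart 𝒦 𝒱) (fun s t => s * t) B ∧
      -- the differential of an `L_∞` structure
      ∀ l : CochainFamily V, IsLInfty K 𝒱 l →
        ∃ D : Forms K 𝒱 →ₗ[K] Forms K 𝒱,
          (∀ φ ∈ CC 𝒱 ip, ∀ f : Forms K 𝒱, f.1 = tilde ip φ →
            ∀ (d : ℕ) (v : Fin (d + 2) → V) (p : Fin (d + 2) → ZMod 2), (∀ i, v i ∈ 𝒱 (p i)) →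
              (D f).1 d v =
                ∑ ab ∈ Finset.HasAntidiagonal.antidiagonal d, ksign ((ab.1 : ZMod 2) * ((ab.2 : ZMod 2) + 1)) •
                  insertAt (tilde ip φ ab.1) (l ab.2) p v) ∧
          IsDifferential (totalParityPart 𝒦 𝒱) D ∧
          -- the case of an invariant inner product
          ((∀ d, IsCyclic 𝒱 ip (l d)) →
            (∀ f g : Forms K 𝒱, g.1 = tilde ip l → D f = B f g) ∧
            IsDGLie (totalParityPart 𝒦 𝒱) B D) := by 
  have hCC := fun φ hφ ψ hψ => modBracket_mem hV hip (φ := φ) (ψ := ψ) hφ hψ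
  refine ⟨hCC, fun φ hφ ψ hψ q hq d v p hv => ?_, bijOn_tilde hV hip,
    existsUnique_bihomogeneous hV, formBracket 𝒱 hV hip, fun φ hφ ψ hψ f g hf hg => ?_,
    isGradedLieBracket_bidegree hV hip, isGradedLieBracket_total hV hip, fun l hl =>
      ⟨actHom 𝒱 hV hl.cochain, fun φ _ f hf d v p hv => ?_, isDifferential_actHom hK0 hV hl,
        fun hcyc => ?_⟩⟩
  · rw [tilde_modBracket hV hip hφ hψ]
    exact act_apply_of_hasParity (tilde_mem_forms hV hip hφ) hψ.1 hq hv
  · rw [tilde_modBracket hV hip hφ hψ, ← hf, ← sharp_eq_of_tilde hip hg]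
    rfl
  · rw [← hf]
    exact act_apply_of_hasParity f.2 hl.cochain hl.parity hv
  · have hD : ∀ f g : Forms K 𝒱, g.1 = tilde ip l →
        actHom 𝒱 hV hl.cochain f = formBracket 𝒱 hV hip f g := fun f g hg =>
      Subtype.ext (congrArg (act 𝒱 f.1) (sharp_eq_of_tilde hip hg).symm)
    refine ⟨hD, isGradedLieBracket_total hV hip, isDifferential_actHom hK0 hV hl,
      fun s f g hg => ?_⟩
    let h : Forms K 𝒱 := ⟨tilde ip l, tilde_mem_forms hV hip ⟨hl.cochain, hcyc⟩⟩
    have hh : h ∈ totalParityPart 𝒦 𝒱 1 := fun d v p hv => by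
      have := hip.even _ _ _ _ (hl.parity d _ _ fun i => hv i.castSucc) (hv (Fin.last (d + 1)))
      rwa [add_assoc, ← Fin.sum_univ_castSucc, add_comm (d : ZMod 2)] at this
    -- With D = {·, l̃} and l̃ of total parity one, the derivation rule is the action identity for
    -- `g` and `l̃`.
    rw [hD _ h rfl, hD _ h rfl, hD _ h rfl, formBracket_formBracket hV hip f hg hh, mul_one]
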